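/- **Definitions.** A *partial Heegaard diagram* $\mathcal H$ is a compact oriented smooth surface $H$ with (possibly empty) boundary, with two finite families of circles (the $\alpha$ and $\beta$ circles) smoothly embedded in $H\setminus\partial H$, two finite families of compact intervals (the $\alpha$ and $\beta$ arcs) smoothly embedded in $H$, meeting $\partial H$ exactly in their endpoints and transversely there, and a finite set of basepoints in $H\setminus\partial H$, off all curves, each labelled $X$ or $O$; the $\alpha$ curves (circles and arcs) are pairwise disjoint, so are the $\beta$ curves, and $\alpha$ and $\beta$ curves meet only transversely and in $H\setminus\partial H$. Diagrams are considered up to ambient isotopy of $H$ fixing $\partial H$ pointwise and carrying along all curves and basepoints. *Gluing.* Let $Z\subset\partial H$ and $Z'\subset\partial H'$ be unions of boundary components and $\varphi:Z\to Z'$ an orientation-reversing diffeomorphism that restricts to a bijection between the endpoints of $\alpha$ arcs and to a bijection between the endpoints of $\beta$ arcs. A partial Heegaard diagram $\mathcal H''$ is obtained by gluing $\mathcal H$ and $\mathcal H'$ along $\varphi$, via orientation-preserving smooth embeddings $i:H\to H''$ and $i':H'\to H''$, if $i(H)\cup i'(H')=H''$, $i(p)=i'(q)$ exactly when $p\in Z$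 and $q=\varphi(p)$, $\partial H''=i(\partial H\setminus Z)\cup i'(\partial H'\setminus Z')$, and the union of the $\alpha$ curves, the union of the $\beta$ curves, the set of $X$ basepoints and the set of $O$ basepoints of $\mathcal H''$ are the unions of the images of those of $\mathcal H$ and $\mathcal H'$. *Heegaard moves.* (1) Isotopies of the $\alpha$ curves and, independently, of the $\beta$ curves, constant near $\partial H$ and not passing over basepoints. (2) Index one/two stabilizations and their inverses: in an open rectangle in $H\setminus\partial H$ without basepoints and $\alpha$ curves, crossed by $n\ge 0$ parallel strands of $\beta$ curves, two closed disks on the two sides of the strands are removed and replaced by a handle; the belt circle of the handle is a new $\beta$ circle, and a circle that runs once over the handle and returns across the strands is a new $\alpha$ circle. The same with $\alpha$ and $\beta$ interchanged is allowed. (3) Index zero/three stabilizations and their inverses: in an open disk without curves that contains exactly one basepoint, of type $X$, one adds an $\alpha$ circle and a $\beta$ circle bounding disks $D_\alpha$, $D_\beta$ and meeting in two points, an $O$ basepoint in $D_\alpha\cap D_\beta$ and a second $X$ basepoint, so that one $X$ lies in $D_\alpha\setminus D_\beta$ and the other in $D_\beta\setminus D_\alpha$. The same with $X$ and $O$ interchanged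 is allowed. (4) Handleslides of an $\alpha$ circle $A$ over another $\alpha$ circle $B$: $A$ is replaced by a circle $A'$ such that $A$, $B$, $A'$ bound a pair of pants embedded in $H\setminus\partial H$ that contains no basepoints and no other points of $\alpha$ curves; likewise for $\beta$. Every move keeps the boundary fixed, so a sequence of moves from $\mathcal H$ to $\tilde{\mathcal H}$ gives a diffeomorphism $b:\partial H\to\partial\tilde H$. The *type* of a move is: isotopy; index one/two stabilization or destabilization, with the family of curves that contains the circle running over the handle; index zero/three stabilization or destabilization, with the label of the original basepoint; or handleslide, with the family of curves that is slid. **Proposition.** Let $\mathcal H$, $\mathcal H'$ be partial Heegaard diagrams, let sequences of Heegaard moves of types $L$ and $L'$ transform $\mathcal H$ into $\tilde{\mathcal H}$ and $\mathcal H'$ into $\tilde{\mathcal H}'$, and let $b:\partial H\to\partial\tilde H$ and $b':\partial H'\to\partial\tilde H'$ be the resulting identifications of the boundaries. Suppose that $\mathcal H''$ is obtained by gluing $\mathcal H$ and $\mathcal H'$ along $\varphi:Z\to Z'$, via $i$ and $i'$. Then $\tilde{\mathcal H}$ and $\tilde{\mathcal H}'$ can be glued along $\tilde\varphi=b'\circ\varphi\circ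 b^{-1}:b(Z)\to b'(Z')$, and there is a partial Heegaard diagram $\tilde{\mathcal H}''$ obtained by gluing them along $\tilde\varphi$, via embeddings $j$ and $j'$, such that a sequence of Heegaard moves whose list of types is $L$ followed by $L'$ transforms $\mathcal H''$ into $\tilde{\mathcal H}''$. The resulting identification $b''$ of the boundaries satisfies $b''\circ i=j\circ b$ on $\partial H\setminus Z$ and $b''\circ i'=j'\circ b'$ on $\partial H'\setminus Z'$. -/

import Mathlib

open scoped Manifold ContDiff Topology

universe u

/-- A compact oriented smooth surface with (possibly empty) boundary.  The orientation is the one for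
which all preferred charts `chartAt _ x` are positively oriented; compatibility means that the changes
of coordinates between preferred charts have positive Jacobian. -/
structure OrientedSurface where
  carrier : Type u
  [top : TopologicalSpace carrier]
  [charted : ChartedSpace (EuclideanHalfSpace 2) carrier]
  [smooth : IsManifold (𝓡∂ 2) ∞ carrier]
  [t2 : T2Space carrier]
  [compact : CompactSpace carrier]
  oriented : ∀ x y z : carrier,
    z ∈ (chartAt (EuclideanHalfSpace 2) x).source → z ∈ (chartAt (EuclideanHalfSpace 2) y).source →
      0 < (tangentCoordChange (𝓡∂ 2) x y z).det

namespace OrientedSurface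

instance : CoeSort OrientedSurface.{u} (Type u) := ⟨OrientedSurface.carrier⟩

instance (S : OrientedSurface.{u}) : TopologicalSpace S := S.top

instance (S : OrientedSurface.{u}) : ChartedSpace (EuclideanHalfSpace 2) S := S.charted

instance (S : OrientedSurface.{u}) : IsManifold (𝓡∂ 2) ∞ S := S.smooth

instance (S : OrientedSurface.{u}) : T2Space S := S.t2

instance (S : OrientedSurface.{u}) : CompactSpace S := S.compact

/-- The set of boundary points of the surface. -/
def bdry (S : OrientedSurface.{u}) : Set S := (𝓡∂ 2).boundary S

/-- The set of interior points of the surface. -/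
def inner (S : OrientedSurface.{u}) : Set S := (𝓡∂ 2).interior S

end OrientedSurface

/-- The Jacobian determinant at `p` of a map of surfaces, in the preferred charts at `p` and `f p`. -/
noncomputable def jacobian {S T : OrientedSurface.{u}} (f : S → T) (p : S) : ℝ :=
  ContinuousLinearMap.det
    (mfderiv (𝓡∂ 2) (𝓡∂ 2) f p : EuclideanSpace ℝ (Fin 2) →L[ℝ] EuclideanSpace ℝ (Fin 2))

/-- The Jacobian determinant at `z` of a map from the plane `ℂ` (with its positively oriented
basis `1, i`) to a surface, in the preferred chart at `f z`. -/
noncomputable def planeJacobian {S : OrientedSurface.{u}} (f : ℂ → S) (z : ℂ) : ℝ :=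
  let v : EuclideanSpace ℝ (Fin 2) := mfderiv 𝓘(ℝ, ℂ) (𝓡∂ 2) f z (1 : ℂ)
  let w : EuclideanSpace ℝ (Fin 2) := mfderiv 𝓘(ℝ, ℂ) (𝓡∂ 2) f z Complex.I
  v 0 * w 1 - v 1 * w 0

/-- The velocity vector of a curve, in the preferred chart at the point `γ t`. -/
noncomputable def velocity {S : OrientedSurface.{u}} (γ : ℝ → S) (t : ℝ) :
    EuclideanSpace ℝ (Fin 2) :=
  mfderiv 𝓘(ℝ, ℝ) (𝓡∂ 2) γ t (1 : ℝ)

/-- The velocity vector of a curve that is only defined on the interval `[0, 1]`. -/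
noncomputable def velocityOnUnitInterval {S : OrientedSurface.{u}} (γ : ℝ → S) (t : ℝ) :
    EuclideanSpace ℝ (Fin 2) :=
  mfderivWithin 𝓘(ℝ, ℝ) (𝓡∂ 2) γ (Set.Icc 0 1) t (1 : ℝ)

/-- `A` is a circle smoothly embedded in the interior of `S`. -/
def IsSmoothCircle {S : OrientedSurface.{u}} (A : Set S) : Prop :=
  ∃ γ : ℝ → S, ContMDiff 𝓘(ℝ, ℝ) (𝓡∂ 2) ∞ γ ∧ Function.Periodic γ 1 ∧
    Set.InjOn γ (Set.Ico 0 1) ∧ (∀ t, velocity γ t ≠ 0) ∧ Set.range γ = A ∧ A ⊆ S.inner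

/-- `A` is a compact interval smoothly embedded in `S` which meets the boundary of `S` exactly in
its two endpoints, and transversely there (the boundary is given by the vanishing of coordinate `0`
in the charts of `S`). -/
def IsSmoothArc {S : OrientedSurface.{u}} (A : Set S) : Prop :=
  ∃ γ : ℝ → S, ContMDiffOn 𝓘(ℝ, ℝ) (𝓡∂ 2) ∞ γ (Set.Icc 0 1) ∧
    Set.InjOn γ (Set.Icc 0 1) ∧ (∀ t ∈ Set.Icc (0 : ℝ) 1, velocityOnUnitInterval γ t ≠ 0) ∧
    γ '' Set.Icc 0 1 = A ∧
    (∀ t ∈ Set.Icc (0 : ℝ) 1, γ t ∈ S.bdry ↔ t = 0 ∨ t = 1) ∧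
    velocityOnUnitInterval γ 0 0 ≠ 0 ∧ velocityOnUnitInterval γ 1 0 ≠ 0

/-- Two curves are transverse at a point if there are linearly independent vectors, one tangent to
the first and one tangent to the second. -/
def TransverseAt {S : OrientedSurface.{u}} (A B : Set S) (p : S) : Prop :=
  ∃ γ δ : ℝ → S, γ 0 = p ∧ δ 0 = p ∧ (∀ᶠ t in 𝓝 0, γ t ∈ A) ∧ (∀ᶠ t in 𝓝 0, δ t ∈ B) ∧
    MDifferentiableAt 𝓘(ℝ, ℝ) (𝓡∂ 2) γ 0 ∧ MDifferentiableAt 𝓘(ℝ, ℝ) (𝓡∂ 2) δ 0 ∧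
    LinearIndependent ℝ ![velocity γ 0, velocity δ 0]

/-- The two families of curves of a Heegaard diagram. -/
inductive Color
  | alpha
  | beta

/-- The other family of curves. -/
def Color.other : Color → Color
  | .alpha => .beta
  | .beta => .alpha

/-- The two types of basepoints. -/
inductive Label
  | X
  | O

/-- The other type of basepoints. -/
def Label.other : Label → Label
  | .X => .O
  | .O => .X

/-- A partial Heegaard diagram with underlying surface `S`. -/
structure PartialHeegaardDiagram (S : OrientedSurface.{u}) where
  circles : Color → Set (Set S)
  arcs : Color → Set (Set S)
  basepoints : Label → Set S
  circles_finite : ∀ c, (circles c).Finite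
  arcs_finite : ∀ c, (arcs c).Finite
  basepoints_finite : ∀ l, (basepoints l).Finite
  isSmoothCircle : ∀ c, ∀ A ∈ circles c, IsSmoothCircle A
  isSmoothArc : ∀ c, ∀ A ∈ arcs c, IsSmoothArc A
  disjoint : ∀ c, (circles c ∪ arcs c).PairwiseDisjoint id
  transverse : ∀ A ∈ circles .alpha ∪ arcs .alpha, ∀ B ∈ circles .beta ∪ arcs .beta,
    ∀ p ∈ A ∩ B, p ∈ S.inner ∧ TransverseAt A B p
  basepoints_disjoint : Disjoint (basepoints .X) (basepoints .O)
  basepoints_inner : ∀ l, basepoints l ⊆ S.inner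
  basepoints_off : ∀ l c, ∀ A ∈ circles c ∪ arcs c, Disjoint (basepoints l) A

namespace PartialHeegaardDiagram

/-- The union of all circles and arcs of one family. -/
def curves {S : OrientedSurface.{u}} (D : PartialHeegaardDiagram S) (c : Color) : Set S :=
  ⋃₀ (D.circles c ∪ D.arcs c)

/-- The endpoints of the arcs of one family. -/
def endpoints {S : OrientedSurface.{u}} (D : PartialHeegaardDiagram S) (c : Color) : Set S :=
  ⋃₀ D.arcs c ∩ S.bdry

end PartialHeegaardDiagram

/-- `f` is an orientation-preserving diffeomorphism from its source (a subset of `S`) onto its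
target (a subset of `T`). -/
structure IsOrientedDiffeo {S T : OrientedSurface.{u}} (f : PartialEquiv S T) : Prop where
  contMDiffOn : ContMDiffOn (𝓡∂ 2) (𝓡∂ 2) ∞ f f.source
  contMDiffOn_symm : ContMDiffOn (𝓡∂ 2) (𝓡∂ 2) ∞ f.symm f.target
  jacobian_pos : ∀ p ∈ f.source, 0 < jacobian f p

/-- `e` is an orientation-preserving diffeomorphism from an open subset of the plane onto an open
subset of the interior of `S`. -/
structure IsPatch {S : OrientedSurface.{u}} (e : PartialEquiv ℂ S) : Prop where
  isOpen_source : IsOpen e.source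
  isOpen_target : IsOpen e.target
  target_subset : e.target ⊆ S.inner
  contMDiffOn : ContMDiffOn 𝓘(ℝ, ℂ) (𝓡∂ 2) ∞ e e.source
  contMDiffOn_symm : ContMDiffOn (𝓡∂ 2) 𝓘(ℝ, ℂ) ∞ e.symm e.target
  jacobian_pos : ∀ z ∈ e.source, 0 < planeJacobian e z

/-! ### Gluing -/

/-- Gluing data: `φ` is an orientation-reversing diffeomorphism from a union of boundary components
of the first surface (the source of `φ`) to a union of boundary components of the second one (the
target of `φ`), which restricts to a bijection between the endpoints of `α` arcs and to a bijection
between the endpoints of `β` arcs.  (A boundary is oriented by the direction of coordinate `1` in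
the positively oriented half-plane charts.) -/
structure IsGluingMap {S S' : OrientedSurface.{u}} (D : PartialHeegaardDiagram S)
    (D' : PartialHeegaardDiagram S') (φ : PartialEquiv S S') : Prop where
  source_subset : φ.source ⊆ S.bdry
  target_subset : φ.target ⊆ S'.bdry
  source_components : ∀ p ∈ φ.source, connectedComponentIn S.bdry p ⊆ φ.source
  target_components : ∀ p ∈ φ.target, connectedComponentIn S'.bdry p ⊆ φ.target
  contMDiffOn : ContMDiffOn (𝓡∂ 2) (𝓡∂ 2) ∞ φ φ.source
  contMDiffOn_symm : ContMDiffOn (𝓡∂ 2) (𝓡∂ 2) ∞ φ.symm φ.target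
  reversing : ∀ γ : ℝ → S, (∀ᶠ t in 𝓝 0, γ t ∈ φ.source) →
    MDifferentiableAt 𝓘(ℝ, ℝ) (𝓡∂ 2) γ 0 → 0 < velocity γ 0 1 → velocity (φ ∘ γ) 0 1 < 0
  endpoints : ∀ c, φ '' (D.endpoints c ∩ φ.source) = D'.endpoints c ∩ φ.target

/-- `D''` is the partial Heegaard diagram obtained by gluing `D` and `D'` along `φ`: the surfaces of
`D` and `D'` are embedded in the surface of `D''` by `i` and `i'`, they cover it and overlap exactly
along the identification `φ`, and the curves and basepoints of `D''` are those of `D` and `D'`.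
The individual circles and arcs of `D''` are the connected components of the union of its curves, so
that arcs of `D` and `D'` which share endpoints are joined to longer arcs or to circles. -/
structure IsGluing {S S' S'' : OrientedSurface.{u}} (D : PartialHeegaardDiagram S)
    (D' : PartialHeegaardDiagram S') (φ : PartialEquiv S S') (D'' : PartialHeegaardDiagram S'')
    (i : PartialEquiv S S'') (i' : PartialEquiv S' S'') : Prop where
  isGluingMap : IsGluingMap D D' φ
  source_left : i.source = Set.univ
  source_right : i'.source = Set.univ
  left : IsOrientedDiffeo i
  right : IsOrientedDiffeo i'
  cover : i.target ∪ i'.target = Set.univ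
  meet : ∀ p q, i p = i' q ↔ p ∈ φ.source ∧ φ p = q
  bdry : S''.bdry = i '' (S.bdry \ φ.source) ∪ i' '' (S'.bdry \ φ.target)
  curves : ∀ c, D''.curves c = i '' D.curves c ∪ i' '' D'.curves c
  basepoints : ∀ l, D''.basepoints l = i '' D.basepoints l ∪ i' '' D'.basepoints l

/-! ### Isotopies and Heegaard moves -/

/-- A smooth ambient isotopy of a surface, starting at the identity. -/
structure AmbientIsotopy (S : OrientedSurface.{u}) where
  toFun : ℝ → S → S
  invFun : ℝ → S → S
  left_inv : ∀ t x, invFun t (toFun t x) = x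
  right_inv : ∀ t x, toFun t (invFun t x) = x
  smooth_toFun : ContMDiff (𝓘(ℝ, ℝ).prod (𝓡∂ 2)) (𝓡∂ 2) ∞ (fun p : ℝ × S => toFun p.1 p.2)
  smooth_invFun : ContMDiff (𝓘(ℝ, ℝ).prod (𝓡∂ 2)) (𝓡∂ 2) ∞ (fun p : ℝ × S => invFun p.1 p.2)
  jacobian_pos : ∀ t x, 0 < jacobian (toFun t) x
  zero : ∀ x, toFun 0 x = x

/-- Two diagrams on `S` are identified if an ambient isotopy fixing the boundary pointwise carries
one to the other, with all curves and basepoints. -/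
def IsIsotopicRelBdry {S : OrientedSurface.{u}} (D E : PartialHeegaardDiagram S) : Prop :=
  ∃ Φ : AmbientIsotopy S, (∀ t, ∀ x ∈ S.bdry, Φ.toFun t x = x) ∧
    (∀ c, E.circles c = (fun A => Φ.toFun 1 '' A) '' D.circles c) ∧
    (∀ c, E.arcs c = (fun A => Φ.toFun 1 '' A) '' D.arcs c) ∧
    (∀ l, E.basepoints l = Φ.toFun 1 '' D.basepoints l)

/-- Isotopy move: the `α` curves and the `β` curves are moved independently of each other by
isotopies which are constant near the boundary and fix the basepoints.  Intersections between `α`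
and `β` curves may be created or removed. -/
def IsIsotopyMove {S : OrientedSurface.{u}} (D E : PartialHeegaardDiagram S) : Prop :=
  ∃ Φ : Color → AmbientIsotopy S,
    (∀ c, ∃ K : Set S, IsCompact K ∧ K ⊆ S.inner ∧ ∀ t, ∀ x ∉ K, (Φ c).toFun t x = x) ∧
    (∀ c t l, ∀ x ∈ D.basepoints l, (Φ c).toFun t x = x) ∧
    (∀ c, E.circles c = (fun A => (Φ c).toFun 1 '' A) '' D.circles c) ∧
    (∀ c, E.arcs c = (fun A => (Φ c).toFun 1 '' A) '' D.arcs c) ∧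
    (∀ l, E.basepoints l = D.basepoints l)

/-- The closed pair of pants in the plane with boundary circles of radius `1` around `-2` and `2`
and of radius `4` around `0`. -/
def pairOfPants : Set ℂ := {z | ‖z‖ ≤ 4 ∧ 1 ≤ ‖z + 2‖ ∧ 1 ≤ ‖z - 2‖}

/-- An open neighbourhood of the pair of pants in the plane. -/
def pairOfPantsNhd : Set ℂ := {z | ‖z‖ < 5 ∧ 1 / 2 < ‖z + 2‖ ∧ 1 / 2 < ‖z - 2‖}

/-- Handleslide of a circle `A` over another circle `B` of the same family `c`: the circle `A` is
replaced by a circle which, together with `A` and `B`, bounds an embedded pair of pants containing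
no basepoints and no other curves of the family `c`. -/
def IsHandleslide {S : OrientedSurface.{u}} (c : Color) (D E : PartialHeegaardDiagram S) : Prop :=
  ∃ (A B : Set S) (e : PartialEquiv ℂ S),
    A ∈ D.circles c ∧ B ∈ D.circles c ∧ A ≠ B ∧
    IsPatch e ∧ e.source = pairOfPantsNhd ∧
    e '' Metric.sphere (-2) 1 = A ∧ e '' Metric.sphere 2 1 = B ∧
    e '' pairOfPants ∩ D.curves c ⊆ A ∪ B ∧
    (∀ l, Disjoint (e '' pairOfPants) (D.basepoints l)) ∧
    E.circles c = insert (e '' Metric.sphere 0 4) (D.circles c \ {A}) ∧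
    E.circles c.other = D.circles c.other ∧
    (∀ c', E.arcs c' = D.arcs c') ∧
    (∀ l, E.basepoints l = D.basepoints l)

/-- Index zero/three stabilization at a basepoint of type `l`: in a disk which meets no curves and
contains exactly one basepoint, of type `l`, one adds an `α` circle and a `β` circle which intersect
in two points, a basepoint of the other type inside both circles, and a second basepoint of type `l`,
so that the two basepoints of type `l` lie one inside the `α` circle only and one inside the
`β` circle only. -/
def IsZeroThreeStabilization {S : OrientedSurface.{u}} (l : Label)
    (D E : PartialHeegaardDiagram S) : Prop :=
  ∃ e : PartialEquiv ℂ S, IsPatch e ∧ e.source = Metric.ball 0 4 ∧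
    (∀ c, Disjoint e.target (D.curves c)) ∧
    D.basepoints l ∩ e.target = {e (-2)} ∧
    Disjoint e.target (D.basepoints l.other) ∧
    E.circles .alpha = insert (e '' Metric.sphere (-1) 2) (D.circles .alpha) ∧
    E.circles .beta = insert (e '' Metric.sphere 1 2) (D.circles .beta) ∧
    (∀ c, E.arcs c = D.arcs c) ∧
    E.basepoints l = insert (e 2) (D.basepoints l) ∧
    E.basepoints l.other = insert (e 0) (D.basepoints l.other)

/-- The rectangle in which an index one/two stabilization takes place. -/
def stabilizationRectangle : Set ℂ := {z | |z.re| < 6 ∧ |z.im| < 3}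

/-- The two closed disks that are the feet of the new handle. -/
def stabilizationFeet : Set ℂ := Metric.closedBall (-3) 1 ∪ Metric.closedBall 3 1

/-- The open annulus that parametrizes the new handle, with a collar at each end. -/
def handleAnnulus : Set ℂ := {z | 1 / 2 < ‖z‖ ∧ ‖z‖ < 2}

/-- Index one/two stabilization.  In a rectangle `e` of `D` that contains no basepoints and no curves
of the family `c`, and that is crossed by some number (possibly zero) of parallel strands of the other
family, two disks, one on each side of the strands, are removed and replaced by a handle `h`.  The new
circle of the family `c` runs once over the handle and returns across the strands; the new circle of
the other family is the belt circle of the handle.  Everything outside the two disks is carried over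
by the diffeomorphism `o`, and `b` is the resulting identification of the boundaries. -/
def IsOneTwoStabilization {S T : OrientedSurface.{u}} (c : Color) (D : PartialHeegaardDiagram S)
    (E : PartialHeegaardDiagram T) (b : PartialEquiv S T) : Prop :=
  ∃ (e : PartialEquiv ℂ S) (strands : Finset ℝ) (o : PartialEquiv S T) (h : PartialEquiv ℂ T),
    IsPatch e ∧ e.source = stabilizationRectangle ∧
    Disjoint e.target (D.curves c) ∧
    (∀ l, Disjoint e.target (D.basepoints l)) ∧
    (∀ r ∈ strands, |r| < 1) ∧
    D.curves c.other ∩ e.target = e '' {z ∈ stabilizationRectangle | z.re ∈ strands} ∧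
    IsOrientedDiffeo o ∧ o.source = (e '' stabilizationFeet)ᶜ ∧ IsOpen o.target ∧
    IsPatch h ∧ h.source = handleAnnulus ∧
    o.target ∪ h.target = Set.univ ∧
    (∀ x ∈ o.source, ∀ z ∈ handleAnnulus,
      o x = h z ↔ (1 < ‖z‖ ∧ x = e (z - 3)) ∨ (‖z‖ < 1 ∧ x = e (3 - z⁻¹))) ∧
    E.circles c = insert
      (o '' (e '' {z | z.im = 0 ∧ |z.re| < 2}) ∪ h '' {z ∈ handleAnnulus | z.im = 0 ∧ 0 < z.re})
      ((fun A => o '' A) '' D.circles c) ∧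
    E.circles c.other = insert (h '' Metric.sphere 0 1) ((fun A => o '' A) '' D.circles c.other) ∧
    (∀ c', E.arcs c' = (fun A => o '' A) '' D.arcs c') ∧
    (∀ l, E.basepoints l = o '' D.basepoints l) ∧
    b.source = S.bdry ∧ b.target = T.bdry ∧ Set.EqOn b o S.bdry

/-- The types of Heegaard moves. -/
inductive MoveKind
  | isotopy
  | oneTwoStabilization (c : Color)
  | oneTwoDestabilization (c : Color)
  | zeroThreeStabilization (l : Label)
  | zeroThreeDestabilization (l : Label)
  | handleslide (c : Color)

/-- `HeegaardMove k D E b` means that a Heegaard move of type `k` transforms `D` into `E`; the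
bijection `b` from the boundary of the surface of `D` to the boundary of the surface of `E` records
that the boundary stays fixed. -/
inductive HeegaardMove : MoveKind → ∀ {S T : OrientedSurface.{u}}, PartialHeegaardDiagram S →
    PartialHeegaardDiagram T → PartialEquiv S T → Prop
  | isotopy {S : OrientedSurface.{u}} {D E : PartialHeegaardDiagram S} (h : IsIsotopyMove D E) :
      HeegaardMove .isotopy D E (PartialEquiv.ofSet S.bdry)
  | oneTwoStabilization {S T : OrientedSurface.{u}} {c : Color} {D : PartialHeegaardDiagram S}
      {E : PartialHeegaardDiagram T} {b : PartialEquiv S T} (h : IsOneTwoStabilization c D E b) :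
      HeegaardMove (.oneTwoStabilization c) D E b
  | oneTwoDestabilization {S T : OrientedSurface.{u}} {c : Color} {D : PartialHeegaardDiagram S}
      {E : PartialHeegaardDiagram T} {b : PartialEquiv S T} (h : IsOneTwoStabilization c D E b) :
      HeegaardMove (.oneTwoDestabilization c) E D b.symm
  | zeroThreeStabilization {S : OrientedSurface.{u}} {l : Label} {D E : PartialHeegaardDiagram S}
      (h : IsZeroThreeStabilization l D E) :
      HeegaardMove (.zeroThreeStabilization l) D E (PartialEquiv.ofSet S.bdry)
  | zeroThreeDestabilization {S : OrientedSurface.{u}} {l : Label} {D E : PartialHeegaardDiagram S}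
      (h : IsZeroThreeStabilization l D E) :
      HeegaardMove (.zeroThreeDestabilization l) E D (PartialEquiv.ofSet S.bdry)
  | handleslide {S : OrientedSurface.{u}} {c : Color} {D E : PartialHeegaardDiagram S}
      (h : IsHandleslide c D E) :
      HeegaardMove (.handleslide c) D E (PartialEquiv.ofSet S.bdry)

/-- `HeegaardMoves L D E b` means that a sequence of Heegaard moves, whose types are listed in
order by `L`, transforms `D` into `E`, where diagrams are considered up to isotopy relative to the
boundary; `b` is the resulting identification of the boundaries. -/
inductive HeegaardMoves : List MoveKind → ∀ {S T : OrientedSurface.{u}}, PartialHeegaardDiagram S →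
    PartialHeegaardDiagram T → PartialEquiv S T → Prop
  | refl {S : OrientedSurface.{u}} (D : PartialHeegaardDiagram S) :
      HeegaardMoves [] D D (PartialEquiv.ofSet S.bdry)
  | isotopic {S T : OrientedSurface.{u}} {L : List MoveKind} {D D₁ : PartialHeegaardDiagram S}
      {E : PartialHeegaardDiagram T} {b : PartialEquiv S T}
      (h : IsIsotopicRelBdry D D₁) (hs : HeegaardMoves L D₁ E b) : HeegaardMoves L D E b
  | move {S S₁ T : OrientedSurface.{u}} {k : MoveKind} {L : List MoveKind}
      {D : PartialHeegaardDiagram S} {D₁ : PartialHeegaardDiagram S₁}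
      {E : PartialHeegaardDiagram T} {b₁ : PartialEquiv S S₁} {b : PartialEquiv S₁ T}
      (h : HeegaardMove k D D₁ b₁) (hs : HeegaardMoves L D₁ E b) :
      HeegaardMoves (k :: L) D E (b₁.trans b)

/-! Gluing is symmetric in its two pieces (`IsGluing.symm`), so it is enough to move one piece while
the other stays fixed. `IsGluing.of_heegaardMoves` does this for the left piece by induction on the
sequence of moves. The theorem applies it to `D`, exchanges the sides, applies it to `D'` and
exchanges the sides back.

A single move takes place in the interior of its surface: isotopies have compact support there, and
the other moves happen inside planar patches. The seam lies in the boundary of both pieces, so the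
embedding `i` carries the support of the move into the glued surface without touching the other
piece. Isotopies extend by the identity, and patches are composed with `i`.

A gluing records only the union of the curves of each color, because arcs may join across the seam.
Two facts bridge this. By `exists_gluedDiagram`, disjoint families of circles and arcs with the
correct unions form a glued diagram; transversality and the conditions on basepoints are inherited
from the pieces. By `IsGluing.image_mem_circles`, a circle of a piece is again a circle of the glued
diagram, since it is connected and clopen in the union of its color.

Index one/two moves change the surface, so a new one has to be built (`Surgery`). As a set it is `T`
together with the points of `S''` outside the left piece; its charts come from `S''` minus the part
that is replaced and from the interior of `T`. Near the seam the old smooth structure is reused, so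
no collars have to be chosen. The replaced part stays away from the boundary, which gives the
Hausdorff property and compactness. Destabilizations use the same construction with the inverse of
the carrying diffeomorphism.

Isotopies relative to the boundary need not be constant near it, so they need not extend smoothly by
the identity. They are absorbed by changing `i` and leaving the glued diagram alone
(`IsGluing.of_isIsotopicRelBdry`). -/

/-! ### Boundary and interior in half-plane coordinates -/

namespace OrientedSurface

variable {S T U : OrientedSurface.{u}}

theorem compl_bdry (S : OrientedSurface.{u}) : S.bdryᶜ = S.inner :=
  ModelWithCorners.compl_boundary

theorem compl_inner (S : OrientedSurface.{u}) : S.innerᶜ = S.bdry :=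
  ModelWithCorners.compl_interior

theorem notMem_bdry {p : S} : p ∉ S.bdry ↔ p ∈ S.inner := by
  rw [← compl_bdry]; rfl

theorem notMem_inner {p : S} : p ∉ S.inner ↔ p ∈ S.bdry := by
  rw [← compl_inner]; rfl

theorem isOpen_inner (S : OrientedSurface.{u}) : IsOpen S.inner :=
  ModelWithCorners.isOpen_interior (n := ∞) (by simp)

theorem mem_bdry_iff {p : S} : p ∈ S.bdry ↔ (extChartAt (𝓡∂ 2) p p : EuclideanSpace ℝ (Fin 2)) 0 = 0 := by
  change extChartAt (𝓡∂ 2) p p ∈ frontier (Set.range (𝓡∂ 2)) ↔ _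
  rw [frontier_range_modelWithCornersEuclideanHalfSpace]
  exact eq_comm

theorem nonneg_extChartAt (p q : S) :
    0 ≤ (extChartAt (𝓡∂ 2) p q : EuclideanSpace ℝ (Fin 2)) 0 := by
  have : extChartAt (𝓡∂ 2) p q ∈ Set.range (𝓡∂ 2) := by
    simp [extChartAt]
  rw [range_modelWithCornersEuclideanHalfSpace] at this
  exact this

end OrientedSurface

/-! ### Jacobians in preferred charts -/

/-- The plane, as the model space of the surfaces. -/
abbrev Plane := EuclideanSpace ℝ (Fin 2)

/-- The derivative of a map of surfaces, in the preferred charts, as an endomorphism of the model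
space. -/
noncomputable def coordDeriv {S T : OrientedSurface.{u}} (f : S → T) (p : S) : Plane →L[ℝ] Plane :=
  mfderiv (𝓡∂ 2) (𝓡∂ 2) f p

section Jacobian

variable {S T U : OrientedSurface.{u}}

theorem jacobian_eq_det (f : S → T) (p : S) :
    jacobian f p = LinearMap.det (coordDeriv f p : Plane →ₗ[ℝ] Plane) := rfl

theorem hasFDerivWithinAt_coordDeriv {f : S → T} {p : S}
    (hf : MDifferentiableAt (𝓡∂ 2) (𝓡∂ 2) f p) :
    HasFDerivWithinAt (extChartAt (𝓡∂ 2) (f p) ∘ (f ∘ (extChartAt (𝓡∂ 2) p).symm)) (coordDeriv f p)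
      (Set.range (𝓡∂ 2)) (extChartAt (𝓡∂ 2) p p) :=
  hf.hasMFDerivAt.2

theorem coordDeriv_comp {f : S → T} {g : T → U} {p : S}
    (hg : MDifferentiableAt (𝓡∂ 2) (𝓡∂ 2) g (f p)) (hf : MDifferentiableAt (𝓡∂ 2) (𝓡∂ 2) f p) :
    coordDeriv (g ∘ f) p = (coordDeriv g (f p)).comp (coordDeriv f p) :=
  mfderiv_comp p hg hf

theorem jacobian_comp {f : S → T} {g : T → U} {p : S}
    (hg : MDifferentiableAt (𝓡∂ 2) (𝓡∂ 2) g (f p)) (hf : MDifferentiableAt (𝓡∂ 2) (𝓡∂ 2) f p) :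
    jacobian (g ∘ f) p = jacobian g (f p) * jacobian f p := by
  rw [jacobian_eq_det, coordDeriv_comp hg hf]
  exact LinearMap.det_comp _ _

theorem jacobian_congr {f g : S → T} {p : S} (h : f =ᶠ[𝓝 p] g) : jacobian f p = jacobian g p := by
  unfold jacobian
  have h2 := h.mfderiv_eq (I := 𝓡∂ 2) (I' := 𝓡∂ 2)
  rw [h2]

theorem jacobian_id (p : S) : jacobian (id : S → S) p = 1 := by
  unfold jacobian
  rw [mfderiv_id]
  exact LinearMap.det_id

end Jacobian

/-! ### Open images, and independence of the sign of the Jacobian from charts -/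

section Derivative

variable {S T : OrientedSurface.{u}}

theorem coordDeriv_injective {f : S → T} {p : S} (h : jacobian f p ≠ 0) :
    Function.Injective (coordDeriv f p) :=
  (LinearMap.equivOfDetNeZero (coordDeriv f p : Plane →ₗ[ℝ] Plane) h).injective

theorem coordDeriv_surjective {f : S → T} {p : S} (h : jacobian f p ≠ 0) :
    Function.Surjective (coordDeriv f p) :=
  (LinearMap.equivOfDetNeZero (coordDeriv f p : Plane →ₗ[ℝ] Plane) h).surjective

/-- If the value were a boundary point, coordinate `0` of the map would have a minimum at the
interior point `p`, so its differential would vanish and the derivative could not be surjective. -/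
theorem mem_inner_of_jacobian_ne_zero {f : S → T} {p : S}
    (hf : MDifferentiableAt (𝓡∂ 2) (𝓡∂ 2) f p) (h : jacobian f p ≠ 0) (hp : p ∈ S.inner) :
    f p ∈ T.inner :=
  hf.isInteriorPoint_of_surjective_mfderiv (coordDeriv_surjective h) hp

/-- The open mapping form of the inverse function theorem, in charts. Both `p` and `f p` are
interior, so the range of the model is a neighbourhood at both points and derivatives within it are
ordinary derivatives. -/
theorem map_nhds_eq_of_jacobian_ne_zero {f : S → T} {p : S}
    (hf : ContMDiffAt (𝓡∂ 2) (𝓡∂ 2) ∞ f p) (h : jacobian f p ≠ 0) (hp : p ∈ S.inner) :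
    Filter.map f (𝓝 p) = 𝓝 (f p) := by
  have hd : MDifferentiableAt (𝓡∂ 2) (𝓡∂ 2) f p := hf.mdifferentiableAt (by simp)
  have hfp := mem_inner_of_jacobian_ne_zero hd h hp
  have hR : Set.range (𝓡∂ 2) ∈ 𝓝 (extChartAt (𝓡∂ 2) p p) := range_mem_nhds_isInteriorPoint hp
  have hR' : Set.range (𝓡∂ 2) ∈ 𝓝 (extChartAt (𝓡∂ 2) (f p) (f p)) :=
    range_mem_nhds_isInteriorPoint hfp
  have hsurj := coordDeriv_surjective h
  set F := writtenInExtChartAt (𝓡∂ 2) (𝓡∂ 2) p f with hF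
  have hc : ContDiffAt ℝ ∞ F (extChartAt (𝓡∂ 2) p p) :=
    ((contMDiffAt_iff.1 hf).2).contDiffAt hR
  have hs : HasStrictFDerivAt F (fderiv ℝ F (extChartAt (𝓡∂ 2) p p)) (extChartAt (𝓡∂ 2) p p) :=
    hc.hasStrictFDerivAt (by simp)
  have hs' : Function.Surjective (fderiv ℝ F (extChartAt (𝓡∂ 2) p p)) := by
    have := (hasFDerivWithinAt_coordDeriv hd).hasFDerivAt hR
    have h2 : fderiv ℝ F (extChartAt (𝓡∂ 2) p p) = coordDeriv f p := this.fderiv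
    rw [h2]
    exact hsurj
  have key := hs.map_nhds_eq_of_surj (LinearMap.range_eq_top.2 hs')
  have e1 : Filter.map (extChartAt (𝓡∂ 2) p) (𝓝 p) = 𝓝 (extChartAt (𝓡∂ 2) p p) := by
    rw [map_extChartAt_nhds, nhdsWithin_eq_nhds.2 hR]
  have e2 : Filter.map (extChartAt (𝓡∂ 2) (f p)).symm (𝓝 (extChartAt (𝓡∂ 2) (f p) (f p))) =
      𝓝 (f p) := by
    rw [← nhdsWithin_eq_nhds.2 hR', map_extChartAt_symm_nhdsWithin_range]
  have e3 : F (extChartAt (𝓡∂ 2) p p) = extChartAt (𝓡∂ 2) (f p) (f p) := by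
    simp only [hF, writtenInExtChartAt, Function.comp_apply]
    rw [(extChartAt (𝓡∂ 2) p).left_inv (mem_extChartAt_source p)]
  rw [e3, ← e1, Filter.map_map] at key
  rw [← e2, ← key, Filter.map_map]
  apply Filter.map_congr
  filter_upwards [hf.continuousAt.preimage_mem_nhds (extChartAt_source_mem_nhds (I := 𝓡∂ 2) (f p)),
    extChartAt_source_mem_nhds (I := 𝓡∂ 2) p] with x hx hx'
  simp only [Function.comp_apply, hF, writtenInExtChartAt]
  rw [(extChartAt (𝓡∂ 2) p).left_inv hx', (extChartAt (𝓡∂ 2) (f p)).left_inv hx]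

theorem isOpen_image_of_jacobian_ne_zero {f : S → T} {U : Set S} (hU : IsOpen U)
    (hi : U ⊆ S.inner) (hf : ContMDiffOn (𝓡∂ 2) (𝓡∂ 2) ∞ f U) (h : ∀ p ∈ U, jacobian f p ≠ 0) :
    IsOpen (f '' U) := by
  rw [isOpen_iff_mem_nhds]
  rintro _ ⟨p, hp, rfl⟩
  rw [← map_nhds_eq_of_jacobian_ne_zero (hf.contMDiffAt (hU.mem_nhds hp)) (h p hp) (hi hp)]
  exact Filter.image_mem_map (hU.mem_nhds hp)

/-- The derivative of a map in two arbitrary preferred charts. -/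
theorem fderivWithin_extChartAt_comp {f : S → T} {x z : S} {y : T}
    (hf : MDifferentiableAt (𝓡∂ 2) (𝓡∂ 2) f z) (hx : z ∈ (extChartAt (𝓡∂ 2) x).source)
    (hy : f z ∈ (extChartAt (𝓡∂ 2) y).source) :
    fderivWithin ℝ (extChartAt (𝓡∂ 2) y ∘ f ∘ (extChartAt (𝓡∂ 2) x).symm) (Set.range (𝓡∂ 2))
      (extChartAt (𝓡∂ 2) x z) =
    (tangentCoordChange (𝓡∂ 2) (f z) y (f z)) ∘L
      coordDeriv f z ∘L
      (tangentCoordChange (𝓡∂ 2) x z z) := by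
  have h1 := hasFDerivWithinAt_tangentCoordChange (I := 𝓡∂ 2) (x := x) (y := z) (z := z)
    ⟨hx, mem_extChartAt_source z⟩
  have h3 := hasFDerivWithinAt_tangentCoordChange (I := 𝓡∂ 2) (x := f z) (y := y) (z := f z)
    ⟨mem_extChartAt_source (f z), hy⟩
  have h2 := hasFDerivWithinAt_coordDeriv hf
  have e1 : (extChartAt (𝓡∂ 2) z ∘ (extChartAt (𝓡∂ 2) x).symm) (extChartAt (𝓡∂ 2) x z) =
    extChartAt (𝓡∂ 2) z z := by
      rw [Function.comp_apply, (extChartAt (𝓡∂ 2) x).left_inv hx]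
  have m1 : Set.MapsTo (extChartAt (𝓡∂ 2) z ∘ (extChartAt (𝓡∂ 2) x).symm) (Set.range (𝓡∂ 2))
      (Set.range (𝓡∂ 2)) := fun w _ => by simp [extChartAt]
  have m2 : Set.MapsTo (extChartAt (𝓡∂ 2) (f z) ∘ f ∘ (extChartAt (𝓡∂ 2) z).symm)
      (Set.range (𝓡∂ 2)) (Set.range (𝓡∂ 2)) := fun w _ => by simp [extChartAt]
  have e2 : (extChartAt (𝓡∂ 2) (f z) ∘ f ∘ (extChartAt (𝓡∂ 2) z).symm) (extChartAt (𝓡∂ 2) z z) =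
    extChartAt (𝓡∂ 2) (f z) (f z) := by
      simp only [Function.comp_apply]
      rw [(extChartAt (𝓡∂ 2) z).left_inv (mem_extChartAt_source z)]
  rw [← e1] at h2
  have h12 := h2.comp _ h1 m1
  rw [← e2, ← e1] at h3
  have h123 := HasFDerivWithinAt.comp (extChartAt (𝓡∂ 2) x z)
    (f := (extChartAt (𝓡∂ 2) (f z) ∘ f ∘ (extChartAt (𝓡∂ 2) z).symm) ∘
      (extChartAt (𝓡∂ 2) z ∘ (extChartAt (𝓡∂ 2) x).symm)) h3 h12 (m2.comp m1)
  have hu : UniqueDiffWithinAt ℝ (Set.range (𝓡∂ 2)) (extChartAt (𝓡∂ 2) x z) :=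
    (𝓡∂ 2).uniqueDiffOn _ (by simp [extChartAt])
  refine HasFDerivWithinAt.fderivWithin ?_ hu
  refine h123.congr_of_eventuallyEq ?_ ?_
  -- Near the point, the intermediate charts at `z` and `f z` cancel, so the chain of three maps is
  -- `f` read in the charts at `x` and `y`.
  · have c1 : ContinuousWithinAt (extChartAt (𝓡∂ 2) x).symm (Set.range (𝓡∂ 2))
        (extChartAt (𝓡∂ 2) x z) :=
      (continuousAt_extChartAt_symm' hx).continuousWithinAt
    have c0 : (extChartAt (𝓡∂ 2) x).symm (extChartAt (𝓡∂ 2) x z) = z :=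
      (extChartAt (𝓡∂ 2) x).left_inv hx
    have n1 := c1.preimage_mem_nhdsWithin (t := (extChartAt (𝓡∂ 2) z).source)
      (by rw [c0]; exact extChartAt_source_mem_nhds z)
    have n2 := c1.preimage_mem_nhdsWithin (t := f ⁻¹' (extChartAt (𝓡∂ 2) (f z)).source)
      (by rw [c0]; exact hf.continuousAt.preimage_mem_nhds (extChartAt_source_mem_nhds (f z)))
    filter_upwards [n1, n2] with w hw1 hw2
    simp only [Function.comp_apply]
    rw [(extChartAt (𝓡∂ 2) z).left_inv hw1, (extChartAt (𝓡∂ 2) (f z)).left_inv hw2]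
  · simp only [Function.comp_apply]
    rw [(extChartAt (𝓡∂ 2) x).left_inv hx, (extChartAt (𝓡∂ 2) z).left_inv (mem_extChartAt_source z),
      (extChartAt (𝓡∂ 2) (f z)).left_inv (mem_extChartAt_source _)]

/-- The coordinate changes on both sides have positive determinant by orientedness, so the sign of
the Jacobian may be read in any preferred charts. This is what orients surfaces built from atlases.
-/
theorem det_fderivWithin_extChartAt_comp_pos {f : S → T} {x z : S} {y : T}
    (hf : MDifferentiableAt (𝓡∂ 2) (𝓡∂ 2) f z) (hj : 0 < jacobian f z)
    (hx : z ∈ (extChartAt (𝓡∂ 2) x).source) (hy : f z ∈ (extChartAt (𝓡∂ 2) y).source) :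
    0 < (fderivWithin ℝ (extChartAt (𝓡∂ 2) y ∘ f ∘ (extChartAt (𝓡∂ 2) x).symm) (Set.range (𝓡∂ 2))
      (extChartAt (𝓡∂ 2) x z)).det := by
  rw [fderivWithin_extChartAt_comp hf hx hy]
  rw [extChartAt_source] at hx hy
  have h1 := S.oriented x z z hx (mem_chart_source _ z)
  have h2 := T.oriented (f z) y (f z) (mem_chart_source _ (f z)) hy
  have := mul_pos h2 (mul_pos hj h1)
  rw [jacobian_eq_det] at this
  unfold ContinuousLinearMap.det at *
  rw [← LinearMap.det_comp, ← LinearMap.det_comp] at this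
  exact this

end Derivative

/-! ### Orientation-preserving partial diffeomorphisms -/

namespace IsOrientedDiffeo

variable {S T U : OrientedSurface.{u}}

theorem contMDiffAt {f : PartialEquiv S T} (hf : IsOrientedDiffeo f) (ho : IsOpen f.source) {p : S}
    (hp : p ∈ f.source) : ContMDiffAt (𝓡∂ 2) (𝓡∂ 2) ∞ f p :=
  hf.contMDiffOn.contMDiffAt (ho.mem_nhds hp)

theorem mdifferentiableAt {f : PartialEquiv S T} (hf : IsOrientedDiffeo f) (ho : IsOpen f.source)
    {p : S} (hp : p ∈ f.source) : MDifferentiableAt (𝓡∂ 2) (𝓡∂ 2) f p :=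
  (hf.contMDiffAt ho hp).mdifferentiableAt (by simp)

/-- By the chain rule the two Jacobians multiply to `1`. The target must be open for the full
derivative of the inverse to be meaningful. -/
theorem symm {f : PartialEquiv S T} (hf : IsOrientedDiffeo f) (ho : IsOpen f.source)
    (ht : IsOpen f.target) : IsOrientedDiffeo f.symm where
  contMDiffOn := hf.contMDiffOn_symm
  contMDiffOn_symm := hf.contMDiffOn
  jacobian_pos q hq := by
    have hq' : q ∈ f.target := hq
    have h1 : MDifferentiableAt (𝓡∂ 2) (𝓡∂ 2) f (f.symm q) :=
      hf.mdifferentiableAt ho (f.map_target hq')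
    have h2 : MDifferentiableAt (𝓡∂ 2) (𝓡∂ 2) f.symm q :=
      (hf.contMDiffOn_symm.contMDiffAt (ht.mem_nhds hq')).mdifferentiableAt (by simp)
    have h3 := jacobian_comp h1 h2
    have h4 : (f ∘ f.symm) =ᶠ[𝓝 q] id := by
      filter_upwards [ht.mem_nhds hq'] with x hx using f.right_inv hx
    rw [jacobian_congr h4, jacobian_id] at h3
    have h5 := hf.jacobian_pos _ (f.map_target hq')
    exact pos_of_mul_pos_right (by rw [← h3]; exact one_pos) h5.le

theorem trans {f : PartialEquiv S T} {g : PartialEquiv T U} (hf : IsOrientedDiffeo f)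
    (hg : IsOrientedDiffeo g) (ho : IsOpen f.source) (ho' : IsOpen g.source) :
    IsOrientedDiffeo (f.trans g) where
  contMDiffOn := by
    have := hg.contMDiffOn.comp' hf.contMDiffOn
    rwa [← PartialEquiv.trans_source, ← PartialEquiv.coe_trans] at this
  contMDiffOn_symm := by
    have := hf.contMDiffOn_symm.comp' hg.contMDiffOn_symm
    exact this
  jacobian_pos p hp := by
    rw [PartialEquiv.trans_source] at hp
    rw [PartialEquiv.coe_trans, jacobian_comp (hg.mdifferentiableAt ho' hp.2)
      (hf.mdifferentiableAt ho hp.1)]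
    exact mul_pos (hg.jacobian_pos _ hp.2) (hf.jacobian_pos _ hp.1)

theorem of_eqOn_id {f : PartialEquiv S S} (ho : IsOpen f.source) (h : Set.EqOn f id f.source) :
    IsOrientedDiffeo f where
  contMDiffOn := contMDiffOn_id.congr h
  contMDiffOn_symm := by
    refine contMDiffOn_id.congr fun q hq => ?_
    have := h (f.map_target hq)
    rw [f.right_inv hq] at this
    exact this.symm
  jacobian_pos p hp := by
    rw [jacobian_congr (h.eventuallyEq_of_mem (ho.mem_nhds hp)), jacobian_id]
    exact one_pos

/-- The target need not be open, so the inverse is compared with the local model only on `f.target ∩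
V`. This serves for embeddings whose local model differs between interior and boundary points, such
as `Surgery.j`. -/
theorem of_locally {f : PartialEquiv S T}
    (h : ∀ p ∈ f.source, ∃ (e : PartialEquiv S T) (V : Set T), IsOrientedDiffeo e ∧
      IsOpen e.source ∧ p ∈ e.source ∧ Set.EqOn f e e.source ∧ IsOpen V ∧ f p ∈ V ∧
      ∀ q ∈ f.target ∩ V, q ∈ e.target ∧ f.symm q = e.symm q) :
    IsOrientedDiffeo f where
  contMDiffOn p hp := by
    obtain ⟨e, V, he, ho, hpe, heq, -⟩ := h p hp
    exact ((he.contMDiffAt ho hpe).congr_of_eventuallyEq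
      (heq.eventuallyEq_of_mem (ho.mem_nhds hpe))).contMDiffWithinAt
  contMDiffOn_symm q hq := by
    obtain ⟨e, V, he, ho, hpe, heq, hV, hqV, hi⟩ := h (f.symm q) (f.map_target hq)
    rw [f.right_inv hq] at hqV
    have h1 : ContMDiffWithinAt (𝓡∂ 2) (𝓡∂ 2) ∞ f.symm (f.target ∩ V) q :=
      ((he.contMDiffOn_symm q (hi q ⟨hq, hqV⟩).1).mono fun x hx => (hi x hx).1).congr
        (fun x hx => (hi x hx).2) (hi q ⟨hq, hqV⟩).2
    exact (contMDiffWithinAt_inter (hV.mem_nhds hqV)).1 h1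
  jacobian_pos p hp := by
    obtain ⟨e, V, he, ho, hpe, heq, -⟩ := h p hp
    rw [jacobian_congr (heq.eventuallyEq_of_mem (ho.mem_nhds hpe))]
    exact he.jacobian_pos p hpe

theorem congr {f g : PartialEquiv S T} (hf : IsOrientedDiffeo f) (ho : IsOpen f.source)
    (hs : g.source = f.source) (h : Set.EqOn g f f.source) : IsOrientedDiffeo g := by
  refine of_locally fun p hp => ⟨f, Set.univ, hf, ho, hs ▸ hp, h, isOpen_univ, trivial, ?_⟩
  rintro q ⟨hq, -⟩
  have h1 : g.symm q ∈ f.source := hs ▸ g.map_target hq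
  have h2 : f (g.symm q) = q := by rw [← h h1, g.right_inv hq]
  refine ⟨h2 ▸ f.map_source h1, ?_⟩
  conv_rhs => rw [← h2, f.left_inv h1]

theorem restr {f : PartialEquiv S T} (hf : IsOrientedDiffeo f) (s : Set S) :
    IsOrientedDiffeo (f.restr s) where
  contMDiffOn := hf.contMDiffOn.mono (by simp)
  contMDiffOn_symm := hf.contMDiffOn_symm.mono (by simp)
  jacobian_pos p hp := hf.jacobian_pos p (by simp at hp; exact hp.1)

theorem isOpen_image {f : PartialEquiv S T} (hf : IsOrientedDiffeo f) {A : Set S} (hA : IsOpen A)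
    (hs : A ⊆ f.source) (hi : A ⊆ S.inner) : IsOpen (f '' A) :=
  isOpen_image_of_jacobian_ne_zero hA hi (hf.contMDiffOn.mono hs)
    fun p hp => (hf.jacobian_pos p (hs hp)).ne'

theorem mem_inner {f : PartialEquiv S T} (hf : IsOrientedDiffeo f) (ho : IsOpen f.source) {p : S}
    (hp : p ∈ f.source) (hi : p ∈ S.inner) : f p ∈ T.inner :=
  mem_inner_of_jacobian_ne_zero (hf.mdifferentiableAt ho hp) (hf.jacobian_pos p hp).ne' hi

end IsOrientedDiffeo

/-! ### Derivatives and velocities at boundary points -/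

section BoundaryDerivative

theorem Plane.eq_add_smul (v : Plane) :
    v = v 0 • EuclideanSpace.single 0 (1 : ℝ) + v 1 • EuclideanSpace.single 1 (1 : ℝ) := by
  ext i; fin_cases i <;> simp

theorem Plane.det_eq (A : Plane →L[ℝ] Plane) :
    LinearMap.det (A : Plane →ₗ[ℝ] Plane) =
      A (EuclideanSpace.single 0 1) 0 * A (EuclideanSpace.single 1 1) 1 -
        A (EuclideanSpace.single 1 1) 0 * A (EuclideanSpace.single 0 1) 1 := by
  rw [← LinearMap.det_toMatrix (EuclideanSpace.basisFun (Fin 2) ℝ).toBasis, Matrix.det_fin_two]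
  simp [LinearMap.toMatrix_apply]

/-- The bracket is the area form, which a linear map scales by its determinant; this relates
`planeJacobian` to `jacobian`. -/
theorem Plane.cross_map (A : Plane →L[ℝ] Plane) (v w : Plane) :
    A v 0 * A w 1 - A v 1 * A w 0 =
      LinearMap.det (A : Plane →ₗ[ℝ] Plane) * (v 0 * w 1 - v 1 * w 0) := by
  rw [Plane.det_eq, Plane.eq_add_smul v, Plane.eq_add_smul w]
  simp
  ring

variable {S T : OrientedSurface.{u}}

/-- The derivative sends inward vectors to inward or tangent ones, hence tangent ones to tangent
ones. Its matrix is therefore triangular, and positivity of the determinant makes both diagonal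
entries positive. In particular the boundary orientation is preserved. -/
theorem coordDeriv_bdry {f : S → T} {p : S} (hf : MDifferentiableAt (𝓡∂ 2) (𝓡∂ 2) f p)
    (hj : 0 < jacobian f p) (hp : p ∈ S.bdry) (hfp : f p ∈ T.bdry) :
    ∃ a d : ℝ, 0 < a ∧ 0 < d ∧ ∀ v : Plane, coordDeriv f p v 0 = a * v 0 ∧
      (v 0 = 0 → coordDeriv f p v 1 = d * v 1) := by
  have hD := hasFDerivWithinAt_coordDeriv hf
  set F := extChartAt (𝓡∂ 2) (f p) ∘ (f ∘ (extChartAt (𝓡∂ 2) p).symm)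
  have hD0 : HasFDerivWithinAt (fun y => F y 0)
      ((EuclideanSpace.proj (0 : Fin 2) : Plane →L[ℝ] ℝ).comp (coordDeriv f p))
      (Set.range (𝓡∂ 2)) (extChartAt (𝓡∂ 2) p p) :=
    (EuclideanSpace.proj (0 : Fin 2) : Plane →L[ℝ] ℝ).hasFDerivAt.comp_hasFDerivWithinAt _ hD
  have hF0 : F (extChartAt (𝓡∂ 2) p p) 0 = 0 := by
    simp only [F, Function.comp_apply]
    rw [(extChartAt (𝓡∂ 2) p).left_inv (mem_extChartAt_source p)]
    exact OrientedSurface.mem_bdry_iff.1 hfp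
  -- Coordinate `0` is nonnegative throughout the half-plane and vanishes at the boundary point `f
  -- p`.
  have hmin : IsLocalMinOn (fun y => F y 0) (Set.range (𝓡∂ 2)) (extChartAt (𝓡∂ 2) p p) := by
    refine Filter.Eventually.of_forall fun y => ?_
    change F (extChartAt (𝓡∂ 2) p p) 0 ≤ F y 0
    rw [hF0]
    exact OrientedSurface.nonneg_extChartAt _ _
  have hnn : ∀ v : Plane, 0 ≤ v 0 → 0 ≤ coordDeriv f p v 0 := by
    intro v hv
    refine hmin.hasFDerivWithinAt_nonneg hD0 (mem_posTangentConeAt_of_segment_subset ?_)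
    rw [range_modelWithCornersEuclideanHalfSpace]
    rintro _ ⟨s, t, hs, ht, hst, rfl⟩
    have h0 := OrientedSurface.mem_bdry_iff.1 hp
    change 0 ≤ s * (extChartAt (𝓡∂ 2) p p : Plane) 0 + t * ((extChartAt (𝓡∂ 2) p p : Plane) 0 + v 0)
    rw [h0]
    nlinarith [mul_nonneg ht hv]
  -- Both `v` and `-v` lie in the closed half-plane, so the one-sided inequality holds in both
  -- directions.
  have hz : ∀ v : Plane, v 0 = 0 → coordDeriv f p v 0 = 0 := by
    intro v hv
    refine le_antisymm ?_ (hnn v hv.ge)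
    have := hnn (-v) (by simp [hv])
    simpa using this
  have hdet := hj
  rw [jacobian_eq_det, Plane.det_eq, hz (EuclideanSpace.single 1 1) (by simp), zero_mul,
    sub_zero] at hdet
  have ha : 0 ≤ coordDeriv f p (EuclideanSpace.single 0 1) 0 := hnn _ (by simp)
  have ha' : 0 < coordDeriv f p (EuclideanSpace.single 0 1) 0 := by
    rcases ha.eq_or_lt with h | h
    · rw [← h, zero_mul] at hdet; exact absurd hdet (lt_irrefl _)
    · exact h
  refine ⟨_, _, ha', pos_of_mul_pos_right hdet ha, fun v => ⟨?_, fun hv => ?_⟩⟩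
  · conv_lhs => rw [Plane.eq_add_smul v]
    simp [hz (EuclideanSpace.single 1 1) (by simp), mul_comm]
  · conv_lhs => rw [Plane.eq_add_smul v]
    simp [hv, mul_comm]

theorem hasDerivAt_velocity {γ : ℝ → S} {t : ℝ} (hγ : MDifferentiableAt 𝓘(ℝ, ℝ) (𝓡∂ 2) γ t) :
    HasDerivAt (fun s => (extChartAt (𝓡∂ 2) (γ t) (γ s) : Plane)) (velocity γ t) t := by
  obtain ⟨D, hD⟩ : ∃ D : ℝ →L[ℝ] Plane, D = mfderiv 𝓘(ℝ, ℝ) (𝓡∂ 2) γ t := ⟨_, rfl⟩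
  have h2 : HasFDerivAt (fun s => (extChartAt (𝓡∂ 2) (γ t) (γ s) : Plane)) D t := by
    rw [hD]
    exact hasFDerivWithinAt_univ.1 (by simpa only [writtenInExtChartAt, mfld_simps] using! hγ.hasMFDerivAt.2)
  have h3 : velocity γ t = D 1 := by rw [hD]; rfl
  rw [h3]
  exact h2.hasDerivAt

/-- The curve is defined on both sides of `t`, so coordinate `0` has a two-sided minimum where the
curve touches the boundary. -/
theorem velocity_zero_of_mem_bdry {γ : ℝ → S} {t : ℝ}
    (hγ : MDifferentiableAt 𝓘(ℝ, ℝ) (𝓡∂ 2) γ t) (h : γ t ∈ S.bdry) : velocity γ t 0 = 0 := by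
  have h1 : HasDerivAt (fun s => (extChartAt (𝓡∂ 2) (γ t) (γ s) : Plane) 0) (velocity γ t 0) t := by
    have := ((EuclideanSpace.proj (0 : Fin 2) : Plane →L[ℝ] ℝ).hasFDerivAt).comp_hasDerivAt t
      (hasDerivAt_velocity hγ)
    exact this
  refine IsLocalMin.hasDerivAt_eq_zero (Filter.Eventually.of_forall fun s => ?_) h1
  rw [OrientedSurface.mem_bdry_iff.1 h]
  exact OrientedSurface.nonneg_extChartAt _ _

theorem velocity_comp {f : S → T} {γ : ℝ → S} {t : ℝ}
    (hf : MDifferentiableAt (𝓡∂ 2) (𝓡∂ 2) f (γ t)) (hγ : MDifferentiableAt 𝓘(ℝ, ℝ) (𝓡∂ 2) γ t) :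
    velocity (f ∘ γ) t = coordDeriv f (γ t) (velocity γ t) := by
  unfold velocity
  rw [mfderiv_comp t hf hγ]
  rfl

theorem velocityOnUnitInterval_comp {f : S → T} {γ : ℝ → S} {t : ℝ} (ht : t ∈ Set.Icc (0 : ℝ) 1)
    (hf : MDifferentiableAt (𝓡∂ 2) (𝓡∂ 2) f (γ t))
    (hγ : MDifferentiableWithinAt 𝓘(ℝ, ℝ) (𝓡∂ 2) γ (Set.Icc 0 1) t) :
    velocityOnUnitInterval (f ∘ γ) t = coordDeriv f (γ t) (velocityOnUnitInterval γ t) := by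
  unfold velocityOnUnitInterval
  rw [mfderiv_comp_mfderivWithin t hf hγ
    (((uniqueDiffOn_Icc one_pos) t ht).uniqueMDiffWithinAt)]
  rfl

theorem velocity_congr {γ δ : ℝ → S} {t : ℝ} (h : γ =ᶠ[𝓝 t] δ) : velocity γ t = velocity δ t := by
  unfold velocity
  have h2 := h.mfderiv_eq (I := 𝓘(ℝ, ℝ)) (I' := 𝓡∂ 2)
  rw [h2]
  rfl

theorem planeJacobian_comp {f : S → T} {e : ℂ → S} {z : ℂ}
    (hf : MDifferentiableAt (𝓡∂ 2) (𝓡∂ 2) f (e z)) (he : MDifferentiableAt 𝓘(ℝ, ℂ) (𝓡∂ 2) e z) :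
    planeJacobian (f ∘ e) z = jacobian f (e z) * planeJacobian e z := by
  have h := mfderiv_comp z hf he
  have h1 : ∀ v : ℂ, (mfderiv 𝓘(ℝ, ℂ) (𝓡∂ 2) (f ∘ e) z v : Plane) =
      coordDeriv f (e z) (mfderiv 𝓘(ℝ, ℂ) (𝓡∂ 2) e z v : Plane) := fun v => by rw [h]; rfl
  unfold planeJacobian
  rw [jacobian_eq_det]
  simp only
  rw [h1, h1]
  exact Plane.cross_map _ _ _

end BoundaryDerivative

/-! ### Curves, transversality and patches under diffeomorphisms -/

section Curves

variable {S T : OrientedSurface.{u}}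

theorem IsSmoothCircle.image {f : PartialEquiv S T} (hf : IsOrientedDiffeo f)
    (ho : IsOpen f.source) {A : Set S} (hA : IsSmoothCircle A) (hs : A ⊆ f.source) :
    IsSmoothCircle (f '' A) := by
  obtain ⟨γ, hc, hper, hinj, hv, rfl, hi⟩ := hA
  have hm : ∀ t, γ t ∈ f.source := fun t => hs ⟨t, rfl⟩
  refine ⟨f ∘ γ, fun t => (hf.contMDiffAt ho (hm t)).comp t (hc t), hper.comp f,
    fun x hx y hy hxy => hinj hx hy (f.injOn (hm x) (hm y) hxy), fun t => ?_, Set.range_comp f γ, ?_⟩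
  · rw [velocity_comp (hf.mdifferentiableAt ho (hm t)) ((hc t).mdifferentiableAt (by simp))]
    intro h0
    exact hv t (coordDeriv_injective (hf.jacobian_pos _ (hm t)).ne' (h0.trans (map_zero _).symm))
  · rintro _ ⟨p, hp, rfl⟩
    exact hf.mem_inner ho (hs hp) (hi hp)

/-- A smooth map can turn boundary points into interior ones, as happens along a seam; `hb` excludes
this. Transversality at the ends survives because the derivative multiplies coordinate `0` by a
positive factor there. -/
theorem IsSmoothArc.image {f : PartialEquiv S T} (hf : IsOrientedDiffeo f)
    (ho : IsOpen f.source) {A : Set S} (hA : IsSmoothArc A) (hs : A ⊆ f.source)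
    (hb : ∀ p ∈ A, f p ∈ T.bdry ↔ p ∈ S.bdry) : IsSmoothArc (f '' A) := by
  obtain ⟨γ, hc, hinj, hv, rfl, hi, h0, h1⟩ := hA
  have hm : ∀ t ∈ Set.Icc (0 : ℝ) 1, γ t ∈ f.source := fun t ht => hs ⟨t, ht, rfl⟩
  have hvel : ∀ t ∈ Set.Icc (0 : ℝ) 1, velocityOnUnitInterval (f ∘ γ) t =
      coordDeriv f (γ t) (velocityOnUnitInterval γ t) := fun t ht =>
    velocityOnUnitInterval_comp ht (hf.mdifferentiableAt ho (hm t ht))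
      ((hc t ht).mdifferentiableWithinAt (by simp))
  have hend : ∀ t ∈ Set.Icc (0 : ℝ) 1, γ t ∈ S.bdry → velocityOnUnitInterval γ t 0 ≠ 0 →
      velocityOnUnitInterval (f ∘ γ) t 0 ≠ 0 := by
    intro t ht hbt hne
    obtain ⟨a, d, ha, -, h⟩ := coordDeriv_bdry (hf.mdifferentiableAt ho (hm t ht))
      (hf.jacobian_pos _ (hm t ht)) hbt ((hb _ ⟨t, ht, rfl⟩).2 hbt)
    rw [hvel t ht, (h _).1]
    exact mul_ne_zero ha.ne' hne
  have m0 : (0 : ℝ) ∈ Set.Icc (0 : ℝ) 1 := by simp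
  have m1 : (1 : ℝ) ∈ Set.Icc (0 : ℝ) 1 := by simp
  refine ⟨f ∘ γ, fun t ht => (hf.contMDiffAt ho (hm t ht)).comp_contMDiffWithinAt t (hc t ht),
    fun x hx y hy hxy => hinj hx hy (f.injOn (hm x hx) (hm y hy) hxy), fun t ht => ?_,
    Set.image_comp f γ _, fun t ht => ?_, hend 0 m0 ((hi 0 m0).2 (Or.inl rfl)) h0,
    hend 1 m1 ((hi 1 m1).2 (Or.inr rfl)) h1⟩
  · rw [hvel t ht]
    intro hz
    exact hv t ht
      (coordDeriv_injective (hf.jacobian_pos _ (hm t ht)).ne' (hz.trans (map_zero _).symm))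
  · rw [← hi t ht]
    exact hb _ ⟨t, ht, rfl⟩

theorem IsSmoothCircle.subset_inner {A : Set S} (hA : IsSmoothCircle A) : A ⊆ S.inner := by
  obtain ⟨γ, -, -, -, -, -, hi⟩ := hA
  exact hi

theorem IsSmoothCircle.nonempty {A : Set S} (hA : IsSmoothCircle A) : A.Nonempty := by
  obtain ⟨γ, -, -, -, -, rfl, -⟩ := hA
  exact Set.range_nonempty γ

theorem IsSmoothCircle.isPreconnected {A : Set S} (hA : IsSmoothCircle A) : IsPreconnected A := by
  obtain ⟨γ, hc, -, -, -, rfl, -⟩ := hA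
  exact isPreconnected_range hc.continuous

theorem IsSmoothCircle.isCompact {A : Set S} (hA : IsSmoothCircle A) : IsCompact A := by
  obtain ⟨γ, hc, hper, -, -, rfl, -⟩ := hA
  rw [← hper.image_Icc one_pos 0]
  exact isCompact_Icc.image hc.continuous

theorem IsSmoothArc.isPreconnected {A : Set S} (hA : IsSmoothArc A) : IsPreconnected A := by
  obtain ⟨γ, hc, -, -, rfl, -⟩ := hA
  exact isPreconnected_Icc.image _ hc.continuousOn

theorem IsSmoothArc.isCompact {A : Set S} (hA : IsSmoothArc A) : IsCompact A := by
  obtain ⟨γ, hc, -, -, rfl, -⟩ := hA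
  exact isCompact_Icc.image_of_continuousOn hc.continuousOn

theorem IsSmoothArc.inter_bdry_nonempty {A : Set S} (hA : IsSmoothArc A) :
    (A ∩ S.bdry).Nonempty := by
  obtain ⟨γ, hc, -, -, rfl, h, -⟩ := hA
  exact ⟨γ 0, ⟨0, by simp, rfl⟩, (h 0 (by simp)).2 (Or.inl rfl)⟩

theorem TransverseAt.mono {A B A' B' : Set S} {p : S} (h : TransverseAt A B p) (hA : A ⊆ A')
    (hB : B ⊆ B') : TransverseAt A' B' p := by
  obtain ⟨γ, δ, h1, h2, h3, h4, h5⟩ := h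
  exact ⟨γ, δ, h1, h2, h3.mono fun _ h => hA h, h4.mono fun _ h => hB h, h5⟩

theorem TransverseAt.image {f : PartialEquiv S T} (hf : IsOrientedDiffeo f)
    (ho : IsOpen f.source) {A B : Set S} {p : S} (h : TransverseAt A B p) (hp : p ∈ f.source) :
    TransverseAt (f '' A) (f '' B) (f p) := by
  obtain ⟨γ, δ, h1, h2, h3, h4, h5, h6, h7⟩ := h
  have hd := hf.mdifferentiableAt ho hp
  have e1 : velocity (f ∘ γ) 0 = coordDeriv f p (velocity γ 0) := by
    rw [velocity_comp (by rwa [h1]) h5, h1]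
  have e2 : velocity (f ∘ δ) 0 = coordDeriv f p (velocity δ 0) := by
    rw [velocity_comp (by rwa [h2]) h6, h2]
  refine ⟨f ∘ γ, f ∘ δ, by simp [h1], by simp [h2], h3.mono fun t ht => ⟨_, ht, rfl⟩,
    h4.mono fun t ht => ⟨_, ht, rfl⟩, MDifferentiableAt.comp 0 (by rwa [h1]) h5,
    MDifferentiableAt.comp 0 (by rwa [h2]) h6, ?_⟩
  rw [e1, e2]
  have := h7.map' (coordDeriv f p : Plane →ₗ[ℝ] Plane)
    (LinearMap.ker_eq_bot.2 (coordDeriv_injective (hf.jacobian_pos p hp).ne'))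
  have e3 : ![coordDeriv f p (velocity γ 0), coordDeriv f p (velocity δ 0)] =
      (coordDeriv f p : Plane →ₗ[ℝ] Plane) ∘ ![velocity γ 0, velocity δ 0] := by
    funext i
    fin_cases i <;> rfl
  rw [e3]
  exact this

/-- Transversality is a local property of closed pieces. -/
theorem TransverseAt.of_union {A B A' B' : Set S} {p : S} (h : TransverseAt (A ∪ A') (B ∪ B') p)
    (hA : IsClosed A') (hB : IsClosed B') (hpA : p ∉ A') (hpB : p ∉ B') : TransverseAt A B p := by
  obtain ⟨γ, δ, h1, h2, h3, h4, h5, h6, h7⟩ := h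
  refine ⟨γ, δ, h1, h2, ?_, ?_, h5, h6, h7⟩
  · filter_upwards [h3, h5.continuousAt.preimage_mem_nhds
      (hA.isOpen_compl.mem_nhds (by rwa [h1]))] with t ht ht'
    exact ht.resolve_right ht'
  · filter_upwards [h4, h6.continuousAt.preimage_mem_nhds
      (hB.isOpen_compl.mem_nhds (by rwa [h2]))] with t ht ht'
    exact ht.resolve_right ht'

theorem IsPatch.contMDiffAt {e : PartialEquiv ℂ S} (he : IsPatch e) {z : ℂ} (hz : z ∈ e.source) :
    ContMDiffAt 𝓘(ℝ, ℂ) (𝓡∂ 2) ∞ e z :=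
  he.contMDiffOn.contMDiffAt (he.isOpen_source.mem_nhds hz)

theorem IsPatch.trans {e : PartialEquiv ℂ S} (he : IsPatch e) {f : PartialEquiv S T}
    (hf : IsOrientedDiffeo f) (ho : IsOpen f.source) (hs : e.target ⊆ f.source) :
    IsPatch (e.trans f) := by
  have hsrc : (e.trans f).source = e.source := by
    rw [PartialEquiv.trans_source]
    exact Set.inter_eq_left.2 fun z hz => hs (e.map_source hz)
  have htgt : (e.trans f).target = f '' e.target := by
    rw [PartialEquiv.trans_target'', Set.inter_eq_right.2 hs]
  refine ⟨hsrc ▸ he.isOpen_source, htgt ▸ hf.isOpen_image he.isOpen_target hs he.target_subset,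
    ?_, ?_, ?_, ?_⟩
  · rw [htgt]
    rintro _ ⟨p, hp, rfl⟩
    exact hf.mem_inner ho (hs hp) (he.target_subset hp)
  · exact hf.contMDiffOn.comp' he.contMDiffOn
  · exact he.contMDiffOn_symm.comp' hf.contMDiffOn_symm
  · intro z hz
    rw [hsrc] at hz
    have hz' := hs (e.map_source hz)
    rw [PartialEquiv.coe_trans, planeJacobian_comp (hf.mdifferentiableAt ho hz')
      ((he.contMDiffAt hz).mdifferentiableAt (by simp))]
    exact mul_pos (hf.jacobian_pos _ hz') (he.jacobian_pos z hz)

theorem PartialEquiv.trans_source_of_subset {α β γ : Type*} {e : PartialEquiv α β}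
    {f : PartialEquiv β γ} (hs : e.target ⊆ f.source) : (e.trans f).source = e.source := by
  rw [PartialEquiv.trans_source]
  exact Set.inter_eq_left.2 fun z hz => hs (e.map_source hz)

theorem PartialEquiv.trans_target_of_subset {α β γ : Type*} {e : PartialEquiv α β}
    {f : PartialEquiv β γ} (hs : e.target ⊆ f.source) : (e.trans f).target = f '' e.target := by
  rw [PartialEquiv.trans_target'', Set.inter_eq_right.2 hs]

end Curves

/-! ### Oriented surfaces from atlases of pieces -/

/-- A cover of a set `M` by images of open subsets of oriented surfaces, whose changes of coordinates
are orientation-preserving diffeomorphisms between open sets. -/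
structure SurfaceAtlas (M : Type u) where
  ι : Type
  piece : ι → OrientedSurface.{u}
  emb : ∀ k, PartialEquiv (piece k) M
  isOpen_source : ∀ k, IsOpen (emb k).source
  isOpen_transition : ∀ k l, IsOpen ((emb k).trans (emb l).symm).source
  transition : ∀ k l, IsOrientedDiffeo ((emb k).trans (emb l).symm)
  index : M → ι
  mem_target : ∀ m, m ∈ (emb (index m)).target

namespace SurfaceAtlas

variable {M : Type u} (A : SurfaceAtlas M)

/-- The change of coordinates between two pieces, as an open partial homeomorphism. -/
noncomputable def transitionHomeomorph (k l : A.ι) :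
    OpenPartialHomeomorph (A.piece k) (A.piece l) where
  toPartialEquiv := (A.emb k).trans (A.emb l).symm
  open_source := A.isOpen_transition k l
  open_target := by
    have := A.isOpen_transition l k
    rwa [← PartialEquiv.symm_source, PartialEquiv.trans_symm_eq_symm_trans_symm,
      PartialEquiv.symm_symm]
  continuousOn_toFun := (A.transition k l).contMDiffOn.continuousOn
  continuousOn_invFun := (A.transition k l).contMDiffOn_symm.continuousOn

/-- The chart of `M` obtained from a preferred chart of a piece. -/
noncomputable def chart (k : A.ι) (x : A.piece k) : PartialEquiv M (EuclideanHalfSpace 2) :=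
  (A.emb k).symm.trans (chartAt (EuclideanHalfSpace 2) x).toPartialEquiv

/-- The change of charts is a composite of open partial homeomorphisms, which supplies both the
openness and the continuity required of a charted space core. -/
theorem chart_symm_trans (k l : A.ι) (x : A.piece k) (y : A.piece l) :
    (A.chart k x).symm.trans (A.chart l y) =
      (((chartAt (EuclideanHalfSpace 2) x).symm.trans (A.transitionHomeomorph k l)).trans
        (chartAt (EuclideanHalfSpace 2) y)).toPartialEquiv := by
  simp [chart, transitionHomeomorph, PartialEquiv.trans_symm_eq_symm_trans_symm,
    PartialEquiv.trans_assoc]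

/-- The charted space core. -/
noncomputable def core : ChartedSpaceCore (EuclideanHalfSpace 2) M where
  atlas := {c | ∃ k x, c = A.chart k x}
  chartAt m := A.chart (A.index m) ((A.emb (A.index m)).symm m)
  mem_chart_source m := by
    simp only [chart, PartialEquiv.trans_source, PartialEquiv.symm_source]
    exact ⟨A.mem_target m, mem_chart_source _ _⟩
  chart_mem_atlas m := ⟨_, _, rfl⟩
  open_source := by
    rintro _ _ ⟨k, x, rfl⟩ ⟨l, y, rfl⟩
    rw [chart_symm_trans]
    exact OpenPartialHomeomorph.open_source _
  continuousOn_toFun := by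
    rintro _ _ ⟨k, x, rfl⟩ ⟨l, y, rfl⟩
    rw [chart_symm_trans]
    exact OpenPartialHomeomorph.continuousOn _

/-- The topology on `M`. -/
@[reducible] noncomputable def topology : TopologicalSpace M := A.core.toTopologicalSpace

/-- The charted space structure on `M`. -/
@[reducible] noncomputable def chartedSpace :
    @ChartedSpace (EuclideanHalfSpace 2) _ M A.topology := A.core.toChartedSpace

theorem isManifold : @IsManifold ℝ _ _ _ _ _ _ (𝓡∂ 2) ∞ M A.topology A.chartedSpace := by
  let _ := A.topology
  let _ := A.chartedSpace
  apply isManifold_of_contDiffOn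
  intro e e' he he'
  have hatlas : ∀ e : OpenPartialHomeomorph M (EuclideanHalfSpace 2),
      e ∈ atlas (EuclideanHalfSpace 2) M →
      ∃ k x, e = A.core.openPartialHomeomorph (A.chart k x) ⟨k, x, rfl⟩ := by
    intro e he
    obtain ⟨_, ⟨k, x, rfl⟩, hk⟩ := Set.mem_iUnion₂.1 (he : e ∈ ⋃ (c : PartialEquiv M _)
      (hc : c ∈ A.core.atlas), {A.core.openPartialHomeomorph c hc})
    exact ⟨k, x, hk⟩
  obtain ⟨k, x, rfl⟩ := hatlas e he
  obtain ⟨l, y, rfl⟩ := hatlas e' he'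
  -- Smoothness of the transition, read in the charts at `x` and `y`, is smoothness of the
  -- coordinate change; only the domains remain to be matched.
  have := (contMDiffOn_iff.1 (A.transition k l).contMDiffOn).2 x y
  refine (this.congr_mono (fun z hz => rfl) ?_)
  rintro z ⟨hz, hz'⟩
  have hz1 : (𝓡∂ 2).symm z ∈ ((A.chart k x).symm.trans (A.chart l y)).source := hz
  rw [chart_symm_trans] at hz1
  simp only [mfld_simps, transitionHomeomorph] at hz1 ⊢
  simp only [Set.mem_range] at hz'
  tauto

variable (hT2 : @T2Space M A.topology) (hC : @CompactSpace M A.topology)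

/-- The surface defined by an atlas. -/
noncomputable def surface : OrientedSurface.{u} :=
  letI := A.topology
  letI := A.chartedSpace
  haveI := A.isManifold
  { carrier := M
    top := A.topology
    charted := A.chartedSpace
    smooth := A.isManifold
    t2 := hT2
    compact := hC
    oriented := by
      intro x y z hx hy
      rw [tangentCoordChange_def]
      have hx' : z ∈ (A.chart (A.index x) ((A.emb (A.index x)).symm x)).source := hx
      have hy' : z ∈ (A.chart (A.index y) ((A.emb (A.index y)).symm y)).source := hy
      set k := A.index x
      set l := A.index y
      simp only [chart, PartialEquiv.trans_source, PartialEquiv.symm_source] at hx' hy'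
      have hs : (A.emb k).symm z ∈ ((A.emb k).trans (A.emb l).symm).source := by
        rw [PartialEquiv.trans_source]
        refine ⟨(A.emb k).map_target hx'.1, ?_⟩
        simp only [Set.mem_preimage, (A.emb k).right_inv hx'.1]
        exact hy'.1
      -- The coordinate change of the new surface is, by definition, the transition between two
      -- pieces read in their preferred charts.
      have := det_fderivWithin_extChartAt_comp_pos (x := (A.emb k).symm x)
        (y := (A.emb l).symm y) (z := (A.emb k).symm z)
        ((A.transition k l).mdifferentiableAt (A.isOpen_transition k l) hs)
        ((A.transition k l).jacobian_pos _ hs)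
        (by rw [extChartAt_source]; exact hx'.2)
        (by
          rw [extChartAt_source, PartialEquiv.coe_trans, Function.comp_apply,
            (A.emb k).right_inv hx'.1]
          exact hy'.2)
      exact this }

/-- The pieces, as partial maps to the surface. -/
noncomputable def toSurface (k : A.ι) : PartialEquiv (A.piece k) (A.surface hT2 hC) := A.emb k

theorem continuousOn_emb (k : A.ι) :
    @ContinuousOn _ _ _ A.topology (A.emb k) (A.emb k).source := by
  let _ := A.topology
  intro p hp
  set c := A.core.openPartialHomeomorph (A.chart k p) ⟨k, p, rfl⟩
  have h1 : ContinuousAt c.symm (chartAt (EuclideanHalfSpace 2) p p) := by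
    refine c.continuousAt_symm ?_
    change _ ∈ (A.chart k p).target
    simp only [chart, PartialEquiv.trans_target]
    refine ⟨(chartAt _ p).map_source (mem_chart_source _ p), ?_⟩
    simpa using hp
  have h2 : ContinuousAt (c.symm ∘ chartAt (EuclideanHalfSpace 2) p) p :=
    h1.comp ((chartAt (EuclideanHalfSpace 2) p).continuousAt (mem_chart_source _ p))
  refine (h2.congr ?_).continuousWithinAt
  filter_upwards [(chartAt (EuclideanHalfSpace 2) p).open_source.mem_nhds (mem_chart_source _ p)]
    with x hx
  change A.emb k ((chartAt (EuclideanHalfSpace 2) p).symm (chartAt (EuclideanHalfSpace 2) p x)) = _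
  rw [(chartAt (EuclideanHalfSpace 2) p).left_inv hx]

theorem continuousAt_emb_symm (k : A.ι) {m : M} (hm : m ∈ (A.emb k).target) :
    @ContinuousAt _ _ A.topology _ (A.emb k).symm m ∧ (A.emb k).target ∈ @nhds _ A.topology m := by
  let _ := A.topology
  set p := (A.emb k).symm m
  set c := A.core.openPartialHomeomorph (A.chart k p) ⟨k, p, rfl⟩
  have hs : c.source =
      (A.emb k).target ∩ (A.emb k).symm ⁻¹' (chartAt (EuclideanHalfSpace 2) p).source := by
    change (A.chart k p).source = _
    simp only [chart, PartialEquiv.trans_source, PartialEquiv.symm_source]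
  have hmc : m ∈ c.source := by
    rw [hs]
    exact ⟨hm, mem_chart_source _ p⟩
  refine ⟨?_, ?_⟩
  · have h1 : ContinuousAt ((chartAt (EuclideanHalfSpace 2) p).symm ∘ c) m :=
      ContinuousAt.comp ((chartAt (EuclideanHalfSpace 2) p).continuousAt_symm
        ((chartAt (EuclideanHalfSpace 2) p).map_source (mem_chart_source _ p))) (c.continuousAt hmc)
    refine h1.congr ?_
    filter_upwards [c.open_source.mem_nhds hmc] with x hx
    rw [hs] at hx
    exact (chartAt (EuclideanHalfSpace 2) p).left_inv hx.2
  · filter_upwards [c.open_source.mem_nhds hmc] with x hx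
    rw [hs] at hx
    exact hx.1

theorem isOpen_target (k : A.ι) : @IsOpen _ A.topology (A.emb k).target := by
  let _ := A.topology
  exact isOpen_iff_mem_nhds.2 fun m hm => (A.continuousAt_emb_symm k hm).2

/-- The preferred chart at `m` passes through the piece `A.index m`. In that chart the inclusion of
piece `k` reads as a transition map, whose smoothness and Jacobian are known. -/
theorem isOrientedDiffeo_toSurface (k : A.ι) : IsOrientedDiffeo (A.toSurface hT2 hC k) := by
  have h1 : ContMDiffOn (𝓡∂ 2) (𝓡∂ 2) ∞ (A.toSurface hT2 hC k) (A.emb k).source := by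
    refine contMDiffOn_iff.2 ⟨A.continuousOn_emb k, fun x m => ?_⟩
    have := (contMDiffOn_iff.1 (A.transition k (A.index m)).contMDiffOn).2 x
      ((A.emb (A.index m)).symm m)
    refine this.congr_mono (fun z hz => rfl) ?_
    rintro z ⟨hz, hz', hz''⟩
    have h2 : A.emb k ((extChartAt (𝓡∂ 2) x).symm z) ∈
        (A.chart (A.index m) ((A.emb (A.index m)).symm m)).source := by
      rw [Set.mem_preimage, extChartAt_source] at hz''
      exact hz''
    simp only [chart, PartialEquiv.trans_source, PartialEquiv.symm_source] at h2
    refine ⟨hz, ⟨hz', h2.1⟩, ?_⟩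
    rw [Set.mem_preimage, extChartAt_source]
    exact h2.2
  refine ⟨h1, ?_, ?_⟩
  · refine contMDiffOn_iff.2 ⟨fun m hm =>
      ContinuousAt.continuousWithinAt (α := A.surface hT2 hC) (A.continuousAt_emb_symm k hm).1,
      fun m x => ?_⟩
    have := (contMDiffOn_iff.1 (A.transition (A.index m) k).contMDiffOn).2
      ((A.emb (A.index m)).symm m) x
    refine this.congr_mono (fun z hz => rfl) ?_
    rintro z ⟨hz, hz', hz''⟩
    have h2 : (𝓡∂ 2).symm z ∈ (A.chart (A.index m) ((A.emb (A.index m)).symm m)).target ∧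
        z ∈ Set.range (𝓡∂ 2) := by
      simp only [extChartAt_target] at hz
      exact hz
    simp only [chart, PartialEquiv.trans_target] at h2
    refine ⟨?_, ⟨?_, hz'⟩, hz''⟩
    · rw [extChartAt_target]
      exact ⟨h2.1.1, h2.2⟩
    · exact h2.1.2
  · intro p hp
    have hd : MDifferentiableAt (𝓡∂ 2) (𝓡∂ 2) (A.toSurface hT2 hC k) p :=
      (h1.contMDiffAt ((A.isOpen_source k).mem_nhds hp)).mdifferentiableAt (by simp)
    set l := A.index (A.emb k p)
    have hs : p ∈ ((A.emb k).trans (A.emb l).symm).source := by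
      rw [PartialEquiv.trans_source]
      exact ⟨hp, A.mem_target _⟩
    have hd' := (A.transition k l).mdifferentiableAt (A.isOpen_transition k l) hs
    have hu : UniqueDiffWithinAt ℝ (Set.range (𝓡∂ 2)) (extChartAt (𝓡∂ 2) p p) :=
      (𝓡∂ 2).uniqueDiffOn _ (by simp [extChartAt])
    -- Both maps have the same expression in the preferred charts, so uniqueness of the derivative
    -- within the half-plane applies.
    have e1 : coordDeriv (A.toSurface hT2 hC k) p =
        coordDeriv ((A.emb k).trans (A.emb l).symm) p :=
      hu.eq (hasFDerivWithinAt_coordDeriv hd) (hasFDerivWithinAt_coordDeriv hd')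
    rw [jacobian_eq_det, e1]
    exact (A.transition k l).jacobian_pos p hs

theorem mem_bdry_surface_iff {m : A.surface hT2 hC} {k : A.ι} (hk : A.index m = k) :
    m ∈ (A.surface hT2 hC).bdry ↔ (A.emb k).symm m ∈ (A.piece k).bdry := by
  subst hk
  rw [OrientedSurface.mem_bdry_iff, OrientedSurface.mem_bdry_iff]
  exact Iff.rfl

theorem isOpen_image_emb (k : A.ι) {U : Set (A.piece k)} (hU : IsOpen U)
    (hs : U ⊆ (A.emb k).source) : @IsOpen _ A.topology (A.emb k '' U) := by
  let _ := A.topology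
  refine isOpen_iff_mem_nhds.2 ?_
  rintro _ ⟨p, hp, rfl⟩
  obtain ⟨h1, h2⟩ := A.continuousAt_emb_symm k ((A.emb k).map_source (hs hp))
  have h3 := h1.preimage_mem_nhds (t := U)
    (by rw [(A.emb k).left_inv (hs hp)]; exact hU.mem_nhds hp)
  filter_upwards [h2, h3] with m hm hm'
  exact ⟨_, hm', (A.emb k).right_inv hm⟩

theorem exists_separation (k : A.ι) {m n : M} (hm : m ∈ (A.emb k).target)
    (hn : n ∈ (A.emb k).target) (hne : m ≠ n) :
    ∃ u v : Set M, @IsOpen _ A.topology u ∧ @IsOpen _ A.topology v ∧ m ∈ u ∧ n ∈ v ∧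
      Disjoint u v := by
  have hne' : (A.emb k).symm m ≠ (A.emb k).symm n := fun h =>
    hne ((A.emb k).symm.injOn hm hn h)
  obtain ⟨u, v, hu, hv, hmu, hnv, huv⟩ := t2_separation hne'
  refine ⟨A.emb k '' (u ∩ (A.emb k).source), A.emb k '' (v ∩ (A.emb k).source),
    A.isOpen_image_emb k (hu.inter (A.isOpen_source k)) Set.inter_subset_right,
    A.isOpen_image_emb k (hv.inter (A.isOpen_source k)) Set.inter_subset_right,
    ⟨_, ⟨hmu, (A.emb k).map_target hm⟩, (A.emb k).right_inv hm⟩,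
    ⟨_, ⟨hnv, (A.emb k).map_target hn⟩, (A.emb k).right_inv hn⟩, ?_⟩
  rw [Set.disjoint_left]
  rintro _ ⟨p, hp, rfl⟩ ⟨q, hq, hpq⟩
  have := (A.emb k).injOn hq.2 hp.2 hpq
  subst this
  exact Set.disjoint_left.1 huv hp.1 hq.1

theorem isCompact_image_emb (k : A.ι) {K : Set (A.piece k)} (hK : IsCompact K)
    (hs : K ⊆ (A.emb k).source) : @IsCompact _ A.topology (A.emb k '' K) := by
  let _ := A.topology
  exact hK.image_of_continuousOn ((A.continuousOn_emb k).mono hs)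

end SurfaceAtlas

/-! ### Glued surfaces -/

/-- The part of the gluing relation that only concerns the surfaces. -/
structure SurfaceGluing {S S' S'' : OrientedSurface.{u}} (φ : PartialEquiv S S')
    (i : PartialEquiv S S'') (i' : PartialEquiv S' S'') : Prop where
  source_subset : φ.source ⊆ S.bdry
  target_subset : φ.target ⊆ S'.bdry
  source_left : i.source = Set.univ
  source_right : i'.source = Set.univ
  left : IsOrientedDiffeo i
  right : IsOrientedDiffeo i'
  cover : i.target ∪ i'.target = Set.univ
  meet : ∀ p q, i p = i' q ↔ p ∈ φ.source ∧ φ p = q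
  bdry : S''.bdry = i '' (S.bdry \ φ.source) ∪ i' '' (S'.bdry \ φ.target)

namespace SurfaceGluing

variable {S S' S'' : OrientedSurface.{u}} {φ : PartialEquiv S S'} {i : PartialEquiv S S''}
  {i' : PartialEquiv S' S''}

theorem symm (G : SurfaceGluing φ i i') : SurfaceGluing φ.symm i' i where
  source_subset := G.target_subset
  target_subset := G.source_subset
  source_left := G.source_right
  source_right := G.source_left
  left := G.right
  right := G.left
  cover := by rw [Set.union_comm]; exact G.cover
  meet p q := by
    rw [eq_comm, G.meet]
    constructor
    · rintro ⟨h1, rfl⟩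
      exact ⟨φ.map_source h1, φ.left_inv h1⟩
    · rintro ⟨h1, rfl⟩
      exact ⟨φ.map_target h1, φ.right_inv h1⟩
  bdry := by rw [Set.union_comm]; exact G.bdry

theorem mem_source (G : SurfaceGluing φ i i') (p : S) : p ∈ i.source := by
  rw [G.source_left]; trivial

theorem isOpen_source (G : SurfaceGluing φ i i') : IsOpen i.source := by
  rw [G.source_left]; exact isOpen_univ

theorem mem_target (G : SurfaceGluing φ i i') (p : S) : i p ∈ i.target :=
  i.map_source (G.mem_source p)

theorem injective (G : SurfaceGluing φ i i') : Function.Injective i := fun p q h =>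
  i.injOn (G.mem_source p) (G.mem_source q) h

theorem symm_apply (G : SurfaceGluing φ i i') (p : S) : i.symm (i p) = p :=
  i.left_inv (G.mem_source p)

theorem mem_target_iff (_ : SurfaceGluing φ i i') {x : S''} : x ∈ i.target ↔ ∃ p, i p = x := by
  constructor
  · exact fun h => ⟨_, i.right_inv h⟩
  · rintro ⟨p, rfl⟩
    exact i.map_source (by simp [SurfaceGluing.source_left ‹_›])

theorem exists_preimage (G : SurfaceGluing φ i i') (x : S'') : (∃ p, i p = x) ∨ ∃ q, i' q = x := by
  have : x ∈ i.target ∪ i'.target := by rw [G.cover]; trivial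
  exact this.imp (G.mem_target_iff).1 (G.symm.mem_target_iff).1

theorem continuous (G : SurfaceGluing φ i i') : Continuous i := by
  have := G.left.contMDiffOn.continuousOn
  rwa [G.source_left, ← continuousOn_univ] at *

theorem mem_inner (G : SurfaceGluing φ i i') {p : S} (hp : p ∈ S.inner) : i p ∈ S''.inner :=
  G.left.mem_inner G.isOpen_source (G.mem_source p) hp

/-- The pieces meet only along the seam, which consists of boundary points. -/
theorem ne_of_mem_inner (G : SurfaceGluing φ i i') {p : S} (hp : p ∈ S.inner) (q : S') :
    i p ≠ i' q := fun h =>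
  OrientedSurface.notMem_bdry.2 hp (G.source_subset ((G.meet p q).1 h).1)

theorem mem_bdry_left_iff (G : SurfaceGluing φ i i') {p : S} :
    i p ∈ S''.bdry ↔ p ∈ S.bdry \ φ.source := by
  rw [G.bdry]
  constructor
  · rintro (⟨q, hq, h⟩ | ⟨q, hq, h⟩)
    · rwa [← G.injective h]
    · obtain ⟨h1, rfl⟩ := (G.meet p q).1 h.symm
      exact absurd (φ.map_source h1) hq.2
  · exact fun h => Or.inl ⟨p, h, rfl⟩

end SurfaceGluing

/-! ### Construction of the glued surface after surgery on the left piece -/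

/-- A glued surface together with a modification of the left piece away from its boundary. -/
structure Surgery (S S' S'' T : OrientedSurface.{u}) where
  φ : PartialEquiv S S'
  i : PartialEquiv S S''
  i' : PartialEquiv S' S''
  o : PartialEquiv S T
  b : PartialEquiv S T
  -- Only a junk value, for the inverse of `inc` outside the copy of `T`.
  base : T
  gluing : SurfaceGluing φ i i'
  diffeo : IsOrientedDiffeo o
  isOpen_source : IsOpen o.source
  isOpen_target : IsOpen o.target
  b_source : b.source = S.bdry
  b_target : b.target = T.bdry
  b_eqOn : Set.EqOn b o S.bdry
  bdry_subset : S.bdry ⊆ o.source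

namespace Surgery

variable {S S' S'' T : OrientedSurface.{u}} (G : Surgery S S' S'' T)

theorem exists_of_mem_bdry {t : T} (ht : t ∈ T.bdry) : ∃ p ∈ S.bdry, G.o p = t ∧ G.b.symm t = p := by
  have h1 : t ∈ G.b.target := G.b_target ▸ ht
  have h2 : G.b.symm t ∈ S.bdry := G.b_source ▸ G.b.map_target h1
  exact ⟨_, h2, by rw [← G.b_eqOn h2, G.b.right_inv h1], rfl⟩

theorem bdry_subset_target : T.bdry ⊆ G.o.target := by
  intro t ht
  obtain ⟨p, hp, rfl, -⟩ := G.exists_of_mem_bdry ht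
  exact G.o.map_source (G.bdry_subset hp)

theorem mem_bdry_iff {p : S} (hp : p ∈ G.o.source) : G.o p ∈ T.bdry ↔ p ∈ S.bdry := by
  constructor
  · intro h
    obtain ⟨q, hq, h', -⟩ := G.exists_of_mem_bdry h
    rwa [← G.o.injOn (G.bdry_subset hq) hp h']
  · intro h
    rw [← G.b_eqOn h, ← G.b_target]
    exact G.b.map_source (G.b_source ▸ h)

theorem symm_mem_bdry_iff {t : T} (ht : t ∈ G.o.target) : G.o.symm t ∈ S.bdry ↔ t ∈ T.bdry := by
  rw [← G.mem_bdry_iff (G.o.map_target ht), G.o.right_inv ht]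

theorem mem_inner_iff {p : S} (hp : p ∈ G.o.source) : G.o p ∈ T.inner ↔ p ∈ S.inner := by
  rw [← OrientedSurface.notMem_bdry, ← OrientedSurface.notMem_bdry, G.mem_bdry_iff hp]

/-- The underlying set of the new surface. -/
abbrev Carrier : Type u := T ⊕ {x : S'' // x ∉ G.i.target}

open Classical in
/-- The inclusion of the unchanged part of the glued surface. -/
noncomputable def keep : PartialEquiv S'' G.Carrier where
  toFun x := if h : x ∈ G.i.target then Sum.inl (G.o (G.i.symm x)) else Sum.inr ⟨x, h⟩
  invFun := Sum.elim (fun t => G.i (G.o.symm t)) Subtype.val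
  -- Points outside the left piece are all kept. Seam points belong to the left piece, so they are
  -- represented in `T`, and each point of the new surface has one representative.
  source := {x | x ∈ G.i.target → G.i.symm x ∈ G.o.source}
  target := {m | Sum.elim (fun t => t ∈ G.o.target) (fun _ => True) m}
  map_source' x hx := by
    by_cases h : x ∈ G.i.target
    · simpa [h] using G.o.map_source (hx h)
    · simp [h]
  map_target' := by
    rintro (t | ⟨x, hx⟩) hm
    · intro _
      simpa [G.gluing.symm_apply] using G.o.map_target hm
    · exact fun h => absurd h hx
  left_inv' x hx := by
    by_cases h : x ∈ G.i.target
    · simp only [h, dif_pos, Sum.elim_inl]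
      rw [G.o.left_inv (hx h), G.i.right_inv h]
    · simp [h]
  right_inv' := by
    rintro (t | ⟨x, hx⟩) hm
    · have := G.o.right_inv (show t ∈ G.o.target from hm)
      simp [G.gluing.mem_target, G.gluing.symm_apply, this]
    · simp [hx]

theorem keep_left (p : S) : G.keep (G.i p) = Sum.inl (G.o p) := by
  simp [keep, G.gluing.mem_target, G.gluing.symm_apply]

theorem keep_of_notMem {x : S''} (hx : x ∉ G.i.target) : G.keep x = Sum.inr ⟨x, hx⟩ := by
  simp [keep, hx]

theorem left_mem_keep_source {p : S} : G.i p ∈ G.keep.source ↔ p ∈ G.o.source := by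
  simp [keep, G.gluing.mem_target, G.gluing.symm_apply]

theorem right_mem_keep_source (q : S') : G.i' q ∈ G.keep.source := by
  intro h
  obtain ⟨p, hp⟩ := G.gluing.mem_target_iff.1 h
  rw [← hp, G.gluing.symm_apply]
  exact G.bdry_subset (G.gluing.source_subset ((G.gluing.meet p q).1 hp).1)

theorem keep_source : G.keep.source = (G.i '' G.o.sourceᶜ)ᶜ := by
  ext x
  by_cases h : x ∈ G.i.target
  · obtain ⟨p, rfl⟩ := G.gluing.mem_target_iff.1 h
    simp [left_mem_keep_source, G.gluing.injective.eq_iff]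
  · have h1 : x ∈ G.keep.source := fun h' => absurd h' h
    have h2 : x ∉ G.i '' G.o.sourceᶜ := by
      rintro ⟨p, -, rfl⟩
      exact h (G.gluing.mem_target p)
    simp [h1, h2]

/-- The points left out form the image under `i` of a closed, hence compact, subset of `S`. -/
theorem isOpen_keep_source : IsOpen G.keep.source := by
  rw [keep_source]
  exact (G.isOpen_source.isClosed_compl.isCompact.image G.gluing.continuous).isClosed.isOpen_compl

/-- The inclusion of the interior of the new piece. -/
noncomputable def inc : PartialEquiv T G.Carrier where
  toFun := Sum.inl
  invFun := Sum.elim id fun _ => G.base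
  -- At seam points `T` alone does not give a neighbourhood in the new surface; all boundary points
  -- of `T` are covered by `keep`.
  source := T.inner
  target := Sum.inl '' T.inner
  map_source' t ht := ⟨t, ht, rfl⟩
  map_target' := by rintro _ ⟨t, ht, rfl⟩; exact ht
  left_inv' t _ := rfl
  right_inv' := by rintro _ ⟨t, ht, rfl⟩; rfl

theorem transition_source :
    (G.keep.trans G.inc.symm).source = G.i '' (G.o.source ∩ S.inner) := by
  ext x
  rw [PartialEquiv.trans_source]
  constructor
  · rintro ⟨h1, t, ht, h2⟩
    by_cases h : x ∈ G.i.target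
    · obtain ⟨p, rfl⟩ := G.gluing.mem_target_iff.1 h
      have hp := G.left_mem_keep_source.1 h1
      rw [keep_left] at h2
      obtain rfl := Sum.inl_injective h2
      exact ⟨p, ⟨hp, (G.mem_inner_iff hp).1 ht⟩, rfl⟩
    · rw [G.keep_of_notMem h] at h2
      cases h2
  · rintro ⟨p, ⟨hp, hi⟩, rfl⟩
    refine ⟨G.left_mem_keep_source.2 hp, ?_⟩
    rw [Set.mem_preimage, keep_left]
    exact ⟨_, (G.mem_inner_iff hp).2 hi, rfl⟩

theorem isOpen_transition_source : IsOpen (G.keep.trans G.inc.symm).source := by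
  rw [transition_source]
  exact G.gluing.left.isOpen_image (G.isOpen_source.inter S.isOpen_inner)
    (fun p _ => G.gluing.mem_source p) Set.inter_subset_right

theorem isOpen_transition_target : IsOpen (G.keep.trans G.inc.symm).target := by
  have : (G.keep.trans G.inc.symm).target = G.o '' (G.o.source ∩ S.inner) := by
    rw [← PartialEquiv.image_source_eq_target, transition_source, Set.image_image]
    refine Set.image_congr fun p _ => ?_
    rw [PartialEquiv.coe_trans, Function.comp_apply, keep_left]
    rfl
  rw [this]
  exact G.diffeo.isOpen_image (G.isOpen_source.inter S.isOpen_inner)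
    Set.inter_subset_left Set.inter_subset_right

/-- On the overlap, the interior of the unchanged left part, the transition is `o` after the inverse
of `i`. Restricting `i` to interior points makes its image open, so that it can be inverted. -/
theorem isOrientedDiffeo_transition : IsOrientedDiffeo (G.keep.trans G.inc.symm) := by
  have hU : IsOpen (G.o.source ∩ S.inner) := G.isOpen_source.inter S.isOpen_inner
  have ho : IsOpen (G.i.restr (G.o.source ∩ S.inner)).source := by
    rw [PartialEquiv.restr_source, G.gluing.source_left, Set.univ_inter]
    exact hU
  have ht : (G.i.restr (G.o.source ∩ S.inner)).target = G.i '' (G.o.source ∩ S.inner) := by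
    rw [← PartialEquiv.image_source_eq_target, PartialEquiv.restr_source, G.gluing.source_left,
      Set.univ_inter]
    rfl
  have hot : IsOpen (G.i.restr (G.o.source ∩ S.inner)).target := by
    rw [ht]
    exact G.gluing.left.isOpen_image hU (fun p _ => G.gluing.mem_source p) Set.inter_subset_right
  have h1 := (G.gluing.left.restr (G.o.source ∩ S.inner)).symm ho hot
  have h2 := h1.trans G.diffeo hot G.isOpen_source
  have hs : ((G.i.restr (G.o.source ∩ S.inner)).symm.trans G.o).source =
      G.i '' (G.o.source ∩ S.inner) := by
    rw [PartialEquiv.trans_source, PartialEquiv.symm_source, ht, Set.inter_eq_left]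
    rintro _ ⟨p, hp, rfl⟩
    rw [Set.mem_preimage]
    change G.i.symm (G.i p) ∈ _
    rw [G.gluing.symm_apply]
    exact hp.1
  refine h2.congr ?_ ?_ ?_
  · rw [hs, ← ht]
    exact hot
  · rw [hs, transition_source]
  · rw [hs]
    rintro _ ⟨p, hp, rfl⟩
    change G.inc.symm (G.keep (G.i p)) = G.o (G.i.symm (G.i p))
    rw [keep_left, G.gluing.symm_apply]
    rfl

/-- The two pieces of the new surface. -/
abbrev piece : Bool → OrientedSurface.{u}
  | true => S''
  | false => T

/-- The inclusions of the two pieces. -/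
noncomputable def emb : ∀ k, PartialEquiv (piece (S'' := S'') (T := T) k) G.Carrier
  | true => G.keep
  | false => G.inc

theorem isOpen_emb_source : ∀ k, IsOpen (G.emb k).source
  | true => G.isOpen_keep_source
  | false => T.isOpen_inner

theorem transition_symm : (G.keep.trans G.inc.symm).symm = G.inc.trans G.keep.symm := by
  rw [PartialEquiv.trans_symm_eq_symm_trans_symm, PartialEquiv.symm_symm]

theorem self_trans_symm {α β : Type*} (e : PartialEquiv α β) :
    (e.trans e.symm).source = e.source ∧ Set.EqOn (e.trans e.symm) id e.source := by
  refine ⟨?_, fun x hx => e.left_inv hx⟩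
  rw [PartialEquiv.trans_source]
  exact Set.inter_eq_left.2 fun x hx => e.map_source hx

open Classical in
/-- The atlas of the new surface. -/
noncomputable def atlas : SurfaceAtlas G.Carrier where
  ι := Bool
  piece := piece (S'' := S'') (T := T)
  emb := G.emb
  isOpen_source := G.isOpen_emb_source
  isOpen_transition := by
    rintro (_ | _) (_ | _)
    · rw [(self_trans_symm _).1]
      exact G.isOpen_emb_source false
    · have := G.isOpen_transition_target
      rwa [← PartialEquiv.symm_source, transition_symm] at this
    · exact G.isOpen_transition_source
    · rw [(self_trans_symm _).1]
      exact G.isOpen_emb_source true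
  transition := by
    have h0 : ∀ k, IsOrientedDiffeo ((G.emb k).trans (G.emb k).symm) := fun k =>
      IsOrientedDiffeo.of_eqOn_id (by rw [(self_trans_symm _).1]; exact G.isOpen_emb_source k)
        (by rw [(self_trans_symm _).1]; exact (self_trans_symm _).2)
    rintro (_ | _) (_ | _)
    · exact h0 false
    · have := G.isOrientedDiffeo_transition.symm G.isOpen_transition_source
        G.isOpen_transition_target
      rwa [transition_symm] at this
    · exact G.isOrientedDiffeo_transition
    · exact h0 true
  -- `keep` takes precedence wherever it is available, so boundary points are always read in charts
  -- of `S''`.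
  index m := decide (m ∈ G.keep.target)
  mem_target := by
    intro m
    have key : ∀ k, decide (m ∈ G.keep.target) = k → m ∈ (G.emb k).target →
        m ∈ (G.emb (decide (m ∈ G.keep.target))).target := by
      rintro _ rfl h
      exact h
    by_cases h : m ∈ G.keep.target
    · exact key true (decide_eq_true h) h
    · refine key false (decide_eq_false h) ?_
      rcases m with t | x
      · refine ⟨t, ?_, rfl⟩
        rw [← OrientedSurface.notMem_bdry]
        exact fun ht => h (G.bdry_subset_target ht)
      · exact absurd trivial h

/-- The part of `T` not carried over from `S` is closed and misses the boundary, so normality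
applies. The set `u` keeps the new part away from the seam and drives both the Hausdorff and the
compactness proofs. -/
theorem exists_collar : ∃ u : Set T, IsOpen u ∧ G.o.targetᶜ ⊆ u ∧ closure u ⊆ T.inner := by
  refine normal_exists_closure_subset G.isOpen_target.isClosed_compl T.isOpen_inner ?_
  intro t ht
  rw [← OrientedSurface.notMem_bdry]
  exact fun h => ht (G.bdry_subset_target h)

/-- The case in which no single piece contains both points: `m` lies in the new part of `T`, while
`n` lies on the boundary of `T` or outside `T`. The neighbourhoods are `u` and what remains of the
glued surface off the closure of `u`. -/
theorem separation_mixed {m n : G.Carrier} (hm : m ∉ G.keep.target) (hn : n ∉ G.inc.target) :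
    ∃ u v : Set G.Carrier, @IsOpen _ G.atlas.topology u ∧ @IsOpen _ G.atlas.topology v ∧
      m ∈ u ∧ n ∈ v ∧ Disjoint u v := by
  obtain ⟨u, hu, hKu, hui⟩ := G.exists_collar
  -- The part of the left piece that is carried outside the closure of `u`; removing the rest of the
  -- left piece leaves an open subset of `S''`.
  set C := G.o.source ∩ G.o ⁻¹' (closure u)ᶜ with hCdef
  have hC : IsOpen C := G.diffeo.contMDiffOn.continuousOn.isOpen_inter_preimage G.isOpen_source
    isClosed_closure.isOpen_compl
  have hV : IsOpen (G.i '' Cᶜ)ᶜ :=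
    (hC.isClosed_compl.isCompact.image G.gluing.continuous).isClosed.isOpen_compl
  have hVs : (G.i '' Cᶜ)ᶜ ⊆ G.keep.source := by
    rw [keep_source]
    exact Set.compl_subset_compl.2 (Set.image_mono (Set.compl_subset_compl.2
      Set.inter_subset_left))
  refine ⟨G.inc '' u, G.keep '' (G.i '' Cᶜ)ᶜ,
    G.atlas.isOpen_image_emb false hu (subset_closure.trans hui),
    G.atlas.isOpen_image_emb true hV hVs, ?_, ?_, ?_⟩
  · rcases m with t | x
    · exact ⟨t, hKu hm, rfl⟩
    · exact absurd trivial hm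
  · have hnk : n ∈ G.keep.target := by
      rcases n with t | x
      · refine G.bdry_subset_target ?_
        rw [← OrientedSurface.notMem_inner]
        exact fun h => hn ⟨t, h, rfl⟩
      · trivial
    refine ⟨G.keep.symm n, ?_, G.keep.right_inv hnk⟩
    rintro ⟨p, hp, hpn⟩
    have h1 : G.keep (G.i p) = n := by rw [hpn, G.keep.right_inv hnk]
    have h2 : p ∈ G.o.source := by
      rw [← left_mem_keep_source, hpn]
      exact G.keep.map_target hnk
    rw [keep_left] at h1
    refine hp ⟨h2, fun h3 => hn ⟨G.o p, hui h3, h1⟩⟩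
  · rw [Set.disjoint_left]
    rintro _ ⟨t, ht, rfl⟩ ⟨x, hx, hxt⟩
    by_cases h : x ∈ G.i.target
    · obtain ⟨p, rfl⟩ := G.gluing.mem_target_iff.1 h
      rw [keep_left] at hxt
      have h4 : G.o p = t := Sum.inl_injective hxt
      refine hx ⟨p, fun hp => hp.2 ?_, rfl⟩
      rw [h4]
      exact subset_closure ht
    · rw [G.keep_of_notMem h] at hxt
      cases hxt

theorem mem_inc_target_of_notMem_keep_target {m : G.Carrier} (hm : m ∉ G.keep.target) :
    m ∈ G.inc.target := by
  have h := G.atlas.mem_target m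
  have hi : G.atlas.index m = false := by simp [atlas, hm]
  rwa [hi] at h

theorem t2Space : @T2Space _ G.atlas.topology := by
  let _ := G.atlas.topology
  refine ⟨fun m n hne => ?_⟩
  by_cases hm : m ∈ G.keep.target <;> by_cases hn : n ∈ G.keep.target
  · exact G.atlas.exists_separation true hm hn hne
  · by_cases hm' : m ∈ G.inc.target
    · exact G.atlas.exists_separation false hm' (G.mem_inc_target_of_notMem_keep_target hn) hne
    · obtain ⟨u, v, hu, hv, h1, h2, h3⟩ := G.separation_mixed hn hm'
      exact ⟨v, u, hv, hu, h2, h1, h3.symm⟩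
  · by_cases hn' : n ∈ G.inc.target
    · exact G.atlas.exists_separation false (G.mem_inc_target_of_notMem_keep_target hm) hn' hne
    · exact G.separation_mixed hm hn'
  · exact G.atlas.exists_separation false (G.mem_inc_target_of_notMem_keep_target hm)
      (G.mem_inc_target_of_notMem_keep_target hn) hne

/-- Three compact images cover: the closure of `u` through `inc`, the complement of `u` pulled back
to `S''` and sent through `keep`, and the right piece through `keep`. -/
theorem compactSpace : @CompactSpace _ G.atlas.topology := by
  let _ := G.atlas.topology
  obtain ⟨u, hu, hKu, hui⟩ := G.exists_collar
  have c1 : IsCompact (G.inc '' closure u) :=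
    G.atlas.isCompact_image_emb false isClosed_closure.isCompact hui
  have hut : uᶜ ⊆ G.o.target := Set.compl_subset_comm.1 hKu
  have c2 : IsCompact (G.i '' (G.o.symm '' uᶜ)) :=
    (hu.isClosed_compl.isCompact.image_of_continuousOn
      (G.diffeo.contMDiffOn_symm.continuousOn.mono hut)).image G.gluing.continuous
  have c3 : IsCompact (G.keep '' (G.i '' (G.o.symm '' uᶜ))) := by
    refine G.atlas.isCompact_image_emb true c2 ?_
    rintro _ ⟨_, ⟨t, ht, rfl⟩, rfl⟩
    exact G.left_mem_keep_source.2 (G.o.map_target (hut ht))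
  have c4 : IsCompact (G.keep '' (Set.range G.i')) := by
    refine G.atlas.isCompact_image_emb true (isCompact_range G.gluing.symm.continuous) ?_
    rintro _ ⟨q, rfl⟩
    exact G.right_mem_keep_source q
  refine ⟨((c1.union c3).union c4).of_isClosed_subset isClosed_univ ?_⟩
  rintro (t | ⟨x, hx⟩) -
  · by_cases ht : t ∈ u
    · exact Or.inl (Or.inl ⟨t, subset_closure ht, rfl⟩)
    · refine Or.inl (Or.inr ⟨_, ⟨_, ⟨t, ht, rfl⟩, rfl⟩, ?_⟩)
      rw [keep_left, G.o.right_inv (hut ht)]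
  · refine Or.inr ⟨x, ?_, G.keep_of_notMem hx⟩
    rcases G.gluing.exists_preimage x with ⟨p, rfl⟩ | ⟨q, rfl⟩
    · exact absurd (G.gluing.mem_target p) hx
    · exact ⟨q, rfl⟩

/-- The new surface. -/
noncomputable def result : OrientedSurface.{u} := G.atlas.surface G.t2Space G.compactSpace

/-- The unchanged part of the glued surface. -/
noncomputable def keep' : PartialEquiv S'' G.result := G.keep

theorem isOrientedDiffeo_keep' : IsOrientedDiffeo G.keep' :=
  G.atlas.isOrientedDiffeo_toSurface G.t2Space G.compactSpace true

theorem isOpen_keep'_target : IsOpen G.keep'.target :=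
  G.atlas.isOpen_target true

/-- The interior of the new piece. -/
noncomputable def inc' : PartialEquiv T G.result := G.inc

theorem isOrientedDiffeo_inc' : IsOrientedDiffeo G.inc' :=
  G.atlas.isOrientedDiffeo_toSurface G.t2Space G.compactSpace false

theorem isOpen_inc'_target : IsOpen G.inc'.target :=
  G.atlas.isOpen_target false

/-- The embedding of the new piece. -/
noncomputable def j : PartialEquiv T G.result where
  toFun := G.inc
  invFun := G.inc.symm
  source := Set.univ
  target := Set.range G.inc
  map_source' t _ := ⟨t, rfl⟩
  map_target' _ _ := trivial
  left_inv' t _ := rfl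
  right_inv' := by rintro _ ⟨t, rfl⟩; rfl

theorem keep'_left (p : S) : G.keep' (G.i p) = G.j (G.o p) := G.keep_left p

theorem j_injective : Function.Injective G.j := Sum.inl_injective

/-- At interior points the local model is `inc'`. At boundary points it is `keep'` after `i` after
the inverse of `o`, so smoothness up to the seam is inherited from `i`. -/
theorem isOrientedDiffeo_j : IsOrientedDiffeo G.j := by
  refine IsOrientedDiffeo.of_locally fun t _ => ?_
  by_cases ht : t ∈ T.inner
  · refine ⟨G.inc', G.inc'.target, G.isOrientedDiffeo_inc', T.isOpen_inner, ht, fun _ _ => rfl,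
      G.isOpen_inc'_target, ⟨t, ht, rfl⟩, fun q hq => ⟨hq.2, rfl⟩⟩
  · have ht' : t ∈ G.o.target := G.bdry_subset_target (OrientedSurface.notMem_inner.1 ht)
    have hsi := G.gluing.isOpen_source
    have h1 := (G.diffeo.symm G.isOpen_source G.isOpen_target).trans G.gluing.left
      G.isOpen_target hsi
    have e1 : (G.o.symm.trans G.i).source = G.o.target :=
      PartialEquiv.trans_source_of_subset (by rw [G.gluing.source_left]; exact Set.subset_univ _)
    have e1' : (G.o.symm.trans G.i).target = G.i '' G.o.source :=
      PartialEquiv.trans_target_of_subset (by rw [G.gluing.source_left]; exact Set.subset_univ _)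
    have e2 : (G.o.symm.trans G.i).target ⊆ G.keep'.source := by
      rw [e1']
      rintro _ ⟨p, hp, rfl⟩
      exact G.left_mem_keep_source.2 hp
    have e3 := PartialEquiv.trans_source_of_subset e2
    have e4 := PartialEquiv.trans_target_of_subset e2
    rw [e1] at e3
    rw [e1'] at e4
    have h2 := h1.trans G.isOrientedDiffeo_keep' (by rw [e1]; exact G.isOpen_target)
      G.isOpen_keep_source
    refine ⟨_, G.keep'.target, h2, by rw [e3]; exact G.isOpen_target, by rwa [e3], ?_,
      G.isOpen_keep'_target, ht', ?_⟩
    · rw [e3]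
      intro s hs
      change G.j s = G.keep' (G.i (G.o.symm s))
      rw [keep'_left, G.o.right_inv hs]
    · rintro _ ⟨⟨s, rfl⟩, hs⟩
      have hs' : s ∈ G.o.target := hs
      have h5 : G.keep' (G.i (G.o.symm s)) = G.inc s := by
        rw [keep'_left, G.o.right_inv hs']
        rfl
      refine ⟨?_, ?_⟩
      · rw [e4]
        exact ⟨_, ⟨_, G.o.map_target hs', rfl⟩, h5⟩
      · change s = G.o (G.i.symm (G.keep'.symm (G.inc s)))
        rw [← h5, G.keep'.left_inv (G.left_mem_keep_source.2 (G.o.map_target hs')),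
          G.gluing.symm_apply, G.o.right_inv hs']

/-- The embedding of the other piece. -/
noncomputable def j' : PartialEquiv S' G.result := G.i'.trans G.keep'

theorem j'_apply (q : S') : G.j' q = G.keep' (G.i' q) := rfl

theorem right_target_subset : G.i'.target ⊆ G.keep'.source := by
  intro x hx
  obtain ⟨q, rfl⟩ := G.gluing.symm.mem_target_iff.1 hx
  exact G.right_mem_keep_source q

theorem isOrientedDiffeo_j' : IsOrientedDiffeo G.j' :=
  G.gluing.right.trans G.isOrientedDiffeo_keep' G.gluing.symm.isOpen_source G.isOpen_keep_source

theorem mem_bdry_result_iff {x : S''} (hx : x ∈ G.keep'.source) :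
    G.keep' x ∈ G.result.bdry ↔ x ∈ S''.bdry := by
  have hk : G.atlas.index (G.keep x) = true := by
    simpa [atlas] using! G.keep.map_source hx
  have := G.atlas.mem_bdry_surface_iff G.t2Space G.compactSpace (m := G.keep x) hk
  refine Iff.trans this ?_
  change G.keep.symm (G.keep x) ∈ S''.bdry ↔ _
  rw [G.keep.left_inv hx]

/-- A point outside the image of `keep` is read in a chart from the interior of `T`, so it is
interior. -/
theorem mem_keep'_target_of_mem_bdry {m : G.result} (hm : m ∈ G.result.bdry) :
    m ∈ G.keep'.target := by
  by_contra h
  have hk : G.atlas.index m = false := by simpa [atlas] using! h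
  have h1 := (G.atlas.mem_bdry_surface_iff G.t2Space G.compactSpace (m := m) hk).1 hm
  have h2 := G.atlas.mem_target m
  rw [hk] at h2
  have h3 : G.inc.symm m ∈ T.inner := G.inc.map_target h2
  exact OrientedSurface.notMem_bdry.2 h3 h1

theorem gluing_result : SurfaceGluing (G.b.symm.trans G.φ) G.j G.j' where
  source_subset := by
    intro t ht
    rw [PartialEquiv.trans_source, PartialEquiv.symm_source, G.b_target] at ht
    exact ht.1
  target_subset := by
    intro q hq
    rw [PartialEquiv.trans_target] at hq
    exact G.gluing.target_subset hq.1
  source_left := rfl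
  source_right := (PartialEquiv.trans_source_of_subset G.right_target_subset).trans
    G.gluing.source_right
  left := G.isOrientedDiffeo_j
  right := G.isOrientedDiffeo_j'
  cover := by
    rw [Set.eq_univ_iff_forall]
    rintro (t | ⟨x, hx⟩)
    · exact Or.inl ⟨t, rfl⟩
    · refine Or.inr ?_
      rw [j', PartialEquiv.trans_target_of_subset G.right_target_subset]
      refine ⟨x, ?_, G.keep_of_notMem hx⟩
      have := G.gluing.cover.ge (Set.mem_univ x)
      exact this.resolve_left hx
  meet t q := by
    rw [PartialEquiv.trans_source, PartialEquiv.symm_source, G.b_target, PartialEquiv.coe_trans]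
    constructor
    · intro h
      rw [j'_apply] at h
      -- If `i' q` lies in the left piece, it is on the old seam and the old gluing relation
      -- applies. Otherwise its image lies in the second summand, which `j` never meets.
      by_cases hq : G.i' q ∈ G.i.target
      · obtain ⟨p, hp⟩ := G.gluing.mem_target_iff.1 hq
        rw [← hp, keep'_left] at h
        obtain rfl := G.j_injective h
        obtain ⟨hp1, rfl⟩ := (G.gluing.meet p q).1 hp
        have hp2 := G.gluing.source_subset hp1
        have h3 : G.b.symm (G.o p) = p := by
          rw [← G.b_eqOn hp2, G.b.left_inv (G.b_source ▸ hp2)]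
        refine ⟨⟨(G.mem_bdry_iff (G.bdry_subset hp2)).2 hp2, ?_⟩, ?_⟩
        · rw [Set.mem_preimage, h3]; exact hp1
        · rw [Function.comp_apply, h3]
      · have h2 : G.keep' (G.i' q) = Sum.inr ⟨_, hq⟩ := G.keep_of_notMem hq
        rw [h2] at h
        cases h
    · rintro ⟨⟨ht, h1⟩, rfl⟩
      obtain ⟨p, hp, rfl, h2⟩ := G.exists_of_mem_bdry ht
      rw [Set.mem_preimage, h2] at h1
      rw [Function.comp_apply, h2, j'_apply, ← (G.gluing.meet p _).2 ⟨h1, rfl⟩, keep'_left]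
  bdry := by
    ext m
    constructor
    · intro hm
      have h1 := G.mem_keep'_target_of_mem_bdry hm
      have h2 : G.keep'.symm m ∈ S''.bdry := by
        rw [← G.mem_bdry_result_iff (G.keep'.map_target h1), G.keep'.right_inv h1]
        exact hm
      rw [G.gluing.bdry] at h2
      rcases h2 with ⟨p, ⟨hp, hpφ⟩, h3⟩ | ⟨q, ⟨hq, hqφ⟩, h3⟩
      · refine Or.inl ⟨G.o p, ⟨(G.mem_bdry_iff (G.bdry_subset hp)).2 hp, ?_⟩, ?_⟩
        · rw [PartialEquiv.trans_source]
          rintro ⟨-, h4⟩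
          rw [Set.mem_preimage, ← G.b_eqOn hp, G.b.left_inv (G.b_source ▸ hp)] at h4
          exact hpφ h4
        · rw [← keep'_left, h3, G.keep'.right_inv h1]
      · refine Or.inr ⟨q, ⟨hq, ?_⟩, ?_⟩
        · rw [PartialEquiv.trans_target]
          exact fun h => hqφ h.1
        · rw [j'_apply, h3, G.keep'.right_inv h1]
    · rintro (⟨t, ⟨ht, h1⟩, rfl⟩ | ⟨q, ⟨hq, h1⟩, rfl⟩)
      · obtain ⟨p, hp, rfl, h2⟩ := G.exists_of_mem_bdry ht
        rw [← keep'_left, G.mem_bdry_result_iff (G.left_mem_keep_source.2 (G.bdry_subset hp)),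
          G.gluing.mem_bdry_left_iff]
        refine ⟨hp, fun h3 => h1 ?_⟩
        rw [PartialEquiv.trans_source, PartialEquiv.symm_source, G.b_target]
        exact ⟨ht, by rwa [Set.mem_preimage, h2]⟩
      · rw [j'_apply, G.mem_bdry_result_iff (G.right_mem_keep_source q),
          G.gluing.symm.mem_bdry_left_iff]
        refine ⟨hq, fun h3 => h1 ?_⟩
        rw [PartialEquiv.trans_target, PartialEquiv.symm_target, G.b_source]
        exact ⟨h3, G.gluing.source_subset (G.φ.map_target h3)⟩

end Surgery

/-! ### Unions of curves and their clopen circles -/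

theorem IsPreconnected.subset_left_of_isClosed {X : Type*} [TopologicalSpace X] {s u v : Set X}
    (hs : IsPreconnected s) (hu : IsClosed u) (hv : IsClosed v) (huv : Disjoint u v)
    (h : s ⊆ u ∪ v) (hne : (s ∩ u).Nonempty) : s ⊆ u := by
  refine (isPreconnected_iff_subset_of_disjoint_closed.1 hs u v hu hv h ?_).resolve_right ?_
  · rw [huv.inter_eq, Set.inter_empty]
  · obtain ⟨x, hxs, hxu⟩ := hne
    exact fun hsv => Set.disjoint_left.1 huv hxu (hsv hxs)

namespace PartialHeegaardDiagram

variable {S : OrientedSurface.{u}} (D : PartialHeegaardDiagram S)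

theorem subset_curves {c : Color} {A : Set S} (hA : A ∈ D.circles c ∪ D.arcs c) :
    A ⊆ D.curves c := Set.subset_sUnion_of_mem hA

theorem isCompact_curve {c : Color} {A : Set S} (hA : A ∈ D.circles c ∪ D.arcs c) :
    IsCompact A :=
  hA.elim (fun h => (D.isSmoothCircle c A h).isCompact) fun h => (D.isSmoothArc c A h).isCompact

theorem finite_curves (c : Color) : (D.circles c ∪ D.arcs c).Finite :=
  (D.circles_finite c).union (D.arcs_finite c)

theorem isCompact_curves (c : Color) : IsCompact (D.curves c) :=
  (D.finite_curves c).isCompact_sUnion fun _ hA => D.isCompact_curve hA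

/-- Circles avoid the boundary, so the endpoint condition of a gluing depends only on the union of
the curves. -/
theorem endpoints_eq (c : Color) : D.endpoints c = D.curves c ∩ S.bdry := by
  ext p
  constructor
  · rintro ⟨⟨A, hA, hp⟩, hb⟩
    exact ⟨⟨A, Or.inr hA, hp⟩, hb⟩
  · rintro ⟨⟨A, hA | hA, hp⟩, hb⟩
    · exact absurd hb (OrientedSurface.notMem_bdry.2 ((D.isSmoothCircle c A hA).subset_inner hp))
    · exact ⟨⟨A, hA, hp⟩, hb⟩

theorem transverse_curves {p : S} (hα : p ∈ D.curves .alpha) (hβ : p ∈ D.curves .beta) :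
    p ∈ S.inner ∧ TransverseAt (D.curves .alpha) (D.curves .beta) p := by
  obtain ⟨A, hA, hpA⟩ := hα
  obtain ⟨B, hB, hpB⟩ := hβ
  obtain ⟨h1, h2⟩ := D.transverse A hA B hB p ⟨hpA, hpB⟩
  exact ⟨h1, h2.mono (D.subset_curves hA) (D.subset_curves hB)⟩

/-- A circle contained in the curves of a family and disjoint from a closed set that contains the
rest of the family is one of the circles of the family. -/
theorem mem_circles_of_isClopen {c : Color} {A R : Set S} (hA : IsPreconnected A)
    (hAc : IsClosed A) (hne : A.Nonempty) (hi : A ⊆ S.inner) (hR : IsClosed R)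
    (hAR : Disjoint A R) (h : D.curves c = A ∪ R) : A ∈ D.circles c := by
  obtain ⟨p, hp⟩ := hne
  have hpc : p ∈ D.curves c := h ▸ Or.inl hp
  -- `C` is the curve of the family through a point of `A`. Both are connected and clopen in the
  -- union, hence equal; `C` is not an arc, since arcs reach the boundary.
  obtain ⟨C, hC, hpC⟩ := hpc
  have hCA : C ⊆ A := by
    have hCpre : IsPreconnected C :=
      hC.elim (fun h => (D.isSmoothCircle c C h).isPreconnected)
        fun h => (D.isSmoothArc c C h).isPreconnected
    exact hCpre.subset_left_of_isClosed hAc hR hAR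
      (h ▸ D.subset_curves hC) ⟨p, hpC, hp⟩
  have hAC : A ⊆ C := by
    have hcl : IsClosed (⋃₀ ((D.circles c ∪ D.arcs c) \ {C})) :=
      (((D.finite_curves c).subset Set.sdiff_subset).isCompact_sUnion
        fun B hB => D.isCompact_curve hB.1).isClosed
    refine hA.subset_left_of_isClosed (D.isCompact_curve hC).isClosed hcl ?_ ?_
      ⟨p, hp, hpC⟩
    · rw [Set.disjoint_sUnion_right]
      rintro B ⟨hB, hBC⟩
      exact D.disjoint c hC hB fun h => hBC h.symm
    · intro x hx
      have : x ∈ D.curves c := h ▸ Or.inl hx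
      obtain ⟨B, hB, hxB⟩ := this
      by_cases hBC : B = C
      · exact Or.inl (hBC ▸ hxB)
      · exact Or.inr ⟨B, ⟨hB, hBC⟩, hxB⟩
  obtain rfl : C = A := Set.Subset.antisymm hCA hAC
  rcases hC with hC | hC
  · exact hC
  · obtain ⟨q, hq, hqb⟩ := (D.isSmoothArc c C hC).inter_bdry_nonempty
    exact absurd hqb (OrientedSurface.notMem_bdry.2 (hi hq))

end PartialHeegaardDiagram

/-! ### Gluing maps: inversion and transport along a surgery -/

namespace IsGluingMap

variable {S S' : OrientedSurface.{u}} {D : PartialHeegaardDiagram S}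
  {D' : PartialHeegaardDiagram S'} {φ : PartialEquiv S S'}

theorem symm (h : IsGluingMap D D' φ) : IsGluingMap D' D φ.symm where
  source_subset := h.target_subset
  target_subset := h.source_subset
  source_components := h.target_components
  target_components := h.source_components
  contMDiffOn := h.contMDiffOn_symm
  contMDiffOn_symm := h.contMDiffOn
  reversing γ hγ hd hv := by
    have h0 : γ 0 ∈ φ.target := hγ.self_of_nhds
    have hnh : γ ⁻¹' φ.target ∈ 𝓝 (0 : ℝ) := hγ
    have hδ : MDifferentiableAt 𝓘(ℝ, ℝ) (𝓡∂ 2) (φ.symm ∘ γ) 0 :=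
      (((h.contMDiffOn_symm _ h0).mdifferentiableWithinAt (by simp)).comp 0
        hd.mdifferentiableWithinAt (Set.Subset.refl _)).mdifferentiableAt hnh
    have hδs : ∀ᶠ t in 𝓝 0, (φ.symm ∘ γ) t ∈ φ.source := hγ.mono fun t ht => φ.map_target ht
    have hδ0 : (φ.symm ∘ γ) 0 ∈ φ.source := hδs.self_of_nhds
    have heq : φ ∘ (φ.symm ∘ γ) =ᶠ[𝓝 0] γ := hγ.mono fun t ht => φ.right_inv ht
    -- If coordinate `1` vanished, the velocity would be zero, being tangent to the boundary, and so
    -- would the velocity of `γ`. If it were positive, `φ` would reverse it and contradict `hv`.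
    rcases lt_trichotomy (velocity (φ.symm ∘ γ) 0 1) 0 with hlt | h1 | hgt
    · exact hlt
    · exfalso
      have hz : velocity (φ.symm ∘ γ) 0 = 0 := by
        have h2 := velocity_zero_of_mem_bdry hδ (h.source_subset hδ0)
        ext k
        fin_cases k
        · exact h2
        · exact h1
      have hw := ((h.contMDiffOn _ hδ0).mdifferentiableWithinAt (by simp)).hasMFDerivWithinAt
      have hc := (hw.comp 0 hδ.hasMFDerivAt.hasMFDerivWithinAt
        (Set.Subset.refl _)).hasMFDerivAt hδs
      have hc' := (hc.congr_of_eventuallyEq heq.symm).mfderiv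
      have : velocity γ 0 = 0 := by
        unfold velocity
        rw [hc']
        have hz' : mfderiv 𝓘(ℝ, ℝ) (𝓡∂ 2) (φ.symm ∘ γ) 0 (1 : ℝ) = 0 := hz
        let F : Plane →L[ℝ] Plane :=
          mfderivWithin (𝓡∂ 2) (𝓡∂ 2) φ φ.source ((φ.symm ∘ γ) 0)
        exact (congrArg F hz').trans (map_zero F)
      rw [this] at hv
      exact lt_irrefl _ hv
    · have := h.reversing _ hδs hδ hgt
      rw [velocity_congr heq] at this
      exact absurd this hv.not_gt
  endpoints c := by
    rw [PartialEquiv.symm_source, PartialEquiv.symm_target, ← h.endpoints c, Set.image_image]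
    ext p
    constructor
    · rintro ⟨q, hq, rfl⟩
      simpa only [φ.left_inv hq.2] using hq
    · intro hp
      exact ⟨p, hp, φ.left_inv hp.2⟩

theorem congr (h : IsGluingMap D D' φ) {E : PartialHeegaardDiagram S}
    (he : ∀ c, E.endpoints c = D.endpoints c) : IsGluingMap E D' φ where
  source_subset := h.source_subset
  target_subset := h.target_subset
  source_components := h.source_components
  target_components := h.target_components
  contMDiffOn := h.contMDiffOn
  contMDiffOn_symm := h.contMDiffOn_symm
  reversing := h.reversing
  endpoints c := by rw [he, h.endpoints]

end IsGluingMap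

/-- On the boundary `b` agrees with `o`, a diffeomorphism of a neighbourhood. Smoothness,
components, boundary orientation and endpoints are therefore transported by `o`. -/
theorem Surgery.isGluingMap {S S' S'' T : OrientedSurface.{u}} (G : Surgery S S' S'' T)
    {D : PartialHeegaardDiagram S} {D' : PartialHeegaardDiagram S'} {E : PartialHeegaardDiagram T}
    (h : IsGluingMap D D' G.φ) (he : ∀ c, E.endpoints c = G.o '' D.endpoints c) :
    IsGluingMap E D' (G.b.symm.trans G.φ) := by
  have hsymm : ∀ t ∈ T.bdry, G.b.symm t = G.o.symm t := by
    intro t ht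
    obtain ⟨p, hp, rfl, h2⟩ := G.exists_of_mem_bdry ht
    rw [h2, G.o.left_inv (G.bdry_subset hp)]
  have hsrc : (G.b.symm.trans G.φ).source = T.bdry ∩ G.o.symm ⁻¹' G.φ.source := by
    rw [PartialEquiv.trans_source, PartialEquiv.symm_source, G.b_target]
    ext t
    exact and_congr_right fun ht => by rw [Set.mem_preimage, Set.mem_preimage, hsymm t ht]
  have htgt : (G.b.symm.trans G.φ).target = G.φ.target := by
    rw [PartialEquiv.trans_target, PartialEquiv.symm_target, G.b_source]
    exact Set.inter_eq_left.2 fun q hq => h.source_subset (G.φ.map_target hq)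
  have hsmooth : ContMDiffOn (𝓡∂ 2) (𝓡∂ 2) ∞ G.o.symm T.bdry :=
    G.diffeo.contMDiffOn_symm.mono G.bdry_subset_target
  refine ⟨?_, ?_, ?_, ?_, ?_, ?_, ?_, ?_⟩
  · rw [hsrc]; exact Set.inter_subset_left
  · rw [htgt]; exact h.target_subset
  · intro p hp t ht
    rw [hsrc] at hp ⊢
    have hsub := connectedComponentIn_subset T.bdry p
    refine ⟨hsub ht, ?_⟩
    have h1 : IsPreconnected (G.o.symm '' connectedComponentIn T.bdry p) :=
      isPreconnected_connectedComponentIn.image _ (hsmooth.continuousOn.mono hsub)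
    have h2 : G.o.symm '' connectedComponentIn T.bdry p ⊆ S.bdry := by
      rintro _ ⟨s, hs, rfl⟩
      exact (G.symm_mem_bdry_iff (G.bdry_subset_target (hsub hs))).2 (hsub hs)
    exact h.source_components _ hp.2 (h1.subset_connectedComponentIn
      ⟨p, mem_connectedComponentIn hp.1, rfl⟩ h2 ⟨t, ht, rfl⟩)
  · intro p hp
    rw [htgt] at hp ⊢
    exact h.target_components p hp
  · rw [hsrc]
    refine (h.contMDiffOn.comp' hsmooth).congr fun t ht => ?_
    rw [PartialEquiv.coe_trans, Function.comp_apply, hsymm t ht.1]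
    rfl
  · rw [htgt]
    have h1 : ContMDiffOn (𝓡∂ 2) (𝓡∂ 2) ∞ (G.o ∘ G.φ.symm) G.φ.target :=
      G.diffeo.contMDiffOn.comp h.contMDiffOn_symm
        fun q hq => G.bdry_subset (h.source_subset (G.φ.map_target hq))
    refine h1.congr fun q hq => ?_
    exact G.b_eqOn (h.source_subset (G.φ.map_target hq))
  · intro γ hγ hd hv
    rw [hsrc] at hγ
    have h0 : γ 0 ∈ T.bdry := hγ.self_of_nhds.1
    have hs := G.diffeo.symm G.isOpen_source G.isOpen_target
    have h0t := G.bdry_subset_target h0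
    have hsd : MDifferentiableAt (𝓡∂ 2) (𝓡∂ 2) G.o.symm (γ 0) :=
      hs.mdifferentiableAt G.isOpen_target h0t
    obtain ⟨a, d, -, hdpos, had⟩ := coordDeriv_bdry hsd (hs.jacobian_pos _ h0t) h0
      ((G.symm_mem_bdry_iff h0t).2 h0)
    have hvel := velocity_comp hsd hd
    -- The inverse of `o` multiplies velocities along the boundary by a positive factor, so the
    -- reversal property of `φ` applies to the transported curve.
    have hv' : 0 < velocity (G.o.symm ∘ γ) 0 1 := by
      rw [hvel, (had _).2 (velocity_zero_of_mem_bdry hd h0)]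
      exact mul_pos hdpos hv
    have := h.reversing (G.o.symm ∘ γ) (hγ.mono fun t ht => ht.2)
      (hsd.comp (0 : ℝ) hd) hv'
    rw [velocity_congr (δ := G.φ ∘ (G.o.symm ∘ γ))]
    · exact this
    · filter_upwards [hγ] with t ht
      rw [Function.comp_apply, PartialEquiv.coe_trans, Function.comp_apply, hsymm _ ht.1]
      rfl
  · intro c
    rw [htgt, hsrc, he, ← h.endpoints c]
    ext q
    constructor
    · rintro ⟨_, ⟨⟨p, hp, rfl⟩, hb, hs⟩, rfl⟩
      have hps := G.bdry_subset hp.2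
      rw [Set.mem_preimage, G.o.left_inv hps] at hs
      refine ⟨p, ⟨hp, hs⟩, ?_⟩
      rw [PartialEquiv.coe_trans, Function.comp_apply, hsymm _ hb, G.o.left_inv hps]
    · rintro ⟨p, ⟨hp, hs⟩, rfl⟩
      have hps := G.bdry_subset hp.2
      have hb := (G.mem_bdry_iff hps).2 hp.2
      refine ⟨G.o p, ⟨⟨p, hp, rfl⟩, hb, ?_⟩, ?_⟩
      · rw [Set.mem_preimage, G.o.left_inv hps]
        exact hs
      · rw [PartialEquiv.coe_trans, Function.comp_apply, hsymm _ hb, G.o.left_inv hps]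

/-! ### Diagrams on glued surfaces -/

section Gluing

variable {S S' S'' : OrientedSurface.{u}} {D : PartialHeegaardDiagram S}
  {D' : PartialHeegaardDiagram S'} {D'' : PartialHeegaardDiagram S''} {φ : PartialEquiv S S'}
  {i : PartialEquiv S S''} {i' : PartialEquiv S' S''}

theorem IsGluing.surfaceGluing (h : IsGluing D D' φ D'' i i') : SurfaceGluing φ i i' :=
  ⟨h.isGluingMap.source_subset, h.isGluingMap.target_subset, h.source_left, h.source_right, h.left,
    h.right, h.cover, h.meet, h.bdry⟩

theorem SurfaceGluing.isGluing (G : SurfaceGluing φ i i') (hm : IsGluingMap D D' φ)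
    (hc : ∀ c, D''.curves c = i '' D.curves c ∪ i' '' D'.curves c)
    (hb : ∀ l, D''.basepoints l = i '' D.basepoints l ∪ i' '' D'.basepoints l) :
    IsGluing D D' φ D'' i i' :=
  ⟨hm, G.source_left, G.source_right, G.left, G.right, G.cover, G.meet, G.bdry, hc, hb⟩

theorem IsGluing.symm (h : IsGluing D D' φ D'' i i') : IsGluing D' D φ.symm D'' i' i :=
  h.surfaceGluing.symm.isGluing h.isGluingMap.symm
    (fun c => by rw [Set.union_comm]; exact h.curves c)
    (fun l => by rw [Set.union_comm]; exact h.basepoints l)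

/-- A right curve can pass through `i p` only on the seam. There it has an endpoint, and the
bijection of endpoints provides a left curve ending at `p`. -/
theorem mem_curves_of_left (G : SurfaceGluing φ i i') (hm : IsGluingMap D D' φ) {c : Color} {p : S}
    (h : i p ∈ i '' D.curves c ∪ i' '' D'.curves c) : p ∈ D.curves c := by
  rcases h with ⟨q, hq, h⟩ | ⟨q, hq, h⟩
  · rwa [← G.injective h]
  · obtain ⟨hp, rfl⟩ := (G.meet p q).1 h.symm
    have h1 : φ p ∈ D'.endpoints c ∩ φ.target := by
      rw [D'.endpoints_eq]
      exact ⟨⟨hq, G.target_subset (φ.map_source hp)⟩, φ.map_source hp⟩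
    rw [← hm.endpoints c] at h1
    obtain ⟨r, ⟨hr, hrs⟩, hrp⟩ := h1
    rw [← φ.injOn hrs hp hrp]
    rw [D.endpoints_eq] at hr
    exact hr.1

/-- Families of curves on a glued surface with the right unions define a diagram obtained by
gluing. -/
theorem exists_gluedDiagram (G : SurfaceGluing φ i i') (hm : IsGluingMap D D' φ)
    (circles arcs : Color → Set (Set S'')) (hcf : ∀ c, (circles c).Finite)
    (haf : ∀ c, (arcs c).Finite) (hcs : ∀ c, ∀ A ∈ circles c, IsSmoothCircle A)
    (has : ∀ c, ∀ A ∈ arcs c, IsSmoothArc A)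
    (hd : ∀ c, (circles c ∪ arcs c).PairwiseDisjoint id)
    (hu : ∀ c, ⋃₀ (circles c ∪ arcs c) = i '' D.curves c ∪ i' '' D'.curves c) :
    ∃ E : PartialHeegaardDiagram S'', E.circles = circles ∧ E.arcs = arcs ∧
      (∀ l, E.basepoints l = i '' D.basepoints l ∪ i' '' D'.basepoints l) ∧
      IsGluing D D' φ E i i' := by
  have hbi : ∀ l, i '' D.basepoints l ∪ i' '' D'.basepoints l ⊆ S''.inner := by
    rintro l _ (⟨p, hp, rfl⟩ | ⟨p, hp, rfl⟩)
    · exact G.mem_inner (D.basepoints_inner l hp)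
    · exact G.symm.mem_inner (D'.basepoints_inner l hp)
  have hboff : ∀ l c, Disjoint (i '' D.basepoints l ∪ i' '' D'.basepoints l)
      (i '' D.curves c ∪ i' '' D'.curves c) := by
    intro l c
    rw [Set.disjoint_left]
    rintro _ (⟨p, hp, rfl⟩ | ⟨p, hp, rfl⟩) h
    · obtain ⟨A, hA, hpA⟩ := mem_curves_of_left G hm h
      exact Set.disjoint_left.1 (D.basepoints_off l c A hA) hp hpA
    · rw [Set.union_comm] at h
      obtain ⟨A, hA, hpA⟩ := mem_curves_of_left G.symm hm.symm h
      exact Set.disjoint_left.1 (D'.basepoints_off l c A hA) hp hpA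
  have hbd : Disjoint (i '' D.basepoints .X ∪ i' '' D'.basepoints .X)
      (i '' D.basepoints .O ∪ i' '' D'.basepoints .O) := by
    rw [Set.disjoint_left]
    rintro _ (⟨p, hp, rfl⟩ | ⟨p, hp, rfl⟩) (⟨q, hq, h⟩ | ⟨q, hq, h⟩)
    · rw [G.injective h] at hq
      exact Set.disjoint_left.1 D.basepoints_disjoint hp hq
    · exact G.ne_of_mem_inner (D.basepoints_inner _ hp) q h.symm
    · exact G.ne_of_mem_inner (D.basepoints_inner _ hq) p h
    · rw [G.symm.injective h] at hq
      exact Set.disjoint_left.1 D'.basepoints_disjoint hp hq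
  -- Transversality is first shown for the unions: a crossing comes from a crossing in the interior
  -- of one of the pieces.
  have htr : ∀ p ∈ i '' D.curves .alpha ∪ i' '' D'.curves .alpha,
      p ∈ i '' D.curves .beta ∪ i' '' D'.curves .beta → p ∈ S''.inner ∧
      TransverseAt (i '' D.curves .alpha ∪ i' '' D'.curves .alpha)
        (i '' D.curves .beta ∪ i' '' D'.curves .beta) p := by
    intro p hα hβ
    rcases G.exists_preimage p with ⟨q, rfl⟩ | ⟨q, rfl⟩
    · obtain ⟨h1, h2⟩ := D.transverse_curves (mem_curves_of_left G hm hα)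
        (mem_curves_of_left G hm hβ)
      exact ⟨G.mem_inner h1, (h2.image G.left G.isOpen_source (G.mem_source q)).mono
        Set.subset_union_left Set.subset_union_left⟩
    · rw [Set.union_comm] at hα hβ
      obtain ⟨h1, h2⟩ := D'.transverse_curves (mem_curves_of_left G.symm hm.symm hα)
        (mem_curves_of_left G.symm hm.symm hβ)
      exact ⟨G.symm.mem_inner h1, (h2.image G.right G.symm.isOpen_source
        (G.symm.mem_source q)).mono Set.subset_union_right Set.subset_union_right⟩
  -- The other curves of the family form a closed set `R`, so near a point of `A` the union looks
  -- like `A`; this localizes `htr` to individual curves.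
  have hrest : ∀ c, ∀ A ∈ circles c ∪ arcs c, ∃ R, IsClosed R ∧ Disjoint A R ∧
      i '' D.curves c ∪ i' '' D'.curves c = A ∪ R := by
    intro c A hA
    refine ⟨⋃₀ ((circles c ∪ arcs c) \ {A}), ?_, ?_, ?_⟩
    · refine ((((hcf c).union (haf c)).subset Set.sdiff_subset).isCompact_sUnion ?_).isClosed
      rintro B ⟨hB | hB, -⟩
      · exact (hcs c B hB).isCompact
      · exact (has c B hB).isCompact
    · rw [Set.disjoint_sUnion_right]
      rintro B ⟨hB, hBA⟩
      exact hd c hA hB fun h => hBA h.symm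
    · rw [← hu, ← Set.sUnion_insert, Set.insert_sdiff_singleton, Set.insert_eq_of_mem hA]
  let E : PartialHeegaardDiagram S'' :=
    { circles := circles
      arcs := arcs
      basepoints := fun l => i '' D.basepoints l ∪ i' '' D'.basepoints l
      circles_finite := hcf
      arcs_finite := haf
      basepoints_finite := fun l =>
        ((D.basepoints_finite l).image _).union ((D'.basepoints_finite l).image _)
      isSmoothCircle := hcs
      isSmoothArc := has
      disjoint := hd
      transverse := by
        rintro A hA B hB p ⟨hpA, hpB⟩
        obtain ⟨R, hR, hAR, hRu⟩ := hrest _ A hA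
        obtain ⟨Q, hQ, hBQ, hQu⟩ := hrest _ B hB
        obtain ⟨h1, h2⟩ := htr p (hRu ▸ Or.inl hpA) (hQu ▸ Or.inl hpB)
        rw [hRu, hQu] at h2
        exact ⟨h1, h2.of_union hR hQ (Set.disjoint_left.1 hAR hpA) (Set.disjoint_left.1 hBQ hpB)⟩
      basepoints_disjoint := hbd
      basepoints_inner := hbi
      basepoints_off := fun l c A hA => (hboff l c).mono_right
        (by rw [← hu]; exact Set.subset_sUnion_of_mem hA) }
  exact ⟨E, rfl, rfl, fun _ => rfl, G.isGluing hm hu fun _ => rfl⟩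

/-- The image is connected, misses the seam, and the rest of the glued curves is closed, so it is
clopen in the union. -/
theorem IsGluing.image_mem_circles (h : IsGluing D D' φ D'' i i') {c : Color} {A : Set S}
    (hA : A ∈ D.circles c) : i '' A ∈ D''.circles c := by
  have G := h.surfaceGluing
  have hs := D.isSmoothCircle c A hA
  have hs' : IsSmoothCircle (i '' A) :=
    hs.image G.left G.isOpen_source fun p _ => G.mem_source p
  have hcl : IsCompact (⋃₀ ((D.circles c ∪ D.arcs c) \ {A})) :=
    (((D.finite_curves c).subset Set.sdiff_subset).isCompact_sUnion
      fun B hB => D.isCompact_curve hB.1)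
  have hcu : D.curves c = A ∪ ⋃₀ ((D.circles c ∪ D.arcs c) \ {A}) := by
    rw [PartialHeegaardDiagram.curves, ← Set.sUnion_insert, Set.insert_sdiff_singleton,
      Set.insert_eq_of_mem (show A ∈ D.circles c ∪ D.arcs c from Or.inl hA)]
  refine D''.mem_circles_of_isClopen hs'.isPreconnected hs'.isCompact.isClosed hs'.nonempty
    hs'.subset_inner (R := i '' ⋃₀ ((D.circles c ∪ D.arcs c) \ {A}) ∪ i' '' D'.curves c)
    ((hcl.image G.continuous).union
      ((D'.isCompact_curves c).image G.symm.continuous)).isClosed ?_ ?_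
  · rw [Set.disjoint_left]
    rintro _ ⟨p, hp, rfl⟩ (⟨q, ⟨B, ⟨hB, hBA⟩, hqB⟩, hq⟩ | ⟨q, hq, hqp⟩)
    · rw [G.injective hq] at hqB
      exact Set.disjoint_left.1 (D.disjoint c (Or.inl hA) hB fun h => hBA h.symm) hp hqB
    · exact G.ne_of_mem_inner (hs.subset_inner hp) q hqp.symm
  · rw [h.curves, ← Set.union_assoc, ← Set.image_union, ← hcu]

end Gluing

theorem Color.forall_of_other {P : Color → Prop} (c : Color) (h : P c) (h' : P c.other) :
    ∀ c', P c' := by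
  cases c <;> rintro (_ | _) <;> assumption

theorem Color.exists_fun {X : Type*} (c : Color) (a b : X) :
    ∃ N : Color → X, N c = a ∧ N c.other = b := by
  cases c
  · exact ⟨fun | .alpha => a | .beta => b, rfl, rfl⟩
  · exact ⟨fun | .alpha => b | .beta => a, rfl, rfl⟩

theorem Set.PairwiseDisjoint.image_image {X Y : Type*} {f : X → Y} {s : Set X} {𝒜 : Set (Set X)}
    (h : 𝒜.PairwiseDisjoint id) (hf : Set.InjOn f s) (hs : ∀ A ∈ 𝒜, A ⊆ s) :
    ((fun A => f '' A) '' 𝒜).PairwiseDisjoint id := by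
  rintro _ ⟨A, hA, rfl⟩ _ ⟨B, hB, rfl⟩ hne
  have hAB : A ≠ B := fun h => hne (by rw [h])
  change Disjoint (f '' A) (f '' B)
  rw [Set.disjoint_left]
  rintro _ ⟨x, hx, rfl⟩ ⟨y, hy, hxy⟩
  rw [hf (hs B hB hy) (hs A hA hx) hxy] at hy
  exact Set.disjoint_left.1 (h hA hB hAB) hx hy

theorem Set.PairwiseDisjoint.insert_of_disjoint {X : Type*} {N : Set X} {𝒜 : Set (Set X)}
    (h : 𝒜.PairwiseDisjoint id) (hN : Disjoint N (⋃₀ 𝒜)) :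
    (insert N 𝒜).PairwiseDisjoint id :=
  Set.pairwiseDisjoint_insert.2
    ⟨h, fun _ hB _ => Disjoint.mono_right (Set.subset_sUnion_of_mem hB) hN⟩

theorem PartialHeegaardDiagram.sUnion_diff_circle {S : OrientedSurface.{u}}
    (D : PartialHeegaardDiagram S) {c : Color} {A : Set S} (hA : A ∈ D.circles c) :
    ⋃₀ (D.circles c \ {A} ∪ D.arcs c) = D.curves c \ A := by
  have hd : ∀ B ∈ D.circles c ∪ D.arcs c, B ≠ A → Disjoint B A := fun B hB hne =>
    D.disjoint c hB (Or.inl hA) hne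
  ext x
  constructor
  · rintro ⟨B, hB | hB, hx⟩
    · exact ⟨⟨B, Or.inl hB.1, hx⟩, Set.disjoint_left.1 (hd B (Or.inl hB.1) hB.2) hx⟩
    · refine ⟨⟨B, Or.inr hB, hx⟩, Set.disjoint_left.1 (hd B (Or.inr hB) ?_) hx⟩
      rintro rfl
      obtain ⟨q, hq, hqb⟩ := (D.isSmoothArc c B hB).inter_bdry_nonempty
      exact OrientedSurface.notMem_bdry.2 ((D.isSmoothCircle c B hA).subset_inner hq) hqb
  · rintro ⟨⟨B, hB | hB, hx⟩, hxA⟩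
    · exact ⟨B, Or.inl ⟨hB, fun h => hxA (h ▸ hx)⟩, hx⟩
    · exact ⟨B, Or.inr hB, hx⟩

theorem PartialEquiv.ofSet_symm_trans {X Y : Type*} {s : Set X} {φ : PartialEquiv X Y}
    (h : φ.source ⊆ s) : (PartialEquiv.ofSet s).symm.trans φ = φ := by
  refine PartialEquiv.ext (fun _ => rfl) (fun _ => rfl) ?_
  rw [PartialEquiv.trans_source]
  exact Set.inter_eq_right.2 h

section Gluing

variable {S S' S'' : OrientedSurface.{u}} {D : PartialHeegaardDiagram S}
  {D' : PartialHeegaardDiagram S'} {D'' : PartialHeegaardDiagram S''} {φ : PartialEquiv S S'}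
  {i : PartialEquiv S S''} {i' : PartialEquiv S' S''}

theorem IsGluing.mem_curves_iff (h : IsGluing D D' φ D'' i i') {c : Color} {p : S} :
    i p ∈ D''.curves c ↔ p ∈ D.curves c := by
  rw [h.curves]
  exact ⟨mem_curves_of_left h.surfaceGluing h.isGluingMap, fun hp => Or.inl ⟨p, hp, rfl⟩⟩

theorem IsGluing.mem_basepoints_iff (h : IsGluing D D' φ D'' i i') {l : Label} {p : S}
    (hp : p ∈ S.inner) : i p ∈ D''.basepoints l ↔ p ∈ D.basepoints l := by
  rw [h.basepoints]
  refine ⟨?_, fun hp => Or.inl ⟨p, hp, rfl⟩⟩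
  rintro (⟨q, hq, h'⟩ | ⟨q, hq, h'⟩)
  · rwa [← h.surfaceGluing.injective h']
  · exact absurd h'.symm (h.surfaceGluing.ne_of_mem_inner hp q)

theorem IsGluing.curves_diff (h : IsGluing D D' φ D'' i i') {c : Color} {A : Set S}
    (hA : A ⊆ S.inner) :
    D''.curves c \ (i '' A) = i '' (D.curves c \ A) ∪ i' '' D'.curves c := by
  have hd : Disjoint (i' '' D'.curves c) (i '' A) := by
    rw [Set.disjoint_right]
    rintro _ ⟨p, hp, rfl⟩ ⟨q, -, hq⟩
    exact h.surfaceGluing.ne_of_mem_inner (hA hp) q hq.symm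
  rw [h.curves, Set.union_sdiff_distrib, hd.sdiff_eq_left, Set.image_sdiff h.surfaceGluing.injective]

end Gluing

/-! ### Extension of compactly supported isotopies by the identity -/

namespace AmbientIsotopy

variable {S S' S'' : OrientedSurface.{u}}

/-- The diffeomorphism at time `t`. -/
def at' (Φ : AmbientIsotopy S) (t : ℝ) : PartialEquiv S S where
  toFun := Φ.toFun t
  invFun := Φ.invFun t
  source := Set.univ
  target := Set.univ
  map_source' _ _ := trivial
  map_target' _ _ := trivial
  left_inv' x _ := Φ.left_inv t x
  right_inv' x _ := Φ.right_inv t x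

theorem isOrientedDiffeo_at (Φ : AmbientIsotopy S) (t : ℝ) : IsOrientedDiffeo (Φ.at' t) where
  contMDiffOn := (Φ.smooth_toFun.comp (contMDiff_const.prodMk contMDiff_id)).contMDiffOn
  contMDiffOn_symm := (Φ.smooth_invFun.comp (contMDiff_const.prodMk contMDiff_id)).contMDiffOn
  jacobian_pos p _ := Φ.jacobian_pos t p

theorem injective (Φ : AmbientIsotopy S) (t : ℝ) : Function.Injective (Φ.toFun t) :=
  Function.LeftInverse.injective (Φ.left_inv t)

theorem invFun_eq_of_fixed (Φ : AmbientIsotopy S) {t : ℝ} {x : S} (h : Φ.toFun t x = x) :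
    Φ.invFun t x = x := by
  conv_lhs => rw [← h]
  exact Φ.left_inv t x

theorem toFun_mem_iff_of_fixed (Φ : AmbientIsotopy S) {t : ℝ} {B : Set S}
    (h : ∀ x ∈ B, Φ.toFun t x = x) {x : S} : Φ.toFun t x ∈ B ↔ x ∈ B := by
  constructor
  · intro hx
    rwa [← Φ.injective t (h _ hx)]
  · intro hx
    rwa [h x hx]

end AmbientIsotopy

section Extension

variable {S S' S'' : OrientedSurface.{u}} {φ : PartialEquiv S S'}
  {i : PartialEquiv S S''} {i' : PartialEquiv S' S''}

open Classical in
/-- Extension of a self-map of the left piece by the identity. -/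
noncomputable def extendById (i : PartialEquiv S S'') (f : S → S) (x : S'') : S'' :=
  if x ∈ i.target then i (f (i.symm x)) else x

theorem SurfaceGluing.extendById_left (G : SurfaceGluing φ i i') (f : S → S) (p : S) :
    extendById i f (i p) = i (f p) := by
  rw [extendById, if_pos (G.mem_target p), G.symm_apply]

theorem SurfaceGluing.extendById_right (G : SurfaceGluing φ i i') {f : S → S}
    (hf : ∀ x ∈ S.bdry, f x = x) (q : S') : extendById i f (i' q) = i' q := by
  by_cases h : i' q ∈ i.target
  · obtain ⟨p, hp⟩ := G.mem_target_iff.1 h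
    rw [← hp, G.extendById_left, hf p (G.source_subset ((G.meet p q).1 hp).1)]
  · rw [extendById, if_neg h]

theorem SurfaceGluing.extendById_of_notMem (G : SurfaceGluing φ i i') {f : S → S} {K : Set S}
    (hf : ∀ x ∉ K, f x = x) {x : S''} (hx : x ∉ i '' K) : extendById i f x = x := by
  by_cases h : x ∈ i.target
  · obtain ⟨p, rfl⟩ := G.mem_target_iff.1 h
    rw [G.extendById_left, hf p fun hp => hx ⟨p, hp, rfl⟩]
  · rw [extendById, if_neg h]

theorem SurfaceGluing.extendById_leftInverse (G : SurfaceGluing φ i i') {f g : S → S}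
    (h : ∀ x, g (f x) = x) (hf : ∀ x ∈ S.bdry, f x = x) (hg : ∀ x ∈ S.bdry, g x = x) (x : S'') :
    extendById i g (extendById i f x) = x := by
  rcases G.exists_preimage x with ⟨p, rfl⟩ | ⟨q, rfl⟩
  · rw [G.extendById_left, G.extendById_left, h]
  · rw [G.extendById_right hf, G.extendById_right hg]

theorem SurfaceGluing.isOpen_image_inner (G : SurfaceGluing φ i i') : IsOpen (i '' S.inner) :=
  G.left.isOpen_image S.isOpen_inner (fun p _ => G.mem_source p) subset_rfl

theorem SurfaceGluing.contMDiffAt_symm (G : SurfaceGluing φ i i') {p : S} (hp : p ∈ S.inner) :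
    ContMDiffAt (𝓡∂ 2) (𝓡∂ 2) ∞ i.symm (i p) := by
  refine G.left.contMDiffOn_symm.contMDiffAt
    (Filter.mem_of_superset (G.isOpen_image_inner.mem_nhds ⟨p, hp, rfl⟩) ?_)
  rintro _ ⟨q, -, rfl⟩
  exact G.mem_target q

/-- Two open sets cover the glued surface: the image of the interior of `S`, where the map is
conjugate to `f` by `i`, and the complement of the compact set `i '' K`, where it is the identity.
-/
theorem SurfaceGluing.contMDiff_extendById (G : SurfaceGluing φ i i') {f : ℝ → S → S} {K : Set S}
    (hK : IsCompact K) (hKi : K ⊆ S.inner) (hf : ∀ t, ∀ x ∉ K, f t x = x)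
    (hs : ContMDiff (𝓘(ℝ, ℝ).prod (𝓡∂ 2)) (𝓡∂ 2) ∞ (fun p : ℝ × S => f p.1 p.2)) :
    ContMDiff (𝓘(ℝ, ℝ).prod (𝓡∂ 2)) (𝓡∂ 2) ∞
      (fun p : ℝ × S'' => extendById i (f p.1) p.2) := by
  rintro ⟨t, x⟩
  by_cases hx : x ∈ i '' S.inner
  · have hev : (fun p : ℝ × S'' => extendById i (f p.1) p.2) =ᶠ[𝓝 (t, x)]
        fun p => i (f p.1 (i.symm p.2)) := by
      filter_upwards [(G.isOpen_image_inner.preimage continuous_snd).mem_nhds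
        (show (t, x) ∈ Prod.snd ⁻¹' (i '' S.inner) from hx)] with p hp
      obtain ⟨q, -, hq⟩ := hp
      rw [← hq, G.extendById_left, G.symm_apply]
    refine ContMDiffAt.congr_of_eventuallyEq ?_ hev
    obtain ⟨q, hq, rfl⟩ := hx
    have h1 : ContMDiffAt (𝓘(ℝ, ℝ).prod (𝓡∂ 2)) (𝓡∂ 2) ∞ (fun p : ℝ × S'' => i.symm p.2)
        (t, i q) := ContMDiffAt.comp (t, i q) (G.contMDiffAt_symm hq) contMDiffAt_snd
    have h2 : ContMDiffAt (𝓘(ℝ, ℝ).prod (𝓡∂ 2)) (𝓘(ℝ, ℝ).prod (𝓡∂ 2)) ∞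
        (fun p : ℝ × S'' => (p.1, i.symm p.2)) (t, i q) := contMDiffAt_fst.prodMk h1
    have h3 : ContMDiffAt (𝓘(ℝ, ℝ).prod (𝓡∂ 2)) (𝓡∂ 2) ∞
        (fun p : ℝ × S'' => f p.1 (i.symm p.2)) (t, i q) :=
      ContMDiffAt.comp (t, i q) (hs _) h2
    exact ContMDiffAt.comp (t, i q) (G.left.contMDiffAt G.isOpen_source (G.mem_source _)) h3
  · have hx' : x ∈ (i '' K)ᶜ := fun h => hx (Set.image_mono hKi h)
    refine contMDiffAt_snd.congr_of_eventuallyEq ?_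
    filter_upwards [((hK.image G.continuous).isClosed.isOpen_compl.preimage
      continuous_snd).mem_nhds (show (t, x) ∈ Prod.snd ⁻¹' (i '' K)ᶜ from hx')] with p hp
    exact G.extendById_of_notMem (hf p.1) hp

theorem SurfaceGluing.jacobian_extendById_pos (G : SurfaceGluing φ i i') {f : S → S} {K : Set S}
    (hK : IsCompact K) (hKi : K ⊆ S.inner) (hf : ∀ x ∉ K, f x = x)
    (hs : ContMDiff (𝓡∂ 2) (𝓡∂ 2) ∞ f) (hj : ∀ x, 0 < jacobian f x) (x : S'') :
    0 < jacobian (extendById i f) x := by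
  by_cases hx : x ∈ i '' S.inner
  · obtain ⟨q, hq, rfl⟩ := hx
    have hev : extendById i f ∘ i =ᶠ[𝓝 q] i ∘ f :=
      Filter.Eventually.of_forall fun p => G.extendById_left f p
    have hev' : extendById i f =ᶠ[𝓝 (i q)] (i ∘ f) ∘ i.symm := by
      filter_upwards [G.isOpen_image_inner.mem_nhds ⟨q, hq, rfl⟩] with y hy
      obtain ⟨p, -, rfl⟩ := hy
      simp only [Function.comp_apply]
      rw [G.extendById_left, G.symm_apply]
    have hi : ∀ p, MDifferentiableAt (𝓡∂ 2) (𝓡∂ 2) i p := fun p =>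
      G.left.mdifferentiableAt G.isOpen_source (G.mem_source p)
    have hfd : MDifferentiableAt (𝓡∂ 2) (𝓡∂ 2) f q := (hs q).mdifferentiableAt (by simp)
    have hif := (hi (f q)).comp q hfd
    have hed : MDifferentiableAt (𝓡∂ 2) (𝓡∂ 2) (extendById i f) (i q) := by
      refine MDifferentiableAt.congr_of_eventuallyEq ?_ hev'
      refine MDifferentiableAt.comp (i q) ?_ ((G.contMDiffAt_symm hq).mdifferentiableAt (by simp))
      rw [G.symm_apply]
      exact hif
    -- The extension intertwines with `i`, so its Jacobian times that of `i` equals a product of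
    -- positive Jacobians.
    have h1 := jacobian_comp hed (hi q)
    rw [jacobian_congr hev, jacobian_comp (hi (f q)) hfd] at h1
    have h2 : 0 < jacobian i (f q) * jacobian f q :=
      mul_pos (G.left.jacobian_pos _ (G.mem_source _)) (hj q)
    rw [h1] at h2
    exact pos_of_mul_pos_left h2 (G.left.jacobian_pos _ (G.mem_source q)).le
  · have hx' : x ∈ (i '' K)ᶜ := fun h => hx (Set.image_mono hKi h)
    have hev : extendById i f =ᶠ[𝓝 x] id := by
      filter_upwards [(hK.image G.continuous).isClosed.isOpen_compl.mem_nhds hx'] with p hp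
      exact G.extendById_of_notMem hf hp
    rw [jacobian_congr hev, jacobian_id]
    exact one_pos

/-- Extension by the identity of a compactly supported ambient isotopy of the interior of the left
piece. -/
noncomputable def AmbientIsotopy.extend (Φ : AmbientIsotopy S) (G : SurfaceGluing φ i i') {K : Set S}
    (hK : IsCompact K) (hKi : K ⊆ S.inner) (hf : ∀ t, ∀ x ∉ K, Φ.toFun t x = x) :
    AmbientIsotopy S'' :=
  have hb : ∀ t, ∀ x ∈ S.bdry, Φ.toFun t x = x := fun t x hx =>
    hf t x fun h => OrientedSurface.notMem_bdry.2 (hKi h) hx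
  { toFun := fun t => extendById i (Φ.toFun t)
    invFun := fun t => extendById i (Φ.invFun t)
    left_inv := fun t => G.extendById_leftInverse (Φ.left_inv t) (hb t)
      fun x hx => Φ.invFun_eq_of_fixed (hb t x hx)
    right_inv := fun t => G.extendById_leftInverse (Φ.right_inv t)
      (fun x hx => Φ.invFun_eq_of_fixed (hb t x hx)) (hb t)
    smooth_toFun := G.contMDiff_extendById hK hKi hf Φ.smooth_toFun
    smooth_invFun := G.contMDiff_extendById hK hKi
      (fun t x hx => Φ.invFun_eq_of_fixed (hf t x hx)) Φ.smooth_invFun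
    jacobian_pos := fun t => G.jacobian_extendById_pos hK hKi (hf t)
      (contMDiffOn_univ.1 (Φ.isOrientedDiffeo_at t).contMDiffOn) (Φ.jacobian_pos t)
    -- At time `0` every point is fixed, so the empty set serves as support.
    zero := fun x => G.extendById_of_notMem (K := ∅) (fun p _ => Φ.zero p) (by simp) }

end Extension

/-! ### Isotopies of glued diagrams -/

section Isotopy

variable {S S' S'' : OrientedSurface.{u}} {D E : PartialHeegaardDiagram S}
  {D' : PartialHeegaardDiagram S'} {D'' : PartialHeegaardDiagram S''} {φ : PartialEquiv S S'}
  {i : PartialEquiv S S''} {i' : PartialEquiv S' S''}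

theorem PartialHeegaardDiagram.curves_eq_image {f : S → S} {c : Color}
    (hc : E.circles c = (fun A => f '' A) '' D.circles c)
    (ha : E.arcs c = (fun A => f '' A) '' D.arcs c) : E.curves c = f '' D.curves c := by
  rw [curves, hc, ha, ← Set.image_union, curves, Set.image_sUnion]

theorem PartialHeegaardDiagram.endpoints_eq_of_isotopy {Φ : AmbientIsotopy S} {t : ℝ} {c : Color}
    (hb : ∀ x ∈ S.bdry, Φ.toFun t x = x) (hcu : E.curves c = Φ.toFun t '' D.curves c) :
    E.endpoints c = D.endpoints c := by
  rw [endpoints_eq, endpoints_eq, hcu]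
  ext x
  constructor
  · rintro ⟨⟨y, hy, rfl⟩, hx⟩
    rw [Φ.toFun_mem_iff_of_fixed hb] at hx
    rw [hb y hx]
    exact ⟨hy, hx⟩
  · rintro ⟨hx, hxb⟩
    exact ⟨⟨x, hx, hb x hxb⟩, hxb⟩

/-- The glued diagram stays as it is, and the left embedding is precomposed with the inverse of the
time-one map. This keeps its boundary values and sends the curves of `E` where `i` sent those of
`D`. -/
theorem IsGluing.of_isIsotopicRelBdry (h : IsGluing D D' φ D'' i i') (hDE : IsIsotopicRelBdry D E) :
    ∃ i₁ : PartialEquiv S S'', IsGluing E D' φ D'' i₁ i' ∧ ∀ p ∈ S.bdry, i₁ p = i p := by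
  obtain ⟨Φ, hb, hc, ha, hp⟩ := hDE
  have G := h.surfaceGluing
  have hcu : ∀ c, E.curves c = Φ.toFun 1 '' D.curves c := fun c =>
    PartialHeegaardDiagram.curves_eq_image (hc c) (ha c)
  have hinv : ∀ p ∈ S.bdry, Φ.invFun 1 p = p := fun p hp => Φ.invFun_eq_of_fixed (hb 1 p hp)
  have himg : ∀ X : Set S, (((Φ.at' 1).symm.trans i : PartialEquiv S S'') : S → S'') ''
      (Φ.toFun 1 '' X) = i '' X := by
    intro X
    rw [Set.image_image]
    refine Set.image_congr fun x _ => ?_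
    change i (Φ.invFun 1 (Φ.toFun 1 x)) = i x
    rw [Φ.left_inv]
  have hi₁ : ∀ p ∈ S.bdry, ((Φ.at' 1).symm.trans i : PartialEquiv S S'') p = i p := by
    intro p hp
    change i (Φ.invFun 1 p) = i p
    rw [hinv p hp]
  have hsub : (Φ.at' 1).symm.target ⊆ i.source := by
    rw [G.source_left]; exact Set.subset_univ _
  have hinvb : ∀ p, Φ.invFun 1 p ∈ S.bdry → p ∈ S.bdry := by
    intro p hp
    have := hb 1 _ hp
    rw [Φ.right_inv] at this
    rwa [this]
  have G₁ : SurfaceGluing φ ((Φ.at' 1).symm.trans i) i' :=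
    { source_subset := G.source_subset
      target_subset := G.target_subset
      source_left := PartialEquiv.trans_source_of_subset hsub
      source_right := G.source_right
      left := ((Φ.isOrientedDiffeo_at 1).symm isOpen_univ isOpen_univ).trans G.left isOpen_univ
        G.isOpen_source
      right := G.right
      cover := by
        rw [PartialEquiv.trans_target_of_subset hsub]
        have : i '' (Φ.at' 1).symm.target = i.target := by
          rw [← i.image_source_eq_target, G.source_left]
          rfl
        rw [this]
        exact G.cover
      meet := by
        intro p q
        change i (Φ.invFun 1 p) = i' q ↔ _
        rw [G.meet]
        constructor
        · rintro ⟨h1, h2⟩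
          have h3 := hinv p (hinvb p (G.source_subset h1))
          rw [h3] at h1 h2
          exact ⟨h1, h2⟩
        · rintro ⟨h1, h2⟩
          rw [hinv p (G.source_subset h1)]
          exact ⟨h1, h2⟩
      bdry := by
        rw [G.bdry]
        congr 1
        exact Set.image_congr fun p hp => (hi₁ p hp.1).symm }
  refine ⟨_, G₁.isGluing (h.isGluingMap.congr fun c =>
    PartialHeegaardDiagram.endpoints_eq_of_isotopy (hb 1) (hcu c)) ?_ ?_, hi₁⟩
  · intro c
    rw [hcu, himg, h.curves]
  · intro l
    rw [hp, himg, h.basepoints]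

/-- Each color has compact support in the interior of `S`, so its isotopy extends by the identity
over the right piece. -/
theorem IsGluing.of_isIsotopyMove (h : IsGluing D D' φ D'' i i') (hDE : IsIsotopyMove D E) :
    ∃ E'' : PartialHeegaardDiagram S'', IsGluing E D' φ E'' i i' ∧ IsIsotopyMove D'' E'' := by
  obtain ⟨Φ, hK, hbp, hc, ha, hp⟩ := hDE
  choose K hKc hKi hf using hK
  have G := h.surfaceGluing
  have hb : ∀ c t, ∀ x ∈ S.bdry, (Φ c).toFun t x = x := fun c t x hx =>
    hf c t x fun h => OrientedSurface.notMem_bdry.2 (hKi c h) hx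
  have hcu : ∀ c, E.curves c = (Φ c).toFun 1 '' D.curves c := fun c =>
    PartialHeegaardDiagram.curves_eq_image (hc c) (ha c)
  let Ψ : Color → AmbientIsotopy S'' := fun c => (Φ c).extend G (hKc c) (hKi c) (hf c)
  have hΨl : ∀ c t p, (Ψ c).toFun t (i p) = i ((Φ c).toFun t p) := fun c t p =>
    G.extendById_left _ p
  have hΨr : ∀ c t q, (Ψ c).toFun t (i' q) = i' q := fun c t q =>
    G.extendById_right (hb c t) q
  have hΨf : ∀ c t, ∀ x ∉ i '' K c, (Ψ c).toFun t x = x := fun c t x hx =>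
    G.extendById_of_notMem (hf c t) hx
  have hKi'' : ∀ c, i '' K c ⊆ S''.inner := by
    rintro c _ ⟨p, hp, rfl⟩
    exact G.mem_inner (hKi c hp)
  have hΨb : ∀ c t, ∀ x ∈ S''.bdry, (Ψ c).toFun t x = x := fun c t x hx =>
    hΨf c t x fun h => OrientedSurface.notMem_bdry.2 (hKi'' c h) hx
  obtain ⟨E'', h1, h2, h3, h4⟩ := exists_gluedDiagram G
    (h.isGluingMap.congr fun c => PartialHeegaardDiagram.endpoints_eq_of_isotopy (hb c 1) (hcu c))
    (fun c => (fun A => (Ψ c).toFun 1 '' A) '' D''.circles c)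
    (fun c => (fun A => (Ψ c).toFun 1 '' A) '' D''.arcs c)
    (fun c => (D''.circles_finite c).image _) (fun c => (D''.arcs_finite c).image _)
    (by
      rintro c _ ⟨A, hA, rfl⟩
      exact (D''.isSmoothCircle c A hA).image ((Ψ c).isOrientedDiffeo_at 1) isOpen_univ
        (Set.subset_univ _))
    (by
      rintro c _ ⟨A, hA, rfl⟩
      exact (D''.isSmoothArc c A hA).image ((Ψ c).isOrientedDiffeo_at 1) isOpen_univ
        (Set.subset_univ _) fun p _ => (Ψ c).toFun_mem_iff_of_fixed (hΨb c 1))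
    (by
      intro c
      rw [← Set.image_union]
      exact (D''.disjoint c).image_image ((Ψ c).injective 1).injOn fun _ _ => Set.subset_univ _)
    (by
      intro c
      rw [← Set.image_union, ← Set.image_sUnion]
      change _ '' D''.curves c = _
      rw [h.curves, hcu, Set.image_union, Set.image_image, Set.image_image, Set.image_image]
      simp only [hΨl, hΨr])
  refine ⟨E'', h4, Ψ, fun c => ⟨i '' K c, (hKc c).image G.continuous, hKi'' c, hΨf c⟩, ?_,
    fun c => by rw [h1], fun c => by rw [h2], fun l => by rw [h3, h.basepoints, hp]⟩
  intro c t l x hx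
  rw [h.basepoints] at hx
  rcases hx with ⟨p, hp, rfl⟩ | ⟨q, -, rfl⟩
  · rw [hΨl, hbp c t l p hp]
  · exact hΨr c t q

end Isotopy

/-! ### Handleslides and index zero/three moves in planar patches -/

theorem pairOfPants_subset_pairOfPantsNhd : pairOfPants ⊆ pairOfPantsNhd := by
  rintro z ⟨h1, h2, h3⟩
  exact ⟨by linarith, by linarith, by linarith⟩

theorem norm_le_of_mem_sphere {a z : ℂ} {r : ℝ} (h : z ∈ Metric.sphere a r) : ‖z‖ ≤ r + ‖a‖ := by
  rw [mem_sphere_iff_norm] at h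
  calc ‖z‖ = ‖(z - a) + a‖ := by rw [sub_add_cancel]
    _ ≤ ‖z - a‖ + ‖a‖ := norm_add_le _ _
    _ = r + ‖a‖ := by rw [h]

theorem le_norm_of_mem_sphere {a b z : ℂ} {r : ℝ} (h : z ∈ Metric.sphere a r) :
    ‖a - b‖ - r ≤ ‖z - b‖ := by
  rw [mem_sphere_iff_norm] at h
  have : ‖a - b‖ ≤ ‖z - b‖ + ‖z - a‖ := by
    have := norm_sub_le (z - b) (z - a)
    rwa [sub_sub_sub_cancel_left] at this
  linarith

theorem sphere_four_subset_pairOfPants : Metric.sphere (0 : ℂ) 4 ⊆ pairOfPants := by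
  intro z hz
  have h1 : ‖z‖ = 4 := by simpa using hz
  have h2 := norm_sub_le (z + 2) 2
  have h3 := norm_add_le (z - 2) 2
  norm_num at h2 h3
  exact ⟨h1.le, by linarith, by linarith⟩

theorem sphere_neg_two_subset_pairOfPants : Metric.sphere (-2 : ℂ) 1 ⊆ pairOfPants := by
  intro z hz
  have h1 := norm_le_of_mem_sphere hz
  have h3 := le_norm_of_mem_sphere (b := 2) hz
  rw [mem_sphere_iff_norm] at hz
  norm_num at h1 h3 hz
  exact ⟨by linarith, hz.ge, by linarith⟩

theorem sphere_two_subset_pairOfPants : Metric.sphere (2 : ℂ) 1 ⊆ pairOfPants := by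
  intro z hz
  have h1 := norm_le_of_mem_sphere hz
  have h3 := le_norm_of_mem_sphere (b := -2) hz
  rw [mem_sphere_iff_norm] at hz
  norm_num at h1 h3 hz
  exact ⟨by linarith, by linarith, hz.ge⟩

theorem PartialEquiv.disjoint_image {X Y : Type*} (e : PartialEquiv X Y) {A B : Set X}
    (hA : A ⊆ e.source) (hB : B ⊆ e.source) (h : Disjoint A B) : Disjoint (e '' A) (e '' B) := by
  rw [Set.disjoint_left]
  rintro _ ⟨x, hx, rfl⟩ ⟨y, hy, hxy⟩
  rw [e.injOn (hB hy) (hA hx) hxy] at hy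
  exact Set.disjoint_left.1 h hx hy

section Patch

variable {S S' S'' : OrientedSurface.{u}} {D E : PartialHeegaardDiagram S}
  {D' : PartialHeegaardDiagram S'} {D'' : PartialHeegaardDiagram S''} {φ : PartialEquiv S S'}
  {i : PartialEquiv S S''} {i' : PartialEquiv S' S''}

theorem IsPatch.image_subset_inner {e : PartialEquiv ℂ S} (he : IsPatch e) {X : Set ℂ}
    (hX : X ⊆ e.source) : e '' X ⊆ S.inner := by
  rintro _ ⟨z, hz, rfl⟩
  exact he.target_subset (e.map_source (hX hz))

theorem SurfaceGluing.target_subset_source (G : SurfaceGluing φ i i') (e : PartialEquiv ℂ S) :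
    e.target ⊆ i.source := by
  rw [G.source_left]; exact Set.subset_univ _

theorem SurfaceGluing.isPatch (G : SurfaceGluing φ i i') {e : PartialEquiv ℂ S} (he : IsPatch e) :
    IsPatch (e.trans i) :=
  he.trans G.left G.isOpen_source (G.target_subset_source e)

theorem SurfaceGluing.trans_source (G : SurfaceGluing φ i i') (e : PartialEquiv ℂ S) :
    (e.trans i).source = e.source :=
  PartialEquiv.trans_source_of_subset (G.target_subset_source e)

theorem SurfaceGluing.trans_target (G : SurfaceGluing φ i i') (e : PartialEquiv ℂ S) :
    (e.trans i).target = i '' e.target :=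
  PartialEquiv.trans_target_of_subset (G.target_subset_source e)

theorem PartialEquiv.trans_image {X Y Z : Type*} (e : PartialEquiv X Y) (f : PartialEquiv Y Z)
    (s : Set X) : (e.trans f) '' s = f '' (e '' s) :=
  Set.image_comp f e s

theorem IsGluing.image_inter_curves (h : IsGluing D D' φ D'' i i') {c : Color} (X : Set S) :
    i '' X ∩ D''.curves c = i '' (X ∩ D.curves c) := by
  ext x
  constructor
  · rintro ⟨⟨p, hp, rfl⟩, hx⟩
    exact ⟨p, ⟨hp, h.mem_curves_iff.1 hx⟩, rfl⟩
  · rintro ⟨p, ⟨hp, hpc⟩, rfl⟩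
    exact ⟨⟨p, hp, rfl⟩, h.mem_curves_iff.2 hpc⟩

theorem IsGluing.disjoint_image_curves (h : IsGluing D D' φ D'' i i') {c : Color} {X : Set S}
    (hX : Disjoint X (D.curves c)) : Disjoint (i '' X) (D''.curves c) := by
  rw [Set.disjoint_iff_inter_eq_empty, h.image_inter_curves, hX.inter_eq, Set.image_empty]

theorem IsGluing.image_inter_basepoints (h : IsGluing D D' φ D'' i i') {l : Label} {X : Set S}
    (hi : X ⊆ S.inner) : i '' X ∩ D''.basepoints l = i '' (X ∩ D.basepoints l) := by
  ext x
  constructor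
  · rintro ⟨⟨p, hp, rfl⟩, hx⟩
    exact ⟨p, ⟨hp, (h.mem_basepoints_iff (hi hp)).1 hx⟩, rfl⟩
  · rintro ⟨p, ⟨hp, hpc⟩, rfl⟩
    exact ⟨⟨p, hp, rfl⟩, (h.mem_basepoints_iff (hi hp)).2 hpc⟩

theorem IsGluing.disjoint_image_basepoints (h : IsGluing D D' φ D'' i i') {l : Label} {X : Set S}
    (hi : X ⊆ S.inner) (hX : Disjoint X (D.basepoints l)) :
    Disjoint (i '' X) (D''.basepoints l) := by
  rw [Set.disjoint_iff_inter_eq_empty, h.image_inter_basepoints hi, hX.inter_eq, Set.image_empty]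

theorem PartialHeegaardDiagram.endpoints_congr (h : ∀ c, E.arcs c = D.arcs c) (c : Color) :
    E.endpoints c = D.endpoints c := by
  rw [endpoints, h, endpoints]

theorem PartialHeegaardDiagram.curves_insert {c : Color} {N : Set S} {𝒞 : Set (Set S)}
    (hc : E.circles c = insert N 𝒞) (ha : E.arcs c = D.arcs c) :
    E.curves c = N ∪ ⋃₀ (𝒞 ∪ D.arcs c) := by
  rw [curves, hc, ha, Set.insert_union, Set.sUnion_insert]

/-- The patch lies in the interior of `S`, so its composite with `i` is a patch meeting no curves or
basepoints beyond those it met in `S`. The circles `A` and `B` remain circles after gluing. -/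
theorem IsGluing.of_isHandleslide (h : IsGluing D D' φ D'' i i') {c : Color}
    (hDE : IsHandleslide c D E) :
    ∃ E'' : PartialHeegaardDiagram S'', IsGluing E D' φ E'' i i' ∧ IsHandleslide c D'' E'' := by
  obtain ⟨A, B, e, hA, hB, hAB, he, hes, heA, heB, hcur, hbp, hc, hco, ha, hb⟩ := hDE
  have G := h.surfaceGluing
  have hP : pairOfPants ⊆ e.source := hes ▸ pairOfPants_subset_pairOfPantsNhd
  set N := e '' Metric.sphere 0 4 with hN
  have hNA : Disjoint N A := by
    rw [hN, ← heA]
    refine e.disjoint_image (sphere_four_subset_pairOfPants.trans hP)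
      (sphere_neg_two_subset_pairOfPants.trans hP) (Set.disjoint_left.2 fun z hz hz' => ?_)
    have h1 := norm_le_of_mem_sphere hz'
    rw [mem_sphere_iff_norm, sub_zero] at hz
    rw [hz] at h1
    norm_num at h1
  have hNB : Disjoint N B := by
    rw [hN, ← heB]
    refine e.disjoint_image (sphere_four_subset_pairOfPants.trans hP)
      (sphere_two_subset_pairOfPants.trans hP) (Set.disjoint_left.2 fun z hz hz' => ?_)
    have h1 := norm_le_of_mem_sphere hz'
    rw [mem_sphere_iff_norm, sub_zero] at hz
    rw [hz] at h1
    norm_num at h1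
  -- In the pair of pants only `A` and `B` can be met, and the three boundary circles are disjoint.
  have hNcur : Disjoint N (D.curves c) := by
    rw [Set.disjoint_left]
    intro x hx hxc
    rcases hcur ⟨Set.image_mono sphere_four_subset_pairOfPants hx, hxc⟩ with h1 | h1
    · exact Set.disjoint_left.1 hNA hx h1
    · exact Set.disjoint_left.1 hNB hx h1
  have hNE : N ∈ E.circles c := hc ▸ Set.mem_insert _ _
  have hNs : IsSmoothCircle (i '' N) :=
    (E.isSmoothCircle c N hNE).image G.left G.isOpen_source fun p _ => G.mem_source p
  have hA'' := h.image_mem_circles hA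
  have hB'' := h.image_mem_circles hB
  obtain ⟨𝒞, h𝒞c, h𝒞o⟩ := Color.exists_fun c
    (insert (i '' N) (D''.circles c \ {i '' A})) (D''.circles c.other)
  have hunion : ⋃₀ (D''.circles c \ {i '' A} ∪ D''.arcs c) =
      i '' (D.curves c \ A) ∪ i' '' D'.curves c := by
    rw [D''.sUnion_diff_circle hA'', h.curves_diff (D.isSmoothCircle c A hA).subset_inner]
  obtain ⟨E'', h1, h2, h3, h4⟩ := exists_gluedDiagram G
    (h.isGluingMap.congr (PartialHeegaardDiagram.endpoints_congr ha)) 𝒞 D''.arcs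
    (c.forall_of_other (by rw [h𝒞c]; exact ((D''.circles_finite c).subset Set.sdiff_subset).insert _)
      (by rw [h𝒞o]; exact D''.circles_finite _))
    D''.arcs_finite
    (c.forall_of_other
      (by
        rw [h𝒞c]
        rintro C (rfl | hC)
        · exact hNs
        · exact D''.isSmoothCircle c C hC.1)
      (by rw [h𝒞o]; exact D''.isSmoothCircle _))
    D''.isSmoothArc
    (c.forall_of_other
      (by
        rw [h𝒞c, Set.insert_union]
        refine Set.PairwiseDisjoint.insert_of_disjoint ((D''.disjoint c).subset
          (Set.union_subset_union_left _ Set.sdiff_subset)) ?_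
        rw [D''.sUnion_diff_circle hA'']
        exact (h.disjoint_image_curves hNcur).mono_right Set.sdiff_subset)
      (by rw [h𝒞o]; exact D''.disjoint _))
    (c.forall_of_other
      (by
        rw [h𝒞c, Set.insert_union, Set.sUnion_insert, hunion,
          PartialHeegaardDiagram.curves_insert hc (ha c), D.sUnion_diff_circle hA,
          Set.image_union, Set.union_assoc])
      (by
        rw [h𝒞o]
        change D''.curves _ = _
        rw [h.curves]
        simp only [PartialHeegaardDiagram.curves, hco, ha]))
  refine ⟨E'', h4, i '' A, i '' B, e.trans i, hA'', hB'',
    fun hab => hAB (G.injective.image_injective hab), G.isPatch he,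
    (G.trans_source e).trans hes, ?_, ?_, ?_, ?_, ?_, ?_, fun c' => by rw [h2], ?_⟩
  · rw [PartialEquiv.trans_image, heA]
  · rw [PartialEquiv.trans_image, heB]
  · rw [PartialEquiv.trans_image, h.image_inter_curves, ← Set.image_union]
    exact Set.image_mono hcur
  · intro l
    rw [PartialEquiv.trans_image]
    exact h.disjoint_image_basepoints (he.image_subset_inner hP) (hbp l)
  · rw [h1, h𝒞c, PartialEquiv.trans_image]
  · rw [h1, h𝒞o]
  · intro l
    rw [h3, hb, h.basepoints]

/-- The circles added by an index zero/three stabilization. -/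
theorem isZeroThreeStabilization_iff {l : Label} : IsZeroThreeStabilization l D E ↔
    ∃ e : PartialEquiv ℂ S, IsPatch e ∧ e.source = Metric.ball 0 4 ∧
      (∀ c, Disjoint e.target (D.curves c)) ∧ D.basepoints l ∩ e.target = {e (-2)} ∧
      Disjoint e.target (D.basepoints l.other) ∧
      (∀ c, E.circles c = insert (e '' Metric.sphere (Color.casesOn c (-1) 1) 2) (D.circles c)) ∧
      (∀ c, E.arcs c = D.arcs c) ∧ E.basepoints l = insert (e 2) (D.basepoints l) ∧
      E.basepoints l.other = insert (e 0) (D.basepoints l.other) := by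
  constructor
  · rintro ⟨e, h1, h2, h3, h4, h5, h6, h7, h8⟩
    exact ⟨e, h1, h2, h3, h4, h5, fun | .alpha => h6 | .beta => h7, h8⟩
  · rintro ⟨e, h1, h2, h3, h4, h5, h6, h8⟩
    exact ⟨e, h1, h2, h3, h4, h5, h6 .alpha, h6 .beta, h8⟩

theorem sphere_two_subset_ball (c : Color) :
    Metric.sphere (Color.casesOn c (-1) 1 : ℂ) 2 ⊆ Metric.ball 0 4 := by
  intro z hz
  have h1 := norm_le_of_mem_sphere hz
  rw [mem_ball_zero_iff]
  cases c <;> norm_num at h1 <;> linarith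

/-- Shared by both directions of the move: once both glued diagrams are available, only the local
model has to be transported by `i`. -/
theorem IsZeroThreeStabilization.glue {l : Label} {E'' : PartialHeegaardDiagram S''}
    {e : PartialEquiv ℂ S} (hD : IsGluing D D' φ D'' i i') (hE : IsGluing E D' φ E'' i i')
    (he : IsPatch e) (hes : e.source = Metric.ball 0 4)
    (hcur : ∀ c, Disjoint e.target (D.curves c)) (hbl : D.basepoints l ∩ e.target = {e (-2)})
    (hblo : Disjoint e.target (D.basepoints l.other))
    (hEl : E.basepoints l = insert (e 2) (D.basepoints l))
    (hElo : E.basepoints l.other = insert (e 0) (D.basepoints l.other))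
    (hc : ∀ c, E''.circles c =
      insert (i '' (e '' Metric.sphere (Color.casesOn c (-1) 1) 2)) (D''.circles c))
    (ha : ∀ c, E''.arcs c = D''.arcs c) : IsZeroThreeStabilization l D'' E'' := by
  have G := hD.surfaceGluing
  refine isZeroThreeStabilization_iff.2 ⟨e.trans i, G.isPatch he, (G.trans_source e).trans hes,
    fun c => ?_, ?_, ?_, fun c => ?_, ha, ?_, ?_⟩
  · rw [G.trans_target]
    exact hD.disjoint_image_curves (hcur c)
  · rw [G.trans_target, Set.inter_comm, hD.image_inter_basepoints he.target_subset, Set.inter_comm,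
      hbl, Set.image_singleton]
    rfl
  · rw [G.trans_target]
    exact hD.disjoint_image_basepoints he.target_subset hblo
  · rw [hc, PartialEquiv.trans_image]
  · rw [hE.basepoints, hEl, Set.image_insert_eq, Set.insert_union, ← hD.basepoints]
    rfl
  · rw [hE.basepoints, hElo, Set.image_insert_eq, Set.insert_union, ← hD.basepoints]
    rfl

theorem IsGluing.of_isZeroThreeStabilization (h : IsGluing D D' φ D'' i i') {l : Label}
    (hDE : IsZeroThreeStabilization l D E) :
    ∃ E'' : PartialHeegaardDiagram S'', IsGluing E D' φ E'' i i' ∧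
      IsZeroThreeStabilization l D'' E'' := by
  obtain ⟨e, he, hes, hcur, hbl, hblo, hc, ha, hEl, hElo⟩ := isZeroThreeStabilization_iff.1 hDE
  have G := h.surfaceGluing
  have hN : ∀ c, Disjoint (e '' Metric.sphere (Color.casesOn c (-1) 1 : ℂ) 2) (D.curves c) := by
    intro c
    refine (hcur c).mono_left ?_
    rintro _ ⟨z, hz, rfl⟩
    exact e.map_source (hes ▸ sphere_two_subset_ball c hz)
  obtain ⟨E'', h1, h2, h3, h4⟩ := exists_gluedDiagram G
    (h.isGluingMap.congr (PartialHeegaardDiagram.endpoints_congr ha))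
    (fun c => insert (i '' (e '' Metric.sphere (Color.casesOn c (-1) 1) 2)) (D''.circles c))
    D''.arcs (fun c => (D''.circles_finite c).insert _) D''.arcs_finite
    (by
      rintro c C (rfl | hC)
      · exact (E.isSmoothCircle c _ (hc c ▸ Set.mem_insert _ _)).image G.left G.isOpen_source
          fun p _ => G.mem_source p
      · exact D''.isSmoothCircle c C hC)
    D''.isSmoothArc
    (by
      intro c
      rw [Set.insert_union]
      exact (D''.disjoint c).insert_of_disjoint (h.disjoint_image_curves (hN c)))
    (by
      intro c
      rw [Set.insert_union, Set.sUnion_insert, PartialHeegaardDiagram.curves_insert (hc c) (ha c)]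
      change _ ∪ D''.curves c = i '' (_ ∪ D.curves c) ∪ _
      rw [h.curves, Set.image_union, Set.union_assoc])
  exact ⟨E'', h4, .glue h h4 he hes hcur hbl hblo hEl hElo (fun c => by rw [h1])
    fun c => by rw [h2]⟩

/-- The two circles to be removed are circles of `E''`, because they miss the seam; deleting them
gives the required glued diagram. -/
theorem IsGluing.of_isZeroThreeDestabilization {E'' : PartialHeegaardDiagram S''}
    (h : IsGluing E D' φ E'' i i') {l : Label} (hDE : IsZeroThreeStabilization l D E) :
    ∃ D'' : PartialHeegaardDiagram S'', IsGluing D D' φ D'' i i' ∧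
      IsZeroThreeStabilization l D'' E'' := by
  obtain ⟨e, he, hes, hcur, hbl, hblo, hc, ha, hEl, hElo⟩ := isZeroThreeStabilization_iff.1 hDE
  have G := h.surfaceGluing
  have hN : ∀ c, Disjoint (e '' Metric.sphere (Color.casesOn c (-1) 1 : ℂ) 2) (D.curves c) := by
    intro c
    refine (hcur c).mono_left ?_
    rintro _ ⟨z, hz, rfl⟩
    exact e.map_source (hes ▸ sphere_two_subset_ball c hz)
  have hNE : ∀ c, e '' Metric.sphere (Color.casesOn c (-1) 1) 2 ∈ E.circles c := fun c =>
    hc c ▸ Set.mem_insert _ _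
  have hcurE : ∀ c, E.curves c \ (e '' Metric.sphere (Color.casesOn c (-1) 1) 2) =
      D.curves c := by
    intro c
    rw [PartialHeegaardDiagram.curves_insert (hc c) (ha c), Set.union_sdiff_left]
    exact (hN c).symm.sdiff_eq_left
  obtain ⟨D'', h1, h2, h3, h4⟩ := exists_gluedDiagram G
    (h.isGluingMap.congr (PartialHeegaardDiagram.endpoints_congr fun c => (ha c).symm))
    (fun c => E''.circles c \ {i '' (e '' Metric.sphere (Color.casesOn c (-1) 1) 2)})
    E''.arcs (fun c => (E''.circles_finite c).subset Set.sdiff_subset) E''.arcs_finite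
    (fun c C hC => E''.isSmoothCircle c C hC.1) E''.isSmoothArc
    (fun c => (E''.disjoint c).subset (Set.union_subset_union_left _ Set.sdiff_subset))
    (by
      intro c
      rw [E''.sUnion_diff_circle (h.image_mem_circles (hNE c)),
        h.curves_diff (E.isSmoothCircle c _ (hNE c)).subset_inner, hcurE])
  exact ⟨D'', h4, .glue h4 h he hes hcur hbl hblo hEl hElo
    (fun c => by
      rw [h1, Set.insert_sdiff_singleton, Set.insert_eq_of_mem (h.image_mem_circles (hNE c))])
    fun c => by rw [h2]⟩

end Patch

/-! ### Index one/two moves on glued diagrams -/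

/-- The partial diffeomorphism `r` between two glued surfaces is `o` on the left pieces and the
identity on the common right piece. -/
structure IsSurgery {S S' S'' T T'' : OrientedSurface.{u}} (i : PartialEquiv S S'')
    (i' : PartialEquiv S' S'') (o : PartialEquiv S T) (j : PartialEquiv T T'')
    (j' : PartialEquiv S' T'') (r : PartialEquiv S'' T'') : Prop where
  diffeo : IsOrientedDiffeo r
  isOpen_source : IsOpen r.source
  isOpen_target : IsOpen r.target
  source_eq : r.source = (i '' o.sourceᶜ)ᶜ
  target_eq : r.target = (j '' o.targetᶜ)ᶜ
  left_mem : ∀ p ∈ o.source, i p ∈ r.source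
  right_mem : ∀ q, i' q ∈ r.source
  left : ∀ p ∈ o.source, r (i p) = j (o p)
  right : ∀ q, r (i' q) = j' q
  mem_bdry_iff : ∀ x ∈ r.source, r x ∈ T''.bdry ↔ x ∈ S''.bdry

namespace IsSurgery

variable {S S' S'' T T'' : OrientedSurface.{u}} {i : PartialEquiv S S''}
  {i' : PartialEquiv S' S''} {o : PartialEquiv S T} {j : PartialEquiv T T''}
  {j' : PartialEquiv S' T''} {r : PartialEquiv S'' T''}

/-- Through this symmetry a destabilization uses the same surgery construction as a stabilization.
-/
theorem symm (H : IsSurgery i i' o j j' r) : IsSurgery j j' o.symm i i' r.symm where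
  diffeo := H.diffeo.symm H.isOpen_source H.isOpen_target
  isOpen_source := H.isOpen_target
  isOpen_target := H.isOpen_source
  source_eq := H.target_eq
  target_eq := H.source_eq
  left_mem t ht := by
    have h1 := o.map_target ht
    have h2 := r.map_source (H.left_mem _ h1)
    rwa [H.left _ h1, o.right_inv ht] at h2
  right_mem q := by
    have h2 := r.map_source (H.right_mem q)
    rwa [H.right] at h2
  left t ht := by
    have h1 := o.map_target ht
    rw [← r.left_inv (H.left_mem _ h1), H.left _ h1, o.right_inv ht]
  right q := by rw [← H.right, r.left_inv (H.right_mem q)]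
  mem_bdry_iff x hx := by
    rw [← H.mem_bdry_iff _ (r.map_target hx), r.right_inv hx]

theorem image_left (H : IsSurgery i i' o j j' r) {X : Set S} (hX : X ⊆ o.source) :
    r '' (i '' X) = j '' (o '' X) := by
  rw [Set.image_image, Set.image_image]
  exact Set.image_congr fun p hp => H.left p (hX hp)

theorem image_right (H : IsSurgery i i' o j j' r) (Y : Set S') : r '' (i' '' Y) = j' '' Y := by
  rw [Set.image_image]
  exact Set.image_congr fun q _ => H.right q

theorem image_union (H : IsSurgery i i' o j j' r) {X : Set S} (hX : X ⊆ o.source) (Y : Set S') :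
    r '' (i '' X ∪ i' '' Y) = j '' (o '' X) ∪ j' '' Y := by
  rw [Set.image_union, H.image_left hX, H.image_right]

theorem union_subset_source (H : IsSurgery i i' o j j' r) {X : Set S} (hX : X ⊆ o.source)
    (Y : Set S') : i '' X ∪ i' '' Y ⊆ r.source := by
  rintro _ (⟨p, hp, rfl⟩ | ⟨q, -, rfl⟩)
  · exact H.left_mem p (hX hp)
  · exact H.right_mem q

theorem bdry_subset (H : IsSurgery i i' o j j' r) {φ : PartialEquiv S S'}
    (G : SurfaceGluing φ i i') (ho : S.bdry ⊆ o.source) : S''.bdry ⊆ r.source := by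
  rw [G.bdry]
  exact H.union_subset_source (Set.sdiff_subset.trans ho) _

theorem restr_source (_ : IsSurgery i i' o j j' r) (hs : S''.bdry ⊆ r.source) :
    (r.restr S''.bdry).source = S''.bdry := by
  rw [PartialEquiv.restr_source]
  exact Set.inter_eq_right.2 hs

theorem restr_target (H : IsSurgery i i' o j j' r) (ht : T''.bdry ⊆ r.target) :
    (r.restr S''.bdry).target = T''.bdry := by
  rw [PartialEquiv.restr_target]
  ext x
  constructor
  · rintro ⟨h1, h2⟩
    exact (H.symm.mem_bdry_iff x h1).1 h2
  · intro hx
    exact ⟨ht hx, (H.symm.mem_bdry_iff x (ht hx)).2 hx⟩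

end IsSurgery

theorem Surgery.isSurgery {S S' S'' T : OrientedSurface.{u}} (G : Surgery S S' S'' T) :
    IsSurgery G.i G.i' G.o G.j G.j' G.keep' where
  diffeo := G.isOrientedDiffeo_keep'
  isOpen_source := G.isOpen_keep_source
  isOpen_target := G.isOpen_keep'_target
  source_eq := G.keep_source
  target_eq := by
    ext m
    rw [Set.mem_compl_iff]
    constructor
    · rintro hm ⟨t, ht, rfl⟩
      exact ht hm
    · rcases m with t | x
      · intro hm
        by_contra ht
        exact hm ⟨t, ht, rfl⟩
      · exact fun _ => trivial
  left_mem _ hp := G.left_mem_keep_source.2 hp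
  right_mem := G.right_mem_keep_source
  left p _ := G.keep'_left p
  right _ := rfl
  mem_bdry_iff _ := G.mem_bdry_result_iff

theorem stabilizationFeet_subset : stabilizationFeet ⊆ stabilizationRectangle := by
  rintro z (hz | hz) <;> rw [mem_closedBall_iff_norm] at hz <;>
    have h1 := (Complex.abs_re_le_norm _).trans hz <;>
    have h2 := (Complex.abs_im_le_norm _).trans hz <;>
    simp [abs_le] at h1 h2 <;>
    exact ⟨abs_lt.2 ⟨by linarith, by linarith⟩, abs_lt.2 ⟨by linarith, by linarith⟩⟩

theorem notMem_stabilizationFeet {z : ℂ} (hz : |z.re| < 2) : z ∉ stabilizationFeet := by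
  rw [abs_lt] at hz
  rintro (h | h) <;> rw [mem_closedBall_iff_norm] at h <;>
    have h1 := (Complex.abs_re_le_norm _).trans h <;>
    simp [abs_le] at h1 <;> linarith

/-- With `three_sub_inv_mem_stabilizationRectangle`, this places the attaching points of both handle
collars inside the patch, hence in the interior of `S`. -/
theorem sub_three_mem_stabilizationRectangle {z : ℂ} (hz : ‖z‖ < 2) :
    z - 3 ∈ stabilizationRectangle := by
  have h1 := abs_lt.1 ((Complex.abs_re_le_norm z).trans_lt hz)
  have h2 := abs_lt.1 ((Complex.abs_im_le_norm z).trans_lt hz)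
  refine ⟨abs_lt.2 ?_, abs_lt.2 ?_⟩ <;> simp <;> constructor <;> linarith

theorem three_sub_inv_mem_stabilizationRectangle {z : ℂ} (hz : 1 / 2 < ‖z‖) :
    3 - z⁻¹ ∈ stabilizationRectangle := by
  have h0 : ‖z⁻¹‖ < 2 := by
    rw [norm_inv]
    have := inv_lt_inv₀ (by linarith) (by norm_num : (0 : ℝ) < 1 / 2) |>.2 hz
    simpa using this
  have h1 := abs_lt.1 ((Complex.abs_re_le_norm z⁻¹).trans_lt h0)
  have h2 := abs_lt.1 ((Complex.abs_im_le_norm z⁻¹).trans_lt h0)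
  refine ⟨abs_lt.2 ?_, abs_lt.2 ?_⟩ <;>
    simp only [Complex.sub_re, Complex.sub_im, Complex.re_ofNat, Complex.im_ofNat] <;>
    constructor <;> linarith

/-- The properties of an index one/two stabilization, with new circles `N`, that are used for
gluing. -/
structure OneTwoModel {S T : OrientedSurface.{u}} (c : Color) (D : PartialHeegaardDiagram S)
    (E : PartialHeegaardDiagram T) (b : PartialEquiv S T) (o : PartialEquiv S T)
    (N : Color → Set T) : Prop where
  diffeo : IsOrientedDiffeo o
  isOpen_source : IsOpen o.source
  isOpen_target : IsOpen o.target
  nonempty_left : Nonempty S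
  nonempty_right : Nonempty T
  bdry_subset : S.bdry ⊆ o.source
  curves_subset : ∀ c', D.curves c' ⊆ o.source
  circles : ∀ c', E.circles c' = insert (N c') ((fun A => o '' A) '' D.circles c')
  arcs : ∀ c', E.arcs c' = (fun A => o '' A) '' D.arcs c'
  -- A new circle leaves the carried part, so it differs from every carried curve.
  not_subset : ∀ c', ¬ N c' ⊆ o.target
  b_source : b.source = S.bdry
  b_target : b.target = T.bdry
  b_eqOn : Set.EqOn b o S.bdry
  -- This field hides the patch, the strands and the handle; it serves both stabilization and
  -- destabilization.
  glue : ∀ {S' S'' T'' : OrientedSurface.{u}} {D' : PartialHeegaardDiagram S'}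
    {D'' : PartialHeegaardDiagram S''} {E'' : PartialHeegaardDiagram T''}
    {φ : PartialEquiv S S'} {ψ : PartialEquiv T S'} {i : PartialEquiv S S''}
    {i' : PartialEquiv S' S''} {j : PartialEquiv T T''} {j' : PartialEquiv S' T''}
    {r : PartialEquiv S'' T''} {b'' : PartialEquiv S'' T''}, IsGluing D D' φ D'' i i' →
    IsGluing E D' ψ E'' j j' → IsSurgery i i' o j j' r →
    (∀ c', E''.circles c' = insert (j '' N c') ((fun A => r '' A) '' D''.circles c')) →
    (∀ c', E''.arcs c' = (fun A => r '' A) '' D''.arcs c') →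
    b''.source = S''.bdry → b''.target = T''.bdry → Set.EqOn b'' r S''.bdry →
    IsOneTwoStabilization c D'' E'' b''

theorem IsOneTwoStabilization.exists_model {S T : OrientedSurface.{u}} {c : Color}
    {D : PartialHeegaardDiagram S} {E : PartialHeegaardDiagram T} {b : PartialEquiv S T}
    (hDE : IsOneTwoStabilization c D E b) : ∃ o N, OneTwoModel c D E b o N := by
  obtain ⟨e, strands, o, h, he, hes, hcur, hbp, hstr, hcuro, ho, hos, hot, hh, hhs, hcov, hoh,
    hc, hco, ha, hb, hbs, hbt, hbo⟩ := hDE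
  obtain ⟨N, hN, hNo⟩ := c.exists_fun
    (o '' (e '' {z | z.im = 0 ∧ |z.re| < 2}) ∪ h '' {z ∈ handleAnnulus | z.im = 0 ∧ 0 < z.re})
    (h '' Metric.sphere 0 1)
  have hfeet : stabilizationFeet ⊆ e.source := hes ▸ stabilizationFeet_subset
  have hft : e '' stabilizationFeet ⊆ e.target := by
    rintro _ ⟨z, hz, rfl⟩
    exact e.map_source (hfeet hz)
  have hcore : {z : ℂ | z.im = 0 ∧ |z.re| < 2} ⊆ stabilizationRectangle := by
    rintro z ⟨h1, h2⟩
    exact ⟨by linarith, by rw [h1, abs_zero]; norm_num⟩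
  have hcoreo : e '' {z : ℂ | z.im = 0 ∧ |z.re| < 2} ⊆ o.source := by
    rw [hos]
    refine Set.disjoint_left.1 (e.disjoint_image (hes ▸ hcore) hfeet
      (Set.disjoint_left.2 fun z hz => notMem_stabilizationFeet hz.2))
  have hoSource : IsOpen o.source := by
    rw [hos]
    have : IsCompact (e '' stabilizationFeet) :=
      ((isCompact_closedBall _ _).union (isCompact_closedBall _ _)).image_of_continuousOn
        (he.contMDiffOn.continuousOn.mono hfeet)
    exact this.isClosed.isOpen_compl
  have hbelt : Metric.sphere (0 : ℂ) 1 ⊆ handleAnnulus := by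
    intro z hz
    have h1 : ‖z‖ = 1 := by simpa using hz
    exact ⟨by rw [h1]; norm_num, by rw [h1]; norm_num⟩
  have hone : (1 : ℂ) ∈ handleAnnulus := hbelt (by simp)
  -- At norm `1` neither collar identification applies, so this point of the handle is not carried
  -- over. Both new circles pass through it.
  have hnot : h 1 ∉ o.target := by
    intro ht
    have := (hoh _ (o.map_target ht) 1 hone).1 (o.right_inv ht)
    rw [norm_one] at this
    rcases this with h | h <;> exact lt_irrefl _ h.1
  -- Inside the patch these curves are strands with real part of absolute value below `1`, whereas
  -- the feet are the unit disks around `-3` and `3`.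
  have hdo : D.curves c.other ⊆ o.source := by
    rw [hos]
    intro x hx hxf
    have h1 : x ∈ D.curves c.other ∩ e.target := ⟨hx, hft hxf⟩
    rw [hcuro] at h1
    refine Set.disjoint_left.1 (e.disjoint_image (A := {z ∈ stabilizationRectangle | z.re ∈ strands})
      (fun z hz => hes ▸ hz.1) hfeet (Set.disjoint_left.2 fun z hz => ?_)) h1 hxf
    exact notMem_stabilizationFeet ((hstr _ hz.2).trans (by norm_num))
  have hdc : D.curves c ⊆ o.source := by
    rw [hos]
    exact fun x hx hxf => Set.disjoint_left.1 hcur (hft hxf) hx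
  have hbo' : ∀ l, D.basepoints l ⊆ o.source := by
    intro l
    rw [hos]
    exact fun x hx hxf => Set.disjoint_left.1 (hbp l) (hft hxf) hx
  refine ⟨o, N, ho, hoSource, hot, ⟨e 0⟩, ⟨h 1⟩, ?_, c.forall_of_other hdc hdo,
    c.forall_of_other (hN ▸ hc) (hNo ▸ hco), ha, c.forall_of_other ?_ ?_, hbs, hbt, hbo, ?_⟩
  · rw [hos]
    intro x hx hxf
    exact OrientedSurface.notMem_bdry.2 (he.target_subset (hft hxf)) hx
  · rw [hN]
    exact fun hs => hnot (hs (Or.inr ⟨1, ⟨hone, by simp, by simp⟩, rfl⟩))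
  · rw [hNo]
    exact fun hs => hnot (hs ⟨1, by simp, rfl⟩)
  intro S' S'' T'' D' D'' E'' φ ψ i i' j j' r b'' hD hE H hcirc harcs hb1 hb2 hb3
  have G := hD.surfaceGluing
  have G' := hE.surfaceGluing
  have hcx := hcirc c
  have hcox := hcirc c.other
  rw [hN] at hcx
  rw [hNo] at hcox
  refine ⟨e.trans i, strands, r, h.trans j, G.isPatch he, (G.trans_source e).trans hes, ?_, ?_,
    hstr, ?_, H.diffeo, ?_, H.isOpen_target, G'.isPatch hh, (G'.trans_source h).trans hhs, ?_, ?_,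
    ?_, ?_, harcs, ?_, hb1, hb2, hb3⟩
  · rw [G.trans_target]
    exact hD.disjoint_image_curves hcur
  · intro l
    rw [G.trans_target]
    exact hD.disjoint_image_basepoints he.target_subset (hbp l)
  · rw [G.trans_target, Set.inter_comm, hD.image_inter_curves, Set.inter_comm, hcuro,
      PartialEquiv.trans_image]
  · rw [H.source_eq, hos, compl_compl, PartialEquiv.trans_image]
  · rw [H.target_eq, G'.trans_target, Set.eq_univ_iff_forall]
    intro x
    by_cases hx : x ∈ j '' o.targetᶜ
    · obtain ⟨t, ht, rfl⟩ := hx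
      have := hcov.ge (Set.mem_univ t)
      exact Or.inr ⟨t, this.resolve_left ht, rfl⟩
    · exact Or.inl hx
  · intro x hx z hz
    have hhz : h z ∈ T.inner := hh.target_subset (h.map_source (hhs ▸ hz))
    simp only [PartialEquiv.coe_trans, Function.comp_apply]
    rcases G.exists_preimage x with ⟨p, rfl⟩ | ⟨q, rfl⟩
    · have hp : p ∈ o.source := by
        by_contra hp
        rw [H.source_eq] at hx
        exact hx ⟨p, hp, rfl⟩
      rw [H.left p hp, G'.injective.eq_iff, G.injective.eq_iff, G.injective.eq_iff]
      exact hoh p hp z hz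
    · rw [H.right]
      -- For points of the right piece both sides of the equivalence are false: the patch and the
      -- handle lie in the interiors of `S` and `T`.
      have hne : ∀ w ∈ stabilizationRectangle, i' q ≠ i (e w) := fun w hw hq =>
        G.ne_of_mem_inner (he.target_subset (e.map_source (hes ▸ hw))) q hq.symm
      constructor
      · exact fun hq => absurd hq.symm (G'.ne_of_mem_inner hhz q)
      · rintro (⟨-, hq⟩ | ⟨-, hq⟩)
        · exact absurd hq (hne _ (sub_three_mem_stabilizationRectangle hz.2))
        · exact absurd hq (hne _ (three_sub_inv_mem_stabilizationRectangle hz.1))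
  · rw [hcx, PartialEquiv.trans_image, PartialEquiv.trans_image, H.image_left hcoreo,
      Set.image_union]
  · rw [hcox, PartialEquiv.trans_image]
  · intro l
    rw [hE.basepoints, hb, hD.basepoints, H.image_union (hbo' l)]

namespace OneTwoModel

variable {S S' S'' T T'' : OrientedSurface.{u}} {c : Color} {D : PartialHeegaardDiagram S}
  {E : PartialHeegaardDiagram T} {D' : PartialHeegaardDiagram S'} {b o : PartialEquiv S T}
  {N : Color → Set T}

theorem mem_circles (M : OneTwoModel c D E b o N) (c' : Color) : N c' ∈ E.circles c' :=
  M.circles c' ▸ Set.mem_insert _ _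

theorem curves_eq (M : OneTwoModel c D E b o N) (c' : Color) :
    E.curves c' = N c' ∪ o '' D.curves c' := by
  rw [PartialHeegaardDiagram.curves, M.circles, M.arcs, Set.insert_union, Set.sUnion_insert,
    ← Set.image_union, ← Set.image_sUnion]
  rfl

/-- The curves of `E` are pairwise disjoint, and the new circle is none of the carried ones since it
leaves `o.target`. -/
theorem disjoint_image (M : OneTwoModel c D E b o N) (c' : Color) :
    Disjoint (N c') (o '' D.curves c') := by
  rw [PartialHeegaardDiagram.curves, Set.image_sUnion, Set.disjoint_sUnion_right]
  rintro _ ⟨A, hA, rfl⟩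
  have hAE : o '' A ∈ E.circles c' ∪ E.arcs c' := by
    rw [M.circles, M.arcs]
    exact hA.imp (fun hA => Or.inr ⟨A, hA, rfl⟩) fun hA => ⟨A, hA, rfl⟩
  refine E.disjoint c' (Or.inl (M.mem_circles c')) hAE fun hNA => M.not_subset c' ?_
  rw [hNA]
  rintro _ ⟨p, hp, rfl⟩
  exact o.map_source (M.curves_subset c' (D.subset_curves hA hp))

theorem curves_diff (M : OneTwoModel c D E b o N) (c' : Color) :
    E.curves c' \ N c' = o '' D.curves c' := by
  rw [M.curves_eq, Set.union_sdiff_left]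
  exact (M.disjoint_image c').symm.sdiff_eq_left

theorem bdry_subset_target (M : OneTwoModel c D E b o N) : T.bdry ⊆ o.target := by
  intro t ht
  have h1 : t ∈ b.target := M.b_target ▸ ht
  have h2 : b.symm t ∈ S.bdry := M.b_source ▸ b.map_target h1
  rw [← b.right_inv h1, M.b_eqOn h2]
  exact o.map_source (M.bdry_subset h2)

theorem b_symm_eqOn (M : OneTwoModel c D E b o N) : Set.EqOn b.symm o.symm T.bdry := by
  intro t ht
  have h1 : t ∈ b.target := M.b_target ▸ ht
  have h2 : b.symm t ∈ S.bdry := M.b_source ▸ b.map_target h1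
  have h3 : o (b.symm t) = t := by rw [← M.b_eqOn h2, b.right_inv h1]
  conv_rhs => rw [← h3, o.left_inv (M.bdry_subset h2)]

/-- The surgery on a glued surface given by a stabilization of the left piece. -/
noncomputable def surgery (M : OneTwoModel c D E b o N) {φ : PartialEquiv S S'}
    {i : PartialEquiv S S''} {i' : PartialEquiv S' S''} (G : SurfaceGluing φ i i') :
    Surgery S S' S'' T where
  φ := φ
  i := i
  i' := i'
  o := o
  b := b
  base := M.nonempty_right.some
  gluing := G
  diffeo := M.diffeo
  isOpen_source := M.isOpen_source
  isOpen_target := M.isOpen_target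
  b_source := M.b_source
  b_target := M.b_target
  b_eqOn := M.b_eqOn
  bdry_subset := M.bdry_subset

/-- The surgery on a glued surface given by a destabilization of the left piece. -/
noncomputable def surgerySymm (M : OneTwoModel c D E b o N) {ψ : PartialEquiv T S'}
    {j : PartialEquiv T T''} {j' : PartialEquiv S' T''} (G : SurfaceGluing ψ j j') :
    Surgery T S' T'' S where
  φ := ψ
  i := j
  i' := j'
  o := o.symm
  b := b.symm
  base := M.nonempty_left.some
  gluing := G
  diffeo := M.diffeo.symm M.isOpen_source M.isOpen_target
  isOpen_source := M.isOpen_target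
  isOpen_target := M.isOpen_source
  b_source := M.b_target
  b_target := M.b_source
  b_eqOn := M.b_symm_eqOn
  bdry_subset := M.bdry_subset_target

theorem endpoints_eq (M : OneTwoModel c D E b o N) {φ : PartialEquiv S S'}
    {i : PartialEquiv S S''} {i' : PartialEquiv S' S''} (G : SurfaceGluing φ i i') (c' : Color) :
    E.endpoints c' = o '' D.endpoints c' := by
  have hs : ⋃₀ D.arcs c' ⊆ o.source :=
    (Set.sUnion_mono Set.subset_union_right).trans (M.curves_subset c')
  rw [PartialHeegaardDiagram.endpoints, M.arcs, ← Set.image_sUnion]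
  ext t
  constructor
  · rintro ⟨⟨p, hp, rfl⟩, hb⟩
    exact ⟨p, ⟨hp, ((M.surgery G).mem_bdry_iff (hs hp)).1 hb⟩, rfl⟩
  · rintro ⟨p, ⟨hp, hb⟩, rfl⟩
    exact ⟨⟨p, hp, rfl⟩, ((M.surgery G).mem_bdry_iff (hs hp)).2 hb⟩

end OneTwoModel

section OneTwo

variable {S S' S'' T T'' : OrientedSurface.{u}} {c : Color} {D : PartialHeegaardDiagram S}
  {E : PartialHeegaardDiagram T} {D' : PartialHeegaardDiagram S'} {b : PartialEquiv S T}

theorem IsGluing.of_isOneTwoStabilization {D'' : PartialHeegaardDiagram S''}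
    {φ : PartialEquiv S S'} {i : PartialEquiv S S''} {i' : PartialEquiv S' S''}
    (h : IsGluing D D' φ D'' i i') (hDE : IsOneTwoStabilization c D E b) :
    ∃ (T'' : OrientedSurface.{u}) (E'' : PartialHeegaardDiagram T'') (j : PartialEquiv T T'')
      (j' : PartialEquiv S' T'') (b'' : PartialEquiv S'' T''),
      IsGluing E D' (b.symm.trans φ) E'' j j' ∧ IsOneTwoStabilization c D'' E'' b'' ∧
      (∀ p ∈ S.bdry \ φ.source, b'' (i p) = j (b p)) ∧
      (∀ q ∈ S'.bdry \ φ.target, b'' (i' q) = j' q) := by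
  obtain ⟨o, N, M⟩ := hDE.exists_model
  have G := h.surfaceGluing
  have H : IsSurgery i i' o (M.surgery G).j (M.surgery G).j' (M.surgery G).keep' :=
    (M.surgery G).isSurgery
  have G' : SurfaceGluing (b.symm.trans φ) (M.surgery G).j (M.surgery G).j' :=
    (M.surgery G).gluing_result
  have hm : IsGluingMap E D' (b.symm.trans φ) :=
    (M.surgery G).isGluingMap h.isGluingMap fun c' => M.endpoints_eq G c'
  -- From here on only the surgery and gluing relations matter, so the construction of the surface
  -- is forgotten.
  generalize (M.surgery G).result = T'', (M.surgery G).j = j, (M.surgery G).j' = j',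
    (M.surgery G).keep' = r at H G'
  have hsub : ∀ c', ∀ A ∈ D''.circles c' ∪ D''.arcs c', A ⊆ r.source := by
    intro c' A hA
    refine (D''.subset_curves hA).trans ?_
    rw [h.curves]
    exact H.union_subset_source (M.curves_subset c') _
  have hNs : ∀ c', IsSmoothCircle (j '' N c') := fun c' =>
    (E.isSmoothCircle c' _ (M.mem_circles c')).image G'.left G'.isOpen_source
      fun p _ => G'.mem_source p
  have hcur : ∀ c', r '' D''.curves c' = j '' (o '' D.curves c') ∪ j' '' D'.curves c' := by
    intro c'
    rw [h.curves, H.image_union (M.curves_subset c')]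
  obtain ⟨E'', h1, h2, h3, h4⟩ := exists_gluedDiagram G' hm
    (fun c' => insert (j '' N c') ((fun A => r '' A) '' D''.circles c'))
    (fun c' => (fun A => r '' A) '' D''.arcs c')
    (fun c' => ((D''.circles_finite c').image _).insert _) (fun c' => (D''.arcs_finite c').image _)
    (by
      rintro c' _ (rfl | ⟨A, hA, rfl⟩)
      · exact hNs c'
      · exact (D''.isSmoothCircle c' A hA).image H.diffeo H.isOpen_source (hsub c' A (Or.inl hA)))
    (by
      rintro c' _ ⟨A, hA, rfl⟩
      have hs := hsub c' A (Or.inr hA)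
      exact (D''.isSmoothArc c' A hA).image H.diffeo H.isOpen_source hs
        fun p hp => H.mem_bdry_iff p (hs hp))
    (by
      intro c'
      rw [Set.insert_union, ← Set.image_union]
      refine ((D''.disjoint c').image_image r.injOn (hsub c')).insert_of_disjoint ?_
      rw [← Set.image_sUnion]
      change Disjoint _ (r '' D''.curves c')
      rw [hcur, Set.disjoint_union_right]
      refine ⟨(Set.disjoint_image_iff G'.injective).2 (M.disjoint_image c'), ?_⟩
      rw [Set.disjoint_left]
      rintro _ ⟨t, ht, rfl⟩ ⟨q, -, hq⟩
      exact G'.ne_of_mem_inner ((E.isSmoothCircle c' _ (M.mem_circles c')).subset_inner ht) q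
        hq.symm)
    (by
      intro c'
      rw [Set.insert_union, Set.sUnion_insert, ← Set.image_union, ← Set.image_sUnion]
      change _ ∪ r '' D''.curves c' = _
      rw [hcur, M.curves_eq, Set.image_union, Set.union_assoc])
  have hs := H.bdry_subset G M.bdry_subset
  have ht := H.symm.bdry_subset G' M.bdry_subset_target
  refine ⟨T'', E'', j, j', r.restr S''.bdry, h4, M.glue h h4 H (fun c' => by rw [h1])
    (fun c' => by rw [h2]) (H.restr_source hs) (H.restr_target ht) (fun _ _ => rfl), ?_,
    fun q _ => H.right q⟩
  intro p hp
  rw [M.b_eqOn hp.1]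
  exact H.left p (M.bdry_subset hp.1)

/-- Surgery along the inverse of `o` replaces the handle by the two disks. The new circles are
circles of `E''`; once they are deleted, every remaining curve lies where `r` is defined and is
carried over. -/
theorem IsGluing.of_isOneTwoDestabilization {E'' : PartialHeegaardDiagram T''}
    {ψ : PartialEquiv T S'} {j : PartialEquiv T T''} {j' : PartialEquiv S' T''}
    (h : IsGluing E D' ψ E'' j j') (hDE : IsOneTwoStabilization c D E b) :
    ∃ (S'' : OrientedSurface.{u}) (D'' : PartialHeegaardDiagram S'') (i : PartialEquiv S S'')
      (i' : PartialEquiv S' S'') (b'' : PartialEquiv S'' T''),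
      IsGluing D D' (b.symm.symm.trans ψ) D'' i i' ∧ IsOneTwoStabilization c D'' E'' b'' ∧
      (∀ t ∈ T.bdry \ ψ.source, b''.symm (j t) = i (b.symm t)) ∧
      (∀ q ∈ S'.bdry \ ψ.target, b''.symm (j' q) = i' q) := by
  obtain ⟨o, N, M⟩ := hDE.exists_model
  have G := h.surfaceGluing
  have H₀ : IsSurgery j j' o.symm (M.surgerySymm G).j (M.surgerySymm G).j'
    (M.surgerySymm G).keep' := (M.surgerySymm G).isSurgery
  have G' : SurfaceGluing (b.symm.symm.trans ψ) (M.surgerySymm G).j (M.surgerySymm G).j' :=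
    (M.surgerySymm G).gluing_result
  have hep : ∀ c', D.endpoints c' = o.symm '' E.endpoints c' := by
    intro c'
    rw [M.endpoints_eq G', PartialEquiv.symm_image_image_of_subset_source]
    rw [D.endpoints_eq]
    exact Set.inter_subset_left.trans (M.curves_subset c')
  have hm : IsGluingMap D D' (b.symm.symm.trans ψ) :=
    (M.surgerySymm G).isGluingMap h.isGluingMap hep
  generalize (M.surgerySymm G).result = S'', (M.surgerySymm G).j = i, (M.surgerySymm G).j' = i',
    (M.surgerySymm G).keep' = r at H₀ G'
  -- Seen backwards, the surgery is a stabilization from `D''` to `E''`, which is the form required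
  -- by `M.glue`.
  have H : IsSurgery i i' o j j' r.symm := H₀.symm
  have hN'' : ∀ c', j '' N c' ∈ E''.circles c' := fun c' => h.image_mem_circles (M.mem_circles c')
  have hcd : ∀ c', E''.curves c' \ (j '' N c') = j '' (o '' D.curves c') ∪ j' '' D'.curves c' := by
    intro c'
    rw [h.curves_diff (E.isSmoothCircle c' _ (M.mem_circles c')).subset_inner, M.curves_diff]
  have himg : ∀ c', o '' D.curves c' ⊆ o.target := by
    rintro c' _ ⟨p, hp, rfl⟩
    exact o.map_source (M.curves_subset c' hp)
  have hsub : ∀ c', ∀ A ∈ E''.circles c' \ {j '' N c'} ∪ E''.arcs c', A ⊆ r.source := by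
    intro c' A hA
    refine (Set.subset_sUnion_of_mem hA).trans ?_
    rw [E''.sUnion_diff_circle (hN'' c'), hcd]
    exact H₀.union_subset_source (himg c') _
  have hinv : ∀ c', ∀ A ∈ E''.circles c' \ {j '' N c'} ∪ E''.arcs c', r.symm '' (r '' A) = A :=
    fun c' A hA => r.symm_image_image_of_subset_source (hsub c' A hA)
  obtain ⟨D'', h1, h2, h3, h4⟩ := exists_gluedDiagram G' hm
    (fun c' => (fun A => r '' A) '' (E''.circles c' \ {j '' N c'}))
    (fun c' => (fun A => r '' A) '' E''.arcs c')
    (fun c' => ((E''.circles_finite c').subset Set.sdiff_subset).image _)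
    (fun c' => (E''.arcs_finite c').image _)
    (by
      rintro c' _ ⟨A, hA, rfl⟩
      exact (E''.isSmoothCircle c' A hA.1).image H₀.diffeo H₀.isOpen_source
        (hsub c' A (Or.inl hA)))
    (by
      rintro c' _ ⟨A, hA, rfl⟩
      have hs := hsub c' A (Or.inr hA)
      exact (E''.isSmoothArc c' A hA).image H₀.diffeo H₀.isOpen_source hs
        fun p hp => H₀.mem_bdry_iff p (hs hp))
    (by
      intro c'
      rw [← Set.image_union]
      exact ((E''.disjoint c').subset
        (Set.union_subset_union_left _ Set.sdiff_subset)).image_image r.injOn (hsub c'))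
    (by
      intro c'
      rw [← Set.image_union, ← Set.image_sUnion, E''.sUnion_diff_circle (hN'' c'), hcd,
        H₀.image_union (himg c'), o.symm_image_image_of_subset_source (M.curves_subset c')])
  have hs := H.bdry_subset G' M.bdry_subset
  have ht := H₀.bdry_subset G M.bdry_subset_target
  refine ⟨S'', D'', i, i', r.symm.restr S''.bdry, h4, M.glue h4 h H (fun c' => ?_)
    (fun c' => ?_) (H.restr_source hs) (H.restr_target ht) (fun _ _ => rfl), ?_,
    fun q _ => H₀.right q⟩
  · rw [h1, Set.image_image]
    have : (fun A => r.symm '' (r '' A)) '' (E''.circles c' \ {j '' N c'}) =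
        id '' (E''.circles c' \ {j '' N c'}) :=
      Set.image_congr fun A hA => hinv c' A (Or.inl hA)
    rw [this, Set.image_id, Set.insert_sdiff_singleton, Set.insert_eq_of_mem (hN'' c')]
  · rw [h2, Set.image_image]
    have : (fun A => r.symm '' (r '' A)) '' E''.arcs c' = id '' E''.arcs c' :=
      Set.image_congr fun A hA => hinv c' A (Or.inr hA)
    rw [this, Set.image_id]
  · intro t ht'
    rw [M.b_symm_eqOn ht'.1]
    exact H₀.left t (M.bdry_subset_target ht'.1)

end OneTwo

/-! ### Sequences of moves and the two-sided statement -/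

section

variable {S S' S'' T T' : OrientedSurface.{u}} {D : PartialHeegaardDiagram S}
  {D' : PartialHeegaardDiagram S'} {D'' : PartialHeegaardDiagram S''}
  {E : PartialHeegaardDiagram T} {E' : PartialHeegaardDiagram T'}

theorem HeegaardMove.source_eq {k : MoveKind} {b : PartialEquiv S T} (h : HeegaardMove k D E b) :
    b.source = S.bdry := by
  cases h with
  | oneTwoStabilization h =>
    obtain ⟨e, s, o, g, h⟩ := h
    tauto
  | oneTwoDestabilization h =>
    obtain ⟨e, s, o, g, h⟩ := h
    rw [PartialEquiv.symm_source]
    tauto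
  | _ => rfl

theorem HeegaardMove.target_eq {k : MoveKind} {b : PartialEquiv S T} (h : HeegaardMove k D E b) :
    b.target = T.bdry := by
  cases h with
  | oneTwoStabilization h =>
    obtain ⟨e, s, o, g, h⟩ := h
    tauto
  | oneTwoDestabilization h =>
    obtain ⟨e, s, o, g, h⟩ := h
    rw [PartialEquiv.symm_target]
    tauto
  | _ => rfl

theorem HeegaardMoves.source_eq {L : List MoveKind} {b : PartialEquiv S T}
    (h : HeegaardMoves L D E b) : b.source = S.bdry := by
  induction h with
  | refl => rfl
  | isotopic _ _ ih => exact ih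
  | move h _ ih =>
    rw [PartialEquiv.trans_source_of_subset, h.source_eq]
    rw [h.target_eq, ih]

theorem HeegaardMoves.target_eq {L : List MoveKind} {b : PartialEquiv S T}
    (h : HeegaardMoves L D E b) : b.target = T.bdry := by
  induction h with
  | refl => rfl
  | isotopic _ _ ih => exact ih
  | move h hs ih =>
    rw [PartialEquiv.trans_target, h.target_eq, ← hs.source_eq, ← ih]
    exact Set.inter_eq_left.2 fun x hx => PartialEquiv.map_target _ hx

theorem HeegaardMoves.append {R : OrientedSurface.{u}} {F : PartialHeegaardDiagram R}
    {L L' : List MoveKind} {b : PartialEquiv S T} {b' : PartialEquiv T R}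
    (h : HeegaardMoves L D E b) (h' : HeegaardMoves L' E F b') :
    HeegaardMoves (L ++ L') D F (b.trans b') := by
  induction h with
  | @refl S D =>
    have : (PartialEquiv.ofSet S.bdry).trans b' = b' :=
      PartialEquiv.ofSet_symm_trans h'.source_eq.subset
    rwa [this]
  | isotopic hi _ ih => exact .isotopic hi (ih h')
  | move hm _ ih =>
    rw [PartialEquiv.trans_assoc]
    exact .move hm (ih h')

theorem IsGluing.of_heegaardMove {φ : PartialEquiv S S'} {i : PartialEquiv S S''}
    {i' : PartialEquiv S' S''} (h : IsGluing D D' φ D'' i i') {k : MoveKind}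
    {b : PartialEquiv S T} (hm : HeegaardMove k D E b) :
    ∃ (T'' : OrientedSurface.{u}) (E'' : PartialHeegaardDiagram T'') (j : PartialEquiv T T'')
      (j' : PartialEquiv S' T'') (b'' : PartialEquiv S'' T''),
      IsGluing E D' (b.symm.trans φ) E'' j j' ∧ HeegaardMove k D'' E'' b'' ∧
      (∀ p ∈ S.bdry \ φ.source, b'' (i p) = j (b p)) ∧
      (∀ q ∈ S'.bdry \ φ.target, b'' (i' q) = j' q) := by
  cases hm with
  | isotopy hm =>
    obtain ⟨E'', h₁, h₂⟩ := h.of_isIsotopyMove hm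
    rw [PartialEquiv.ofSet_symm_trans h.isGluingMap.source_subset]
    exact ⟨_, E'', i, i', _, h₁, .isotopy h₂, fun _ _ => rfl, fun _ _ => rfl⟩
  | oneTwoStabilization hm =>
    obtain ⟨T'', E'', j, j', b'', h₁, h₂, h₃⟩ := h.of_isOneTwoStabilization hm
    exact ⟨T'', E'', j, j', b'', h₁, .oneTwoStabilization h₂, h₃⟩
  | oneTwoDestabilization hm =>
    obtain ⟨T'', E'', j, j', b'', h₁, h₂, h₃⟩ := h.of_isOneTwoDestabilization hm
    exact ⟨T'', E'', j, j', b''.symm, h₁, .oneTwoDestabilization h₂, h₃⟩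
  | zeroThreeStabilization hm =>
    obtain ⟨E'', h₁, h₂⟩ := h.of_isZeroThreeStabilization hm
    rw [PartialEquiv.ofSet_symm_trans h.isGluingMap.source_subset]
    exact ⟨_, E'', i, i', _, h₁, .zeroThreeStabilization h₂, fun _ _ => rfl, fun _ _ => rfl⟩
  | zeroThreeDestabilization hm =>
    obtain ⟨E'', h₁, h₂⟩ := h.of_isZeroThreeDestabilization hm
    rw [PartialEquiv.ofSet_symm_trans h.isGluingMap.source_subset]
    exact ⟨_, E'', i, i', _, h₁, .zeroThreeDestabilization h₂, fun _ _ => rfl, fun _ _ => rfl⟩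
  | handleslide hm =>
    obtain ⟨E'', h₁, h₂⟩ := h.of_isHandleslide hm
    rw [PartialEquiv.ofSet_symm_trans h.isGluingMap.source_subset]
    exact ⟨_, E'', i, i', _, h₁, .handleslide h₂, fun _ _ => rfl, fun _ _ => rfl⟩

theorem PartialEquiv.mem_diff_symm_trans_source {α β γ : Type*} {b : PartialEquiv α β}
    {φ : PartialEquiv α γ} {A : Set α} {B : Set β} (hb : b.source = A) (hB : b.target = B) {p : α}
    (hp : p ∈ A \ φ.source) : b p ∈ B \ (b.symm.trans φ).source := by
  have hpb : p ∈ b.source := hb ▸ hp.1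
  refine ⟨hB ▸ b.map_source hpb, fun h => hp.2 ?_⟩
  have h₂ : b.symm (b p) ∈ φ.source := h.2
  rwa [b.left_inv hpb] at h₂

/-- Heegaard moves of the left piece induce Heegaard moves of the glued diagram. -/
theorem IsGluing.of_heegaardMoves {L : List MoveKind} {b : PartialEquiv S T}
    (hL : HeegaardMoves L D E b) {φ : PartialEquiv S S'} {i : PartialEquiv S S''}
    {i' : PartialEquiv S' S''} (h : IsGluing D D' φ D'' i i') :
    ∃ (T'' : OrientedSurface.{u}) (E'' : PartialHeegaardDiagram T'') (j : PartialEquiv T T'')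
      (j' : PartialEquiv S' T'') (b'' : PartialEquiv S'' T''),
      IsGluing E D' (b.symm.trans φ) E'' j j' ∧ HeegaardMoves L D'' E'' b'' ∧
      (∀ p ∈ S.bdry \ φ.source, b'' (i p) = j (b p)) ∧
      (∀ q ∈ S'.bdry \ φ.target, b'' (i' q) = j' q) := by
  induction hL generalizing S'' with
  | refl D =>
    rw [PartialEquiv.ofSet_symm_trans h.isGluingMap.source_subset]
    exact ⟨_, D'', i, i', _, h, .refl D'', fun _ _ => rfl, fun _ _ => rfl⟩
  | isotopic hi _ ih =>
    obtain ⟨i₁, h₁, hi₁⟩ := h.of_isIsotopicRelBdry hi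
    obtain ⟨T'', E'', j, j', b'', h₂, hs, h₃, h₄⟩ := ih h₁
    -- The changed embedding `i₁` has the boundary values of `i`, so the compatibility with `b''` is
    -- unaffected.
    exact ⟨T'', E'', j, j', b'', h₂, hs, fun p hp => hi₁ p hp.1 ▸ h₃ p hp, h₄⟩
  | @move _ _ _ _ _ _ _ _ b₁ b hm _ ih =>
    obtain ⟨S₁'', D₁'', i₁, i₁', b₁'', h₁, hm'', h₂, h₃⟩ := h.of_heegaardMove hm
    obtain ⟨T'', E'', j, j', b'', h₄, hs'', h₅, h₆⟩ := ih h₁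
    refine ⟨T'', E'', j, j', b₁''.trans b'', ?_, .move hm'' hs'', fun p hp => ?_, fun q hq => ?_⟩
    · rwa [PartialEquiv.trans_symm_eq_symm_trans_symm, PartialEquiv.trans_assoc]
    · change b'' (b₁'' (i p)) = j (b (b₁ p))
      rw [h₂ p hp, h₅ _ (PartialEquiv.mem_diff_symm_trans_source hm.source_eq hm.target_eq hp)]
    · change b'' (b₁'' (i' q)) = j' q
      rw [h₃ q hq, h₆ q ⟨hq.1, fun h' => hq.2 h'.1⟩]

end

theorem mainTheorem2 {S S' S'' T T' : OrientedSurface.{u}}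
    (D : PartialHeegaardDiagram S) (D' : PartialHeegaardDiagram S')
    (D'' : PartialHeegaardDiagram S'')
    (E : PartialHeegaardDiagram T) (E' : PartialHeegaardDiagram T')
    (L L' : List MoveKind) (b : PartialEquiv S T) (b' : PartialEquiv S' T')
    (hL : HeegaardMoves L D E b) (hL' : HeegaardMoves L' D' E' b')
    (φ : PartialEquiv S S') (i : PartialEquiv S S'') (i' : PartialEquiv S' S'')
    (hglue : IsGluing D D' φ D'' i i') :
    ∃ (T'' : OrientedSurface.{u}) (E'' : PartialHeegaardDiagram T'')
      (j : PartialEquiv T T'') (j' : PartialEquiv T' T'') (b'' : PartialEquiv S'' T''),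
      IsGluing E E' (b.symm.trans (φ.trans b')) E'' j j' ∧
      HeegaardMoves (L ++ L') D'' E'' b'' ∧
      (∀ p ∈ S.bdry \ φ.source, b'' (i p) = j (b p)) ∧
      (∀ p ∈ S'.bdry \ φ.target, b'' (i' p) = j' (b' p)) := by
  obtain ⟨S₁, D₁, j₁, j₁', b₁, h₁, hs₁, h₂, h₃⟩ := hglue.of_heegaardMoves hL
  -- With the sides exchanged, `D'` is the left piece and the already modified `E` is the piece that
  -- stays fixed.
  obtain ⟨T'', E'', j', j, b₂, h₄, hs₂, h₅, h₆⟩ := h₁.symm.of_heegaardMoves hL'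
  refine ⟨T'', E'', j, j', b₁.trans b₂, ?_, hs₁.append hs₂, fun p hp => ?_, fun q hq => ?_⟩
  -- Exchanging the sides back inverts the gluing map, which turns into `φ` preceded by the inverse
  -- of `b` and followed by `b'`.
  · have h := h₄.symm
    rwa [PartialEquiv.trans_symm_eq_symm_trans_symm, PartialEquiv.symm_symm, PartialEquiv.symm_symm,
      PartialEquiv.trans_assoc] at h
  · change b₂ (b₁ (i p)) = j (b p)
    rw [h₂ p hp, h₆ _ (PartialEquiv.mem_diff_symm_trans_source hL.source_eq hL.target_eq hp)]
  · change b₂ (b₁ (i' q)) = j' (b' q)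
    rw [h₃ q hq, h₅ q ⟨hq.1, fun h' => hq.2 h'.1⟩]
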